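/- All vector spaces, Lie algebras and tensor products are over $\mathbb C$. Let $\mathfrak g=\mathfrak g(C)$ be the Kac–Moody algebra of a generalized Cartan matrix $C$, with Cartan subalgebra $\mathfrak h$ and positive part $N^+$ (generated by the Chevalley generators $e_i$). Put $\mathfrak g'=[\mathfrak g,\mathfrak g]$, $\mathfrak h'=\mathfrak h\cap\mathfrak g'$, and let $\mathfrak h''$ be any subspace with $\mathfrak h=\mathfrak h'\oplus\mathfrak h''$. Let $A=\mathbb C[t_1^{\pm1},\dots,t_n^{\pm1}]$, $t^m=t_1^{m_1}\cdots t_n^{m_n}$ for $m\in\mathbb Z^n$, and $$\mathfrak g_A=\mathfrak g'\otimes A\oplus\mathfrak h'',\qquad \mathfrak h_A=\mathfrak h'\otimes A\oplus\mathfrak h'',$$ with brackets $[X\otimes a,Y\otimes b]=[X,Y]\otimes ab$, $[h,X\otimes a]=[h,X]\otimes a$, $[h,\tilde h]=0$ for $X,Y\in\mathfrak g'$, $a,b\in A$, $h,\tilde h\in\mathfrak h''$. For a linear map $\chi:\mathfrak h_A\to\mathbb C$ let $M(\chi)$ be the $\mathfrak g_A$-module induced from the one-dimensional $((N^+\otimes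 A)\oplus\mathfrak h_A)$-module on which $N^+\otimes A$ acts by $0$ and $\mathfrak h_A$ acts by $\chi$, and let $V(\chi)$ be the quotient of $M(\chi)$ by the sum of its proper submodules. Write $\chi_h(m)=\chi(h\otimes t^m)$ for $h\in\mathfrak h'$, $m\in\mathbb Z^n$. A function $f:\mathbb Z^n\to\mathbb C$ is exp-polynomial with exponents in $S\subseteq(\mathbb C^*)^n$ if it is a finite sum of terms $c\,m_1^{\ell_1}\cdots m_n^{\ell_n}\lambda_1^{m_1}\cdots\lambda_n^{m_n}$ with $c\in\mathbb C$, $\ell\in\mathbb N^n$, $\lambda\in S$; $\chi$ is called exp-polynomial (with exponents in $S$) if $\chi_h$ is so for every $h\in\mathfrak h'$. If $S$ is not mentioned, $S=(\mathbb C^*)^n$. Let $\psi:\mathfrak h_A\to\mathbb C$ be an exp-polynomial map, and assume that the subalgebra $A_\psi$ of $A$ generated by all $\psi(h\otimes t^m)\,t^m$ ($h\in\mathfrak h'$, $m\in\mathbb Z^n$) is $\mathbb C[t_1^{\pm r_1},\dots,t_n^{\pm r_n}]$ for positive integers $r_1,\dots,r_n$. Let $R=r_1\cdots r_n$, let $\overline\Gamma=\mathbb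 Z/r_1\mathbb Z\oplus\cdots\oplus\mathbb Z/r_n\mathbb Z$ (a group of order $R$), and let $\xi_i$ be a primitive $r_i$-th root of unity. Let $\overline\Gamma$ act on $(\mathbb C^*)^n$ by $k\cdot\lambda=(\xi_1^{k_1}\lambda_1,\dots,\xi_n^{k_n}\lambda_n)$ and let $B$ be a set of representatives of the orbits. For $k\in\overline\Gamma$ and a linear map $\Phi:\mathfrak h_A\to\mathbb C$ define $\xi^k\Phi$ by $(\xi^k\Phi)(h\otimes t^m)=\xi_1^{k_1m_1}\cdots\xi_n^{k_nm_n}\Phi(h\otimes t^m)$ for $h\in\mathfrak h'$ and $\xi^k\Phi=\Phi$ on $\mathfrak h''$. Then there is an exp-polynomial map $\Phi$ with exponents in $B$ such that $\psi=\sum_{k\in\overline\Gamma}\xi^k\Phi$. For every such $\Phi$, each of the $R$ highest weight modules $V(\xi^k\Phi)$, $k\in\overline\Gamma$, is irreducible, and $$V(\psi)\;\cong\;\bigotimes_{k\in\overline\Gamma}V(\xi^k\Phi)\qquad\text{as }\mathfrak g_A\text{-modules.}$$ -/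

import Mathlib

open scoped TensorProduct

noncomputable section

namespace LoopKM

universe u v

/-! ### Kac-Moody algebras -/

/-- Generalized Cartan matrices. -/
structure IsGCM {ι : Type u} (C : Matrix ι ι ℤ) : Prop where
  diag : ∀ i, C i i = 2
  nonpos : ∀ i j, i ≠ j → C i j ≤ 0
  zero_symm : ∀ i j, C i j = 0 → C j i = 0

/-- A (minimal) realization of the `N × N` matrix `C` over `ℂ`: a finite-dimensional space `H`
of dimension `2N - rank C`, linearly independent simple roots in the dual of `H`, and linearly
independent simple coroots in `H`, with `⟨coroot i, root j⟩ = C i j`. -/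
structure Realization {ι : Type u} [Fintype ι] (C : Matrix ι ι ℤ) (H : Type v)
    [AddCommGroup H] [Module ℂ H] where
  root : ι → Module.Dual ℂ H
  coroot : ι → H
  finiteDimensional : FiniteDimensional ℂ H
  linearIndependent_root : LinearIndependent ℂ root
  linearIndependent_coroot : LinearIndependent ℂ coroot
  root_coroot : ∀ i j, root j (coroot i) = (C i j : ℂ)
  finrank_add_rank :
    Module.finrank ℂ H + (C.map (Int.cast : ℤ → ℂ)).rank = 2 * Fintype.card ι

/-- Generators of a Kac-Moody algebra: all elements of `H`, and `e i`, `f i`. -/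
inductive Gen (ι : Type u) (H : Type v) : Type (max u v)
  | h : H → Gen ι H
  | e : ι → Gen ι H
  | f : ι → Gen ι H

section KacMoody

variable {ι : Type u} [Fintype ι] {C : Matrix ι ι ℤ} {H : Type v} [AddCommGroup H] [Module ℂ H]

/-- The generators, in the free Lie algebra. -/
abbrev gen {ι : Type u} {H : Type v} (x : Gen ι H) : FreeLieAlgebra ℂ (Gen ι H) :=
  FreeLieAlgebra.of ℂ x

/-- The defining relations of the auxiliary algebra `g̃(C)`; the first two say that `H` embeds
linearly. -/
inductive Rel {ι : Type u} [Fintype ι] {C : Matrix ι ι ℤ} {H : Type v} [AddCommGroup H]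
    [Module ℂ H] (Z : Realization C H) : FreeLieAlgebra ℂ (Gen ι H) → Prop
  | add (x y : H) : Rel Z (gen (ι := ι) (.h (x + y)) - gen (ι := ι) (.h x) - gen (ι := ι) (.h y))
  | smul (c : ℂ) (x : H) : Rel Z (gen (ι := ι) (.h (c • x)) - c • gen (ι := ι) (.h x))
  | hh (x y : H) : Rel Z ⁅gen (ι := ι) (.h x), gen (ι := ι) (.h y)⁆
  | he (x : H) (i : ι) : Rel Z (⁅gen (ι := ι) (.h x), gen (H := H) (.e i)⁆ - Z.root i x • gen (H := H) (.e i))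
  | hf (x : H) (i : ι) : Rel Z (⁅gen (ι := ι) (.h x), gen (H := H) (.f i)⁆ + Z.root i x • gen (H := H) (.f i))
  | ef_same (i : ι) : Rel Z (⁅gen (H := H) (.e i), gen (H := H) (.f i)⁆ - gen (ι := ι) (.h (Z.coroot i)))
  | ef_ne (i j : ι) (hij : i ≠ j) : Rel Z ⁅gen (H := H) (.e i), gen (H := H) (.f j)⁆

/-- The ideal generated by the defining relations. -/
def relIdeal (Z : Realization C H) : LieIdeal ℂ (FreeLieAlgebra ℂ (Gen ι H)) :=
  LieSubmodule.lieSpan ℂ _ {x | Rel Z x}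

/-- The auxiliary Lie algebra `g̃(C)`. -/
def Aux (Z : Realization C H) := FreeLieAlgebra ℂ (Gen ι H) ⧸ relIdeal Z

instance (Z : Realization C H) : LieRing (Aux Z) :=
  inferInstanceAs (LieRing (FreeLieAlgebra ℂ (Gen ι H) ⧸ relIdeal Z))

instance (Z : Realization C H) : LieAlgebra ℂ (Aux Z) :=
  inferInstanceAs (LieAlgebra ℂ (FreeLieAlgebra ℂ (Gen ι H) ⧸ relIdeal Z))

/-- The image of a generator in `g̃(C)`. -/
def auxGen (Z : Realization C H) (x : Gen ι H) : Aux Z :=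
  LieSubmodule.Quotient.mk (N := relIdeal Z) (gen x)

/-- The Cartan subalgebra of `g̃(C)`, as a subspace. -/
def auxCartan (Z : Realization C H) : Submodule ℂ (Aux Z) :=
  Submodule.span ℂ (Set.range fun x : H => auxGen Z (.h x))

/-- The sum of all ideals of `g̃(C)` that intersect the Cartan subalgebra trivially. -/
def maxIdeal (Z : Realization C H) : LieIdeal ℂ (Aux Z) :=
  sSup {I : LieIdeal ℂ (Aux Z) | I.toSubmodule ⊓ auxCartan Z = ⊥}

/-- The Kac-Moody algebra `g = g(C)`. -/
def KM (Z : Realization C H) := Aux Z ⧸ maxIdeal Z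

instance (Z : Realization C H) : LieRing (KM Z) :=
  inferInstanceAs (LieRing (Aux Z ⧸ maxIdeal Z))

instance (Z : Realization C H) : LieAlgebra ℂ (KM Z) :=
  inferInstanceAs (LieAlgebra ℂ (Aux Z ⧸ maxIdeal Z))

/-- The image of a generator in `g`. -/
def kmGen (Z : Realization C H) (x : Gen ι H) : KM Z :=
  LieSubmodule.Quotient.mk (N := maxIdeal Z) (auxGen Z x)

/-- The Cartan subalgebra `h` of `g`. -/
def cartan (Z : Realization C H) : Submodule ℂ (KM Z) :=
  Submodule.span ℂ (Set.range fun x : H => kmGen Z (.h x))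

/-- `N⁺`, the subalgebra of `g` generated by the `e i`. -/
def nPos (Z : Realization C H) : LieSubalgebra ℂ (KM Z) :=
  LieSubalgebra.lieSpan ℂ (KM Z) (Set.range fun i : ι => kmGen Z (.e i))

/-- `g' = [g, g]`. -/
def derived (Z : Realization C H) : LieIdeal ℂ (KM Z) :=
  ⁅(⊤ : LieIdeal ℂ (KM Z)), (⊤ : LieIdeal ℂ (KM Z))⁆

/-- `h' = h ∩ g'`. -/
def cartan' (Z : Realization C H) : Submodule ℂ (KM Z) :=
  cartan Z ⊓ (derived Z).toSubmodule

/-- `h''` is a complement of `h'` in `h`. -/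
def IsCartanCompl (Z : Realization C H) (H2 : Submodule ℂ (KM Z)) : Prop :=
  cartan' Z ⊓ H2 = ⊥ ∧ cartan' Z ⊔ H2 = cartan Z

end KacMoody

/-! ### Loop Kac-Moody algebras -/

/-- The Laurent polynomials `A = ℂ[t₁^{±1}, …, tₙ^{±1}]`, the group algebra of `ℤⁿ`. -/
def Laurent (n : ℕ) := AddMonoidAlgebra ℂ (Fin n → ℤ)

instance (n : ℕ) : CommRing (Laurent n) :=
  inferInstanceAs (CommRing (AddMonoidAlgebra ℂ (Fin n → ℤ)))

instance (n : ℕ) : Algebra ℂ (Laurent n) :=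
  inferInstanceAs (Algebra ℂ (AddMonoidAlgebra ℂ (Fin n → ℤ)))

/-- The monomial `t^m`. -/
def mono {n : ℕ} (m : Fin n → ℤ) : Laurent n :=
  (AddMonoidAlgebra.single m 1 : AddMonoidAlgebra ℂ (Fin n → ℤ))

/-- The basis of `A` formed by the monomials. -/
def monoBasis (n : ℕ) : Module.Basis (Fin n → ℤ) ℂ (Laurent n) :=
  .ofRepr ((AddMonoidAlgebra.basis (Fin n → ℤ) ℂ).repr : AddMonoidAlgebra ℂ (Fin n → ℤ) ≃ₗ[ℂ] _)

theorem monoBasis_apply {n : ℕ} (m : Fin n → ℤ) : monoBasis n m = mono m :=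
  AddMonoidAlgebra.basis_apply ℂ m

section Loop

variable {ι : Type u} [Fintype ι] {C : Matrix ι ι ℤ} {H : Type v} [AddCommGroup H] [Module ℂ H]

/-- The subspace `S ⊗ A` of `g ⊗ A` (written with `A` on the left). -/
def loopSub {Z : Realization C H} (n : ℕ) (S : Submodule ℂ (KM Z)) :
    Submodule ℂ (Laurent n ⊗[ℂ] KM Z) :=
  LinearMap.range (LinearMap.lTensor (Laurent n) S.subtype)

/-- The map `x ↦ x ⊗ 1` from `g` to `g ⊗ A`. -/
def constMap (Z : Realization C H) (n : ℕ) : KM Z →ₗ[ℂ] Laurent n ⊗[ℂ] KM Z :=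
  TensorProduct.mk ℂ (Laurent n) (KM Z) 1

theorem lie_mem_loopSub {Z : Realization C H} {n : ℕ} (x y : Laurent n ⊗[ℂ] KM Z) :
    ⁅x, y⁆ ∈ loopSub n (derived Z).toSubmodule := by
  induction x using TensorProduct.induction_on with
  | zero => rw [zero_lie]; exact Submodule.zero_mem _
  | add a b ha hb => rw [add_lie]; exact Submodule.add_mem _ ha hb
  | tmul a x =>
    induction y using TensorProduct.induction_on with
    | zero => rw [lie_zero]; exact Submodule.zero_mem _
    | add b c hb hc => rw [lie_add]; exact Submodule.add_mem _ hb hc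
    | tmul b y =>
      exact ⟨(a * b) ⊗ₜ[ℂ] (⟨⁅x, y⁆, LieSubmodule.lie_mem_lie (LieSubmodule.mem_top x)
        (LieSubmodule.mem_top y)⟩ : (derived Z).toSubmodule), rfl⟩

/-- The loop Kac-Moody algebra `g_A = g' ⊗ A ⊕ h''`, realized inside `g ⊗ A`. The sum is direct
since `h'' ∩ g' = h'' ∩ h' = 0`. -/
def loopKM (Z : Realization C H) (n : ℕ) (H2 : Submodule ℂ (KM Z)) :
    LieSubalgebra ℂ (Laurent n ⊗[ℂ] KM Z) where
  toSubmodule := loopSub n (derived Z).toSubmodule ⊔ H2.map (constMap Z n)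
  lie_mem' := fun {x y} _ _ => Submodule.mem_sup_left (lie_mem_loopSub x y)

/-- `h_A = h' ⊗ A ⊕ h''` (the external direct sum). -/
abbrev LoopCartan (Z : Realization C H) (n : ℕ) (H2 : Submodule ℂ (KM Z)) :=
  (Laurent n ⊗[ℂ] cartan' Z) × H2

/-- The inclusion of `h_A` in `g ⊗ A`. -/
def loopCartanMap (Z : Realization C H) (n : ℕ) (H2 : Submodule ℂ (KM Z)) :
    LoopCartan Z n H2 →ₗ[ℂ] Laurent n ⊗[ℂ] KM Z :=
  (LinearMap.lTensor (Laurent n) (cartan' Z).subtype).coprod (constMap Z n ∘ₗ H2.subtype)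

theorem loopCartanMap_mem (Z : Realization C H) (n : ℕ) (H2 : Submodule ℂ (KM Z))
    (x : LoopCartan Z n H2) : loopCartanMap Z n H2 x ∈ loopKM Z n H2 := by
  obtain ⟨a, b⟩ := x
  rw [loopCartanMap, LinearMap.coprod_apply]
  refine Submodule.add_mem_sup ?_ ⟨b, b.2, rfl⟩
  have h : cartan' Z ≤ (derived Z).toSubmodule := inf_le_right
  refine ⟨LinearMap.lTensor (Laurent n) (Submodule.inclusion h) a, ?_⟩
  rw [← LinearMap.comp_apply, ← LinearMap.lTensor_comp, Submodule.subtype_comp_inclusion]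

/-- The inclusion of `h_A` in `g_A`. -/
def loopCartanIncl (Z : Realization C H) (n : ℕ) (H2 : Submodule ℂ (KM Z))
    (x : LoopCartan Z n H2) : loopKM Z n H2 :=
  ⟨loopCartanMap Z n H2 x, loopCartanMap_mem Z n H2 x⟩

/-- The element `h ⊗ t^m` of `h_A`. -/
def cartanMono {Z : Realization C H} {n : ℕ} {H2 : Submodule ℂ (KM Z)} (h : cartan' Z)
    (m : Fin n → ℤ) : LoopCartan Z n H2 :=
  (mono m ⊗ₜ[ℂ] h, 0)

attribute [local instance] LieRing.ofAssociativeRing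

/-! ### The modules `M(ψ)` and `V(ψ)` -/

variable {Z : Realization C H} {n : ℕ} {H2 : Submodule ℂ (KM Z)}

/-- The universal enveloping algebra of `g_A`. -/
abbrev UEA (Z : Realization C H) (n : ℕ) (H2 : Submodule ℂ (KM Z)) :=
  UniversalEnvelopingAlgebra ℂ (loopKM Z n H2)

/-- The left ideal of `U(g_A)` generated by `N⁺ ⊗ A` and by `x - ψ(x)` for `x ∈ h_A`. -/
def vermaIdeal (ψ : Module.Dual ℂ (LoopCartan Z n H2)) : Submodule (UEA Z n H2) (UEA Z n H2) :=
  Submodule.span (UEA Z n H2)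
    ({u | ∃ x : loopKM Z n H2, (x : Laurent n ⊗[ℂ] KM Z) ∈ loopSub n (nPos Z).toSubmodule ∧
        u = UniversalEnvelopingAlgebra.ι ℂ x} ∪
      {u | ∃ y : LoopCartan Z n H2,
        u = UniversalEnvelopingAlgebra.ι ℂ (loopCartanIncl Z n H2 y) -
          algebraMap ℂ (UEA Z n H2) (ψ y)})

/-- `M(ψ)`, the `U(g_A)`-module induced from the one-dimensional module of
`(N⁺ ⊗ A) ⊕ h_A` given by `ψ`. -/
abbrev Verma (ψ : Module.Dual ℂ (LoopCartan Z n H2)) := UEA Z n H2 ⧸ vermaIdeal ψ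

/-- The sum of all proper submodules of `M(ψ)`. -/
def vermaMax (ψ : Module.Dual ℂ (LoopCartan Z n H2)) : Submodule (UEA Z n H2) (Verma ψ) :=
  sSup {N | N ≠ ⊤}

/-- `V(ψ)`, the irreducible quotient of `M(ψ)`. -/
def V (ψ : Module.Dual ℂ (LoopCartan Z n H2)) := Verma ψ ⧸ vermaMax ψ

instance (ψ : Module.Dual ℂ (LoopCartan Z n H2)) : AddCommGroup (V ψ) :=
  inferInstanceAs (AddCommGroup (Verma ψ ⧸ vermaMax ψ))

instance (ψ : Module.Dual ℂ (LoopCartan Z n H2)) : Module (UEA Z n H2) (V ψ) :=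
  inferInstanceAs (Module (UEA Z n H2) (Verma ψ ⧸ vermaMax ψ))

instance (ψ : Module.Dual ℂ (LoopCartan Z n H2)) : Module ℂ (V ψ) :=
  inferInstanceAs (Module ℂ (Verma ψ ⧸ vermaMax ψ))

instance (ψ : Module.Dual ℂ (LoopCartan Z n H2)) : IsScalarTower ℂ (UEA Z n H2) (V ψ) :=
  inferInstanceAs (IsScalarTower ℂ (UEA Z n H2) (Verma ψ ⧸ vermaMax ψ))

/-- The action of `g_A` on `V(ψ)`. -/
instance (ψ : Module.Dual ℂ (LoopCartan Z n H2)) : LieRingModule (loopKM Z n H2) (V ψ) where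
  bracket x v := UniversalEnvelopingAlgebra.ι ℂ x • v
  add_lie x y v := by
    change UniversalEnvelopingAlgebra.ι ℂ (x + y) • v = _
    rw [map_add, add_smul]
  lie_add x v w := smul_add _ v w
  leibniz_lie x y v := by
    change UniversalEnvelopingAlgebra.ι ℂ x • UniversalEnvelopingAlgebra.ι ℂ y • v =
      UniversalEnvelopingAlgebra.ι ℂ ⁅x, y⁆ • v +
        UniversalEnvelopingAlgebra.ι ℂ y • UniversalEnvelopingAlgebra.ι ℂ x • v
    rw [LieHom.map_lie, LieRing.of_associative_ring_bracket, sub_smul, mul_smul, mul_smul,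
      sub_add_cancel]

instance (ψ : Module.Dual ℂ (LoopCartan Z n H2)) : LieModule ℂ (loopKM Z n H2) (V ψ) where
  smul_lie c x v := by
    change UniversalEnvelopingAlgebra.ι ℂ (c • x) • v = c • UniversalEnvelopingAlgebra.ι ℂ x • v
    rw [map_smul, smul_assoc]
  lie_smul c x v := by
    change UniversalEnvelopingAlgebra.ι ℂ x • c • v = c • UniversalEnvelopingAlgebra.ι ℂ x • v
    rw [← algebraMap_smul (UEA Z n H2) c v, ← algebraMap_smul (UEA Z n H2) c
      (UniversalEnvelopingAlgebra.ι ℂ x • v), smul_smul, smul_smul, Algebra.commutes]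

end Loop

/-! ### Tensor products of families of Lie algebra modules -/

section Tensor

set_option linter.unusedSectionVars false

variable {κ : Type*} [Fintype κ] [DecidableEq κ] {L : Type*} [LieRing L] [LieAlgebra ℂ L]
  {M : κ → Type*} [∀ k, AddCommGroup (M k)] [∀ k, Module ℂ (M k)]
  [∀ k, LieRingModule L (M k)] [∀ k, LieModule ℂ L (M k)]

/-- The action of `x` on the `k`-th factor of `⨂ M k`. -/
def factorAct (x : L) (k : κ) : Module.End ℂ (⨂[ℂ] k, M k) :=
  PiTensorProduct.map
    (Function.update (fun _ => LinearMap.id) k (LieModule.toEnd ℂ L (M k) x))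

/-- `x · (⨂ v_k) = ∑_k (… ⊗ x v_k ⊗ …)`. -/
def tensorAct (x : L) : Module.End ℂ (⨂[ℂ] k, M k) := ∑ k, factorAct x k

theorem factorAct_add (x y : L) (k : κ) :
    factorAct (M := M) (x + y) k = factorAct x k + factorAct y k := by
  rw [factorAct, map_add, PiTensorProduct.map_update_add]; rfl

theorem factorAct_smul (c : ℂ) (x : L) (k : κ) :
    factorAct (M := M) (c • x) k = c • factorAct x k := by
  rw [factorAct, map_smul, PiTensorProduct.map_update_smul]; rfl

theorem factorAct_tprod (x : L) (k : κ) (v : ∀ k, M k) :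
    factorAct x k (PiTensorProduct.tprod ℂ v) =
      PiTensorProduct.tprod ℂ (Function.update v k ⁅x, v k⁆) := by
  rw [factorAct, PiTensorProduct.map_tprod]
  congr 1
  funext j
  by_cases h : j = k
  · subst h; simp
  · simp [h]

theorem factorAct_lie (x y : L) (k : κ) :
    factorAct (M := M) ⁅x, y⁆ k = ⁅factorAct (M := M) x k, factorAct (M := M) y k⁆ := by
  refine PiTensorProduct.ext (MultilinearMap.ext fun v => ?_)
  simp only [LinearMap.compMultilinearMap_apply, LieRing.of_associative_ring_bracket,
    LinearMap.sub_apply, Module.End.mul_apply, factorAct_tprod, Function.update_self,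
    Function.update_idem, lie_lie, MultilinearMap.map_update_sub]

theorem factorAct_comm (x y : L) {k l : κ} (h : k ≠ l) :
    ⁅factorAct (M := M) x k, factorAct (M := M) y l⁆ = 0 := by
  refine PiTensorProduct.ext (MultilinearMap.ext fun v => ?_)
  simp only [LinearMap.compMultilinearMap_apply, LieRing.of_associative_ring_bracket,
    LinearMap.sub_apply, Module.End.mul_apply, factorAct_tprod, LinearMap.zero_apply,
    Function.update_of_ne h, Function.update_of_ne h.symm, Function.update_comm h, sub_self]

theorem tensorAct_lie (x y : L) :
    tensorAct (M := M) ⁅x, y⁆ = ⁅tensorAct (M := M) x, tensorAct (M := M) y⁆ := by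
  rw [tensorAct, tensorAct, tensorAct, LieRing.of_associative_ring_bracket, Finset.sum_mul_sum,
    Finset.sum_mul_sum, Finset.sum_comm (f := fun i j => factorAct y i * factorAct x j),
    ← Finset.sum_sub_distrib]
  refine Finset.sum_congr rfl fun k _ => ?_
  rw [← Finset.sum_sub_distrib, Finset.sum_eq_single k, factorAct_lie]
  · rfl
  · intro l _ hl
    exact factorAct_comm x y hl.symm
  · simp

/-- The Lie algebra acts on the tensor product of a finite family of modules by the Leibniz
rule. -/
instance : LieRingModule L (⨂[ℂ] k, M k) where
  bracket x v := tensorAct x v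
  add_lie x y v := by
    change tensorAct (x + y) v = tensorAct x v + tensorAct y v
    simp only [tensorAct, factorAct_add, Finset.sum_add_distrib, LinearMap.add_apply]
  lie_add x v w := map_add _ v w
  leibniz_lie x y v := by
    change tensorAct x (tensorAct y v) = tensorAct ⁅x, y⁆ v + tensorAct y (tensorAct x v)
    rw [tensorAct_lie, LieRing.of_associative_ring_bracket, LinearMap.sub_apply,
      Module.End.mul_apply, Module.End.mul_apply, sub_add_cancel]

instance : LieModule ℂ L (⨂[ℂ] k, M k) where
  smul_lie c x v := by
    change tensorAct (c • x) v = c • tensorAct x v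
    simp only [tensorAct, factorAct_smul, ← Finset.smul_sum, LinearMap.smul_apply]
  lie_smul c x v := map_smul _ c v

end Tensor

/-! ### Exp-polynomial maps and their decomposition -/

/-- `f : ℤⁿ → ℂ` is a finite sum of terms `c · m₁^{k₁} ⋯ mₙ^{kₙ} · a₁^{m₁} ⋯ aₙ^{mₙ}` with `k ∈ ℕⁿ`
and all occurring `a ∈ (ℂ*)ⁿ` lying in `S`. -/
def IsExpPolyOn {n : ℕ} (S : Set (Fin n → ℂˣ)) (f : (Fin n → ℤ) → ℂ) : Prop :=
  ∃ c : ((Fin n → ℕ) × (Fin n → ℂˣ)) →₀ ℂ, (∀ p ∈ c.support, p.2 ∈ S) ∧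
    ∀ m, f m = c.sum fun p z => z * (∏ i, (m i : ℂ) ^ p.1 i) * ∏ i, (p.2 i : ℂ) ^ m i

/-- The action of `k ∈ ℤ/r₁ ⊕ ⋯ ⊕ ℤ/rₙ` on `(ℂ*)ⁿ` by `λ ↦ (ξ₁^{k₁} λ₁, …, ξₙ^{kₙ} λₙ)`. -/
def rotate {n : ℕ} {r : Fin n → ℕ} (ξ : Fin n → ℂˣ) (k : ∀ i, ZMod (r i)) (l : Fin n → ℂˣ) :
    Fin n → ℂˣ :=
  fun i => ξ i ^ (k i).val * l i

/-- `B` contains exactly one point of each orbit of this action. -/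
def IsTransversal {n : ℕ} (r : Fin n → ℕ) (ξ : Fin n → ℂˣ) (B : Set (Fin n → ℂˣ)) : Prop :=
  ∀ l : Fin n → ℂˣ, ∃! b, b ∈ B ∧ ∃ k : ∀ i, ZMod (r i), l = rotate ξ k b

/-- The linear map `t^m ↦ ξ^{k·m} t^m = ξ₁^{k₁m₁} ⋯ ξₙ^{kₙmₙ} t^m` on `A`. -/
def laurentTwist {n : ℕ} {r : Fin n → ℕ} (ξ : Fin n → ℂˣ) (k : ∀ i, ZMod (r i)) :
    Laurent n →ₗ[ℂ] Laurent n :=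
  (monoBasis n).constr ℂ fun m =>
    (∏ i, ((ξ i ^ (k i).val : ℂˣ) : ℂ) ^ m i) • mono m

/-- The subalgebra `ℂ[t₁^{±r₁}, …, tₙ^{±rₙ}]` of `A`. -/
def powerSubalgebra {n : ℕ} (r : Fin n → ℕ) : Subalgebra ℂ (Laurent n) :=
  Algebra.adjoin ℂ
    (Set.range (fun i : Fin n => (mono (Pi.single i (r i : ℤ)) : Laurent n)) ∪
      Set.range (fun i : Fin n => (mono (Pi.single i (-(r i : ℤ))) : Laurent n)))

section Functionals

variable {ι : Type u} [Fintype ι] {C : Matrix ι ι ℤ} {H : Type v} [AddCommGroup H] [Module ℂ H]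
  {Z : Realization C H} {n : ℕ} {H2 : Submodule ℂ (KM Z)}

/-- `ψ_h(m) = ψ(h ⊗ t^m)`. -/
def component (ψ : Module.Dual ℂ (LoopCartan Z n H2)) (h : cartan' Z) (m : Fin n → ℤ) : ℂ :=
  ψ (cartanMono h m)

/-- `ψ` is an exp-polynomial map whose exponentials all lie in `S`. -/
def ExpPolyOn (S : Set (Fin n → ℂˣ)) (ψ : Module.Dual ℂ (LoopCartan Z n H2)) : Prop :=
  ∀ h : cartan' Z, IsExpPolyOn S (component ψ h)

/-- `ψ` is an exp-polynomial map. -/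
def ExpPoly (ψ : Module.Dual ℂ (LoopCartan Z n H2)) : Prop := ExpPolyOn Set.univ ψ

/-- `A_ψ`, the image of `U(h' ⊗ A)` in `A` under the algebra homomorphism that extends
`h ⊗ t^m ↦ ψ(h ⊗ t^m) t^m`; that is, the subalgebra generated by the `ψ(h ⊗ t^m) t^m`. -/
def imageAlgebra (ψ : Module.Dual ℂ (LoopCartan Z n H2)) : Subalgebra ℂ (Laurent n) :=
  Algebra.adjoin ℂ
    (Set.range fun p : cartan' Z × (Fin n → ℤ) => component ψ p.1 p.2 • mono p.2)

/-- `ξ^k Φ`: `(ξ^k Φ)(h ⊗ t^m) = ξ^{k·m} Φ(h ⊗ t^m)`, and `ξ^k Φ = Φ` on `h''`. In terms of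
`Φ_h = ∑ p_{h,λ} exp λ` this is `(ξ^k Φ)_h = ∑ p_{h,λ} exp (k·λ)`. -/
def twist {r : Fin n → ℕ} (ξ : Fin n → ℂˣ) (k : ∀ i, ZMod (r i))
    (Φ : Module.Dual ℂ (LoopCartan Z n H2)) : Module.Dual ℂ (LoopCartan Z n H2) :=
  Φ ∘ₗ LinearMap.prodMap (LinearMap.rTensor (cartan' Z) (laurentTwist ξ k)) LinearMap.id

/-- `Φ` is a summand as in `ψ = ∑_k ξ^k Φ`, with exponentials taken from `B`. -/
def IsDecomposition (r : Fin n → ℕ) [∀ i, NeZero (r i)] (ξ : Fin n → ℂˣ)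
    (B : Set (Fin n → ℂˣ)) (ψ Φ : Module.Dual ℂ (LoopCartan Z n H2)) : Prop :=
  ExpPolyOn B Φ ∧ ψ = ∑ k : (∀ i, ZMod (r i)), twist ξ k Φ

end Functionals

end LoopKM

end

open scoped TensorProduct

noncomputable section

namespace LoopKM

universe u v

/-! ### Abstract highest weight representations with a coefficient functional. -/

section HighestWeight

attribute [local instance] LieRing.ofAssociativeRing

/-! Fix a decomposition ψ = ∑ ξ^k Φ. The exponents of ξ^k Φ lie in k·B, and these sets are pairwise
disjoint, because B is a transversal and the group acts freely. To a weight χ attach the largest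
ideal I of A with χ(h' ⊗ I) = 0 (`weightIdeal`). For exp-polynomial χ it contains a finite
intersection of ideals, one for each term, and the ideal of a term with exponent λ contains a power
of t_i - λ_i for every i. So disjoint sets of exponents give comaximal ideals
(`isCoprime_weightIdeal`).

The ideal g' ⊗ I acts by zero on V(χ) (`lie_eq_zero_of_mem_weightIdeal`). By the Chinese remainder
theorem, for every X in g' ⊗ A and every k some element acts as X on V(ξ^k Φ) and as zero on the
other factors (`exists_factor_element`). A submodule of the tensor product is therefore stable under
g' ⊗ A acting in a single slot. This makes the tensor product a highest weight module without proper
nonzero submodules, of weight ∑ ξ^k Φ = ψ, and such a module is determined by its weight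
(`exists_equiv_of_isHighestWeight`).

Weight spaces are replaced by one functional `top`, the coefficient of the highest weight vector v.
A Cartan element taking the value 1 on all simple roots separates the depths below v, so a submodule
contains top(w) v along with w (`top_smul_mem`). Irreducibility then amounts to having no nonzero
submodule inside the kernel of `top`.

That V(χ) is nonzero would usually come from the Poincaré-Birkhoff-Witt theorem. Here a module is
built by hand on the words in the letters f_i ⊗ t^p (`exists_highest_weight_rep`). Its operators
satisfy the Cartan relations and [e, f] = h, but no relations among the f's alone. The remaining
relations are imposed by dividing out the images of all operators that are paired with 0 in g ⊗ A;
these images have no empty-word component, so the highest weight vector survives.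

For the existence of Φ, replace each exponent of ψ by its representative in B and divide by R. The
condition on A_ψ says that ψ_h(m) = ξ^{k·m} ψ_h(m), so summing over the twists recovers ψ. -/

/-- A triangular structure on a Lie algebra `L`: spaces `F` and `E` of negative and positive
generators, a map `c` from an abstract Cartan subspace `𝔥`, and an element `d` of `𝔥` that
grades the negative generators. -/
structure TriData (L 𝔥 : Type*) [LieRing L] [LieAlgebra ℂ L] [AddCommGroup 𝔥] [Module ℂ 𝔥] where
  F : Submodule ℂ L
  E : Submodule ℂ L
  c : 𝔥 →ₗ[ℂ] L
  d : 𝔥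
  lie_c_F : ∀ y, ∀ f ∈ F, ⁅c y, f⁆ ∈ F
  lie_E_F : ∀ e ∈ E, ∀ f ∈ F, ⁅e, f⁆ ∈ LinearMap.range c
  lie_d : ∀ f ∈ F, ⁅c d, f⁆ = -f
  span : (LieSubalgebra.lieSpan ℂ L (F : Set L)).toSubmodule ⊔ LinearMap.range c ⊔
    (LieSubalgebra.lieSpan ℂ L (E : Set L)).toSubmodule = ⊤

/-- A representation `ρ` is generated by a highest weight vector `v` of weight `ψ`, and `top` is
the projection to the coefficient of `v`. -/
structure IsHighestWeight {L 𝔥 M : Type*} [LieRing L] [LieAlgebra ℂ L] [AddCommGroup 𝔥]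
    [Module ℂ 𝔥] [AddCommGroup M] [Module ℂ M] (τ : TriData L 𝔥) (ψ : Module.Dual ℂ 𝔥)
    (ρ : L →ₗ⁅ℂ⁆ Module.End ℂ M) (v : M) (top : Module.Dual ℂ M) : Prop where
  top_v : top v = 1
  act_E : ∀ e ∈ τ.E, ρ e v = 0
  act_c : ∀ y, ρ (τ.c y) v = ψ y • v
  top_F : ∀ f ∈ τ.F, ∀ w, top (ρ f w) = 0
  top_c : ∀ y w, top (ρ (τ.c y) w) = ψ y * top w
  gen : ∀ N : Submodule ℂ M, v ∈ N → (∀ x, ∀ w ∈ N, ρ x w ∈ N) → N = ⊤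

/-- No nonzero subrepresentation lies in the kernel of `top`. -/
def IsNondeg {L M : Type*} [LieRing L] [LieAlgebra ℂ L]
    [AddCommGroup M] [Module ℂ M] (ρ : L →ₗ⁅ℂ⁆ Module.End ℂ M) (top : Module.Dual ℂ M) : Prop :=
  ∀ N : Submodule ℂ M, (∀ x, ∀ w ∈ N, ρ x w ∈ N) → (∀ w ∈ N, top w = 0) → N = ⊥

variable {L 𝔥 M : Type*} [LieRing L] [LieAlgebra ℂ L] [AddCommGroup 𝔥] [Module ℂ 𝔥]
  [AddCommGroup M] [Module ℂ M]

theorem rep_lie (ρ : L →ₗ⁅ℂ⁆ Module.End ℂ M) (x y : L) (w : M) :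
    ρ ⁅x, y⁆ w = ρ x (ρ y w) - ρ y (ρ x w) := by
  rw [LieHom.map_lie, LieRing.of_associative_ring_bracket]; rfl

theorem rep_comm (ρ : L →ₗ⁅ℂ⁆ Module.End ℂ M) (x y : L) (w : M) :
    ρ x (ρ y w) = ρ y (ρ x w) + ρ ⁅x, y⁆ w := by
  rw [rep_lie]; abel

/-- The elements of `L` mapping `N` to itself. -/
def stabilizer (ρ : L →ₗ⁅ℂ⁆ Module.End ℂ M) (N : Submodule ℂ M) : LieSubalgebra ℂ L where
  carrier := {x | ∀ w ∈ N, ρ x w ∈ N}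
  add_mem' := fun ha hb w hw => by
    rw [map_add]; exact N.add_mem (ha w hw) (hb w hw)
  zero_mem' := fun w _ => by rw [map_zero]; exact N.zero_mem
  smul_mem' := fun c x hx w hw => by rw [map_smul]; exact N.smul_mem c (hx w hw)
  lie_mem' := fun hx hy w hw => by
    rw [rep_lie]; exact N.sub_mem (hx _ (hy w hw)) (hy _ (hx w hw))

/-- The elements of `L` killing `v`. -/
def annihilatorLie (ρ : L →ₗ⁅ℂ⁆ Module.End ℂ M) (v : M) : LieSubalgebra ℂ L where
  carrier := {x | ρ x v = 0}
  add_mem' := fun {a b} (ha : ρ a v = 0) (hb : ρ b v = 0) => by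
    change ρ (a + b) v = 0
    rw [map_add, LinearMap.add_apply, ha, hb, add_zero]
  zero_mem' := by change ρ 0 v = 0; rw [map_zero]; rfl
  smul_mem' := fun c x (hx : ρ x v = 0) => by
    change ρ (c • x) v = 0
    rw [map_smul, LinearMap.smul_apply, hx, smul_zero]
  lie_mem' := fun {a b} (ha : ρ a v = 0) (hb : ρ b v = 0) => by
    change ρ ⁅a, b⁆ v = 0
    rw [rep_lie, ha, hb, map_zero, map_zero, sub_zero]

/-- The elements of `L` whose image lies in the kernel of `top`. -/
def topKiller (ρ : L →ₗ⁅ℂ⁆ Module.End ℂ M) (top : Module.Dual ℂ M) : LieSubalgebra ℂ L where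
  carrier := {x | ∀ w, top (ρ x w) = 0}
  add_mem' := fun ha hb w => by
    rw [map_add, LinearMap.add_apply, map_add, ha, hb, add_zero]
  zero_mem' := fun w => by rw [map_zero, LinearMap.zero_apply, map_zero]
  smul_mem' := fun c x hx w => by
    rw [map_smul, LinearMap.smul_apply, map_smul, hx, smul_zero]
  lie_mem' := fun hx hy w => by
    rw [rep_lie, map_sub, hx, hy, sub_zero]

/-- The span of the vectors obtained from `v` by at most `n` applications of elements of `F`. -/
def depthFiltration (F : Submodule ℂ L) (ρ : L →ₗ⁅ℂ⁆ Module.End ℂ M) (v : M) :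
    ℕ → Submodule ℂ M
  | 0 => Submodule.span ℂ {v}
  | n + 1 => depthFiltration F ρ v n ⊔
      Submodule.span ℂ {w | ∃ f ∈ F, ∃ p ∈ depthFiltration F ρ v n, w = ρ f p}

theorem depthFiltration_induction {F : Submodule ℂ L} {ρ : L →ₗ⁅ℂ⁆ Module.End ℂ M} {v : M}
    {n : ℕ} {N : Submodule ℂ M} (h₁ : depthFiltration F ρ v n ≤ N)
    (h₂ : ∀ f ∈ F, ∀ p ∈ depthFiltration F ρ v n, ρ f p ∈ N) :
    depthFiltration F ρ v (n + 1) ≤ N := by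
  refine sup_le h₁ (Submodule.span_le.2 ?_)
  rintro _ ⟨f, hf, p, hp, rfl⟩
  exact h₂ f hf p hp

theorem map_mem_of_depthFiltration {F : Submodule ℂ L} {ρ : L →ₗ⁅ℂ⁆ Module.End ℂ M} {v : M}
    {n : ℕ} {N : Submodule ℂ M} (T : Module.End ℂ M)
    (h₁ : ∀ p ∈ depthFiltration F ρ v n, T p ∈ N)
    (h₂ : ∀ f ∈ F, ∀ p ∈ depthFiltration F ρ v n, T (ρ f p) ∈ N) :
    ∀ p ∈ depthFiltration F ρ v (n + 1), T p ∈ N :=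
  fun _ hp => depthFiltration_induction (N := Submodule.comap T N) h₁ h₂ hp

theorem depthFiltration_le_succ (F : Submodule ℂ L) (ρ : L →ₗ⁅ℂ⁆ Module.End ℂ M) (v : M) (n : ℕ) :
    depthFiltration F ρ v n ≤ depthFiltration F ρ v (n + 1) := le_sup_left

theorem depthFiltration_mono (F : Submodule ℂ L) (ρ : L →ₗ⁅ℂ⁆ Module.End ℂ M) (v : M) :
    Monotone (depthFiltration F ρ v) :=
  monotone_nat_of_le_succ (depthFiltration_le_succ F ρ v)

theorem act_mem_depthFiltration {F : Submodule ℂ L} {ρ : L →ₗ⁅ℂ⁆ Module.End ℂ M} {v : M}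
    {n : ℕ} {f : L} (hf : f ∈ F) {p : M} (hp : p ∈ depthFiltration F ρ v n) :
    ρ f p ∈ depthFiltration F ρ v (n + 1) :=
  Submodule.mem_sup_right (Submodule.subset_span ⟨f, hf, p, hp, rfl⟩)

namespace IsHighestWeight

variable {τ : TriData L 𝔥} {ψ : Module.Dual ℂ 𝔥} {ρ : L →ₗ⁅ℂ⁆ Module.End ℂ M} {v : M}
  {top : Module.Dual ℂ M}

theorem c_mem (h : IsHighestWeight τ ψ ρ v top) (y : 𝔥) (n : ℕ) :
    ∀ p ∈ depthFiltration τ.F ρ v n, ρ (τ.c y) p ∈ depthFiltration τ.F ρ v n := by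
  induction n with
  | zero =>
    intro p hp
    obtain ⟨a, rfl⟩ := Submodule.mem_span_singleton.1 hp
    rw [map_smul, h.act_c]
    exact Submodule.smul_mem _ _ (Submodule.smul_mem _ _ (Submodule.mem_span_singleton_self v))
  | succ n ih =>
    refine map_mem_of_depthFiltration _ (fun p hp => depthFiltration_le_succ _ _ _ _ (ih p hp))
      fun f hf p hp => ?_
    rw [rep_comm]
    exact Submodule.add_mem _ (act_mem_depthFiltration hf (ih p hp))
      (act_mem_depthFiltration (τ.lie_c_F y f hf) hp)

theorem E_mem (h : IsHighestWeight τ ψ ρ v top) {e : L} (he : e ∈ τ.E) (n : ℕ) :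
    ∀ p ∈ depthFiltration τ.F ρ v n, ρ e p ∈ depthFiltration τ.F ρ v n := by
  induction n with
  | zero =>
    intro p hp
    obtain ⟨a, rfl⟩ := Submodule.mem_span_singleton.1 hp
    rw [map_smul, h.act_E e he, smul_zero]
    exact Submodule.zero_mem _
  | succ n ih =>
    refine map_mem_of_depthFiltration _ (fun p hp => depthFiltration_le_succ _ _ _ _ (ih p hp))
      fun f hf p hp => ?_
    rw [rep_comm]
    obtain ⟨y, hy⟩ := τ.lie_E_F e he f hf
    rw [← hy]
    exact Submodule.add_mem _ (act_mem_depthFiltration hf (ih p hp))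
      (depthFiltration_le_succ _ _ _ _ (h.c_mem y n p hp))

/-- Replaces U(L) = U(n⁻) U(h) U(n⁺): commuting a Cartan element or a positive generator past the
f's never increases depth, so the union of the filtration is already a subrepresentation. -/
theorem iSup_depthFiltration (h : IsHighestWeight τ ψ ρ v top) :
    ⨆ n, depthFiltration τ.F ρ v n = ⊤ := by
  have hdir : Directed (· ≤ ·) (depthFiltration τ.F ρ v) := (depthFiltration_mono _ _ _).directed_le
  -- The stabilizer is a Lie subalgebra, so by `τ.span` it is enough to test the generators in `F`
  -- and `E` and the Cartan elements.
  have key : stabilizer ρ (⨆ n, depthFiltration τ.F ρ v n) = ⊤ := by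
    rw [← LieSubalgebra.toSubmodule_inj, LieSubalgebra.top_toSubmodule, eq_top_iff, ← τ.span]
    refine sup_le (sup_le ?_ ?_) ?_
    · refine (LieSubalgebra.lieSpan_le (K := stabilizer ρ _)).2 fun f hf w hw => ?_
      obtain ⟨n, hn⟩ := (Submodule.mem_iSup_of_directed _ hdir).1 hw
      exact Submodule.mem_iSup_of_mem _ (act_mem_depthFiltration hf hn)
    · rintro _ ⟨y, rfl⟩ w hw
      obtain ⟨n, hn⟩ := (Submodule.mem_iSup_of_directed _ hdir).1 hw
      exact Submodule.mem_iSup_of_mem _ (h.c_mem y n w hn)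
    · refine (LieSubalgebra.lieSpan_le (K := stabilizer ρ _)).2 fun f hf w hw => ?_
      obtain ⟨n, hn⟩ := (Submodule.mem_iSup_of_directed _ hdir).1 hw
      exact Submodule.mem_iSup_of_mem _ (h.E_mem hf n w hn)
  refine h.gen _ (Submodule.mem_iSup_of_mem 0 (Submodule.mem_span_singleton_self v)) ?_
  intro x
  have hx : x ∈ stabilizer ρ (⨆ n, depthFiltration τ.F ρ v n) := key ▸ LieSubalgebra.mem_top x
  exact hx

theorem exists_mem_depthFiltration (h : IsHighestWeight τ ψ ρ v top) (w : M) :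
    ∃ n, w ∈ depthFiltration τ.F ρ v n :=
  (Submodule.mem_iSup_of_directed _ (depthFiltration_mono _ _ _).directed_le).1
    (h.iSup_depthFiltration ▸ Submodule.mem_top)

/-- A subspace that contains `v` and is stable under the negative generators is everything. -/
theorem eq_top_of_stable (h : IsHighestWeight τ ψ ρ v top) {N : Submodule ℂ M} (hv : v ∈ N)
    (hN : ∀ f ∈ τ.F, ∀ w ∈ N, ρ f w ∈ N) : N = ⊤ := by
  rw [eq_top_iff, ← h.iSup_depthFiltration]
  refine iSup_le fun n => ?_
  induction n with
  | zero => exact Submodule.span_le.2 (Set.singleton_subset_iff.2 hv)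
  | succ n ih => exact depthFiltration_induction ih fun f hf p hp => hN f hf p (ih hp)

/-- Each application of an f lowers the eigenvalue of d by 1, so modulo depth n the element d acts
on depth n + 1 by the scalar ψ(d) - (n + 1). -/
theorem grading_mem (h : IsHighestWeight τ ψ ρ v top) (n : ℕ) :
    ∀ p ∈ depthFiltration τ.F ρ v (n + 1), ρ (τ.c τ.d) p + ((n : ℂ) + 1 - ψ τ.d) • p ∈
      depthFiltration τ.F ρ v n := by
  set D := ρ (τ.c τ.d)
  have h0 : ∀ p ∈ depthFiltration τ.F ρ v 0, D p = ψ τ.d • p := by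
    intro p hp
    obtain ⟨a, rfl⟩ := Submodule.mem_span_singleton.1 hp
    rw [map_smul, h.act_c, smul_comm]
  have hf : ∀ n : ℕ, ∀ f ∈ τ.F, ∀ p : M, D (ρ f p) + ((n : ℂ) + 1 - ψ τ.d) • ρ f p =
      ρ f (D p + ((n : ℂ) - ψ τ.d) • p) := by
    intro n f hf p
    have : D (ρ f p) = ρ f (D p) - ρ f p := by
      rw [rep_comm, τ.lie_d f hf, map_neg, LinearMap.neg_apply, sub_eq_add_neg]
    rw [this, map_add, map_smul]
    module
  induction n with
  | zero =>
    refine map_mem_of_depthFiltration (F := τ.F) (ρ := ρ)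
      (D + (((0 : ℕ) : ℂ) + 1 - ψ τ.d) • LinearMap.id)
      (fun p hp => ?_) fun f hfm p hp => ?_
    · exact Submodule.add_mem _ (h.c_mem _ _ p hp) (Submodule.smul_mem _ _ hp)
    · change D (ρ f p) + (((0 : ℕ) : ℂ) + 1 - ψ τ.d) • ρ f p ∈ _
      rw [hf 0 f hfm, h0 p hp]
      convert Submodule.zero_mem _
      rw [← add_smul]
      simp
  | succ n ih =>
    refine map_mem_of_depthFiltration (F := τ.F) (ρ := ρ)
      (D + (((n + 1 : ℕ) : ℂ) + 1 - ψ τ.d) • LinearMap.id)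
      (fun p hp => ?_) fun f hfm p hp => ?_
    · exact Submodule.add_mem _ (h.c_mem _ _ p hp) (Submodule.smul_mem _ _ hp)
    · change D (ρ f p) + (((n + 1 : ℕ) : ℂ) + 1 - ψ τ.d) • ρ f p ∈ _
      rw [hf _ f hfm]
      refine act_mem_depthFiltration hfm ?_
      have := ih p hp
      push_cast
      exact this

/-- A subrepresentation contains the components in `ℂ v` of its elements. -/
theorem top_smul_mem (h : IsHighestWeight τ ψ ρ v top) {N : Submodule ℂ M}
    (hN : ∀ x, ∀ w ∈ N, ρ x w ∈ N) {w : M} (hw : w ∈ N) : top w • v ∈ N := by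
  obtain ⟨n, hn⟩ := h.exists_mem_depthFiltration w
  induction n generalizing w with
  | zero =>
    obtain ⟨a, rfl⟩ := Submodule.mem_span_singleton.1 hn
    simpa [h.top_v] using hw
  | succ n ih =>
    -- Applying d + (n + 1 - ψ(d)) keeps w in N, lowers its depth and multiplies `top w` by n + 1,
    -- which is nonzero.
    have hm := ih (N.add_mem (hN (τ.c τ.d) w hw) (N.smul_mem ((n : ℂ) + 1 - ψ τ.d) hw))
      (h.grading_mem n w hn)
    rw [map_add, h.top_c, map_smul, smul_eq_mul, ← add_mul, add_sub_cancel, mul_smul] at hm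
    refine (N.smul_mem_iff ?_).1 hm
    exact_mod_cast Nat.succ_ne_zero n

/-- Otherwise N contains v, which generates everything. -/
theorem top_eq_zero (h : IsHighestWeight τ ψ ρ v top) {N : Submodule ℂ M}
    (hN : ∀ x, ∀ w ∈ N, ρ x w ∈ N) (hne : N ≠ ⊤) {w : M} (hw : w ∈ N) : top w = 0 := by
  by_contra h0
  exact hne (h.gen N ((N.smul_mem_iff h0).1 (h.top_smul_mem hN hw)) hN)

theorem eq_bot_or_eq_top (h : IsHighestWeight τ ψ ρ v top) (hnd : IsNondeg ρ top)
    {N : Submodule ℂ M} (hN : ∀ x, ∀ w ∈ N, ρ x w ∈ N) : N = ⊥ ∨ N = ⊤ := by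
  by_cases hne : N = ⊤
  · exact Or.inr hne
  · exact Or.inl (hnd N hN fun w hw => h.top_eq_zero hN hne hw)

/-- An ideal acts by zero on a nondegenerate highest weight representation if the Cartan parts of
its elements are killed by the highest weight. -/
theorem act_eq_zero_of_ideal (h : IsHighestWeight τ ψ ρ v top) (hnd : IsNondeg ρ top)
    (J : Submodule ℂ L) (hJ : ∀ x : L, ∀ j ∈ J, ⁅x, j⁆ ∈ J)
    (hJψ : ∀ j ∈ J, ∃ a ∈ LieSubalgebra.lieSpan ℂ L (τ.F : Set L),
      ∃ b ∈ LieSubalgebra.lieSpan ℂ L (τ.E : Set L), ∃ y, ψ y = 0 ∧ j = a + τ.c y + b)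
    {j : L} (hj : j ∈ J) : ρ j = 0 := by
  have hneg : LieSubalgebra.lieSpan ℂ L (τ.F : Set L) ≤ topKiller ρ top :=
    LieSubalgebra.lieSpan_le.2 fun f hf => h.top_F f hf
  have hpos : LieSubalgebra.lieSpan ℂ L (τ.E : Set L) ≤ annihilatorLie ρ v :=
    LieSubalgebra.lieSpan_le.2 fun f hf => h.act_E f hf
  have key : ∀ n, ∀ p ∈ depthFiltration τ.F ρ v n, ∀ j ∈ J, top (ρ j p) = 0 := by
    intro n
    induction n with
    | zero =>
      intro p hp j hj
      obtain ⟨t, rfl⟩ := Submodule.mem_span_singleton.1 hp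
      -- On a multiple of v the positive part b gives 0, the negative part a has image in the kernel
      -- of `top`, and the Cartan part acts by ψ(y) = 0.
      obtain ⟨a, ha, b, hb, y, hy, rfl⟩ := hJψ j hj
      have hb' : ρ b v = 0 := hpos hb
      rw [map_smul, map_smul, map_add, map_add, LinearMap.add_apply, LinearMap.add_apply, hb',
        h.act_c, hy, zero_smul, add_zero, add_zero, hneg ha v, smul_zero]
    | succ n ih =>
      intro p hp j hj
      refine depthFiltration_induction
        (N := LinearMap.ker (top ∘ₗ ρ j)) (fun p hp => ih p hp j hj) (fun f hf p hp => ?_) hp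
      rw [LinearMap.mem_ker, LinearMap.comp_apply, rep_comm, map_add, h.top_F f hf, zero_add,
        ← lie_skew, map_neg, LinearMap.neg_apply, map_neg, ih p hp _ (hJ f j hj), neg_zero]
  -- This is J·M, a subrepresentation because J is an ideal.
  let N : Submodule ℂ M := Submodule.span ℂ {w | ∃ j ∈ J, ∃ p, w = ρ j p}
  have hN : N = ⊥ := by
    refine hnd N (fun x w hw => ?_) fun w hw => ?_
    · induction hw using Submodule.span_induction with
      | mem w hw =>
        obtain ⟨j, hj, p, rfl⟩ := hw
        rw [rep_comm]
        exact N.add_mem (Submodule.subset_span ⟨j, hj, _, rfl⟩)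
          (Submodule.subset_span ⟨_, hJ x j hj, _, rfl⟩)
      | zero => rw [map_zero]; exact N.zero_mem
      | add a b _ _ ha hb => rw [map_add]; exact N.add_mem ha hb
      | smul c a _ ha => rw [map_smul]; exact N.smul_mem c ha
    · induction hw using Submodule.span_induction with
      | mem w hw =>
        obtain ⟨j, hj, p, rfl⟩ := hw
        obtain ⟨n, hn⟩ := h.exists_mem_depthFiltration p
        exact key n p hn j hj
      | zero => exact map_zero _
      | add a b _ _ ha hb => rw [map_add, ha, hb, add_zero]
      | smul c a _ ha => rw [map_smul, ha, smul_zero]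
  ext p
  have : ρ j p ∈ N := Submodule.subset_span ⟨j, hj, p, rfl⟩
  rw [hN] at this
  exact (Submodule.mem_bot ℂ).1 this

/-- Nondegeneracy with respect to an ideal `L'` that together with the Cartan subalgebra spans
the Lie algebra. -/
theorem eq_bot_of_ideal_stable (h : IsHighestWeight τ ψ ρ v top) (hnd : IsNondeg ρ top)
    {L' : Submodule ℂ L} (hL' : ∀ x : L, ∀ j ∈ L', ⁅x, j⁆ ∈ L')
    (hsup : L' ⊔ LinearMap.range τ.c = ⊤) {N : Submodule ℂ M}
    (hN : ∀ x ∈ L', ∀ w ∈ N, ρ x w ∈ N) (h0 : ∀ w ∈ N, top w = 0) :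
    N = ⊥ := by
  -- The sum of all such subspaces is the largest one. Its maximality forces stability under the
  -- Cartan elements, hence under all of L.
  let S : Set (Submodule ℂ M) :=
    {N | (∀ x ∈ L', ∀ w ∈ N, ρ x w ∈ N) ∧ ∀ w ∈ N, top w = 0}
  have hS : ∀ x ∈ L', ∀ w ∈ sSup S, ρ x w ∈ sSup S := by
    intro x hx
    change sSup S ≤ Submodule.comap (ρ x) (sSup S)
    refine sSup_le fun N hN w hw => ?_
    exact (le_sSup hN : N ≤ sSup S) (hN.1 x hx w hw)
  have hS0 : sSup S ≤ LinearMap.ker top := sSup_le fun N hN w hw => hN.2 w hw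
  have hc : ∀ y, ∀ w ∈ sSup S, ρ (τ.c y) w ∈ sSup S := by
    intro y w hw
    -- Adjoining the image under c(y) keeps both properties, as L' is an ideal and `top` is an
    -- eigenfunctional of c(y). By maximality nothing new is added.
    set N' := sSup S ⊔ Submodule.map (ρ (τ.c y)) (sSup S) with hN'
    have hmem : N' ∈ S := by
      refine ⟨fun x hx => ?_, ?_⟩
      · change N' ≤ Submodule.comap (ρ x) N'
        refine sup_le (fun w hw => Submodule.mem_sup_left (hS x hx w hw)) ?_
        rintro _ ⟨w, hw, rfl⟩
        rw [Submodule.mem_comap, rep_comm, ← lie_skew, map_neg, LinearMap.neg_apply]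
        exact Submodule.add_mem _ (Submodule.mem_sup_right ⟨_, hS x hx w hw, rfl⟩)
          (Submodule.mem_sup_left (Submodule.neg_mem _ (hS _ (hL' _ x hx) w hw)))
      · change N' ≤ LinearMap.ker top
        refine sup_le hS0 ?_
        rintro _ ⟨w, hw, rfl⟩
        rw [LinearMap.mem_ker, h.top_c, (hS0 hw : top w = 0), mul_zero]
    exact (le_sSup hmem) (Submodule.mem_sup_right ⟨w, hw, rfl⟩)
  have hbot : sSup S = ⊥ := by
    refine hnd _ (fun x w hw => ?_) fun w hw => hS0 hw
    have hx : x ∈ L' ⊔ LinearMap.range τ.c := hsup ▸ Submodule.mem_top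
    obtain ⟨a, ha, _, ⟨y, rfl⟩, rfl⟩ := Submodule.mem_sup.1 hx
    rw [map_add]
    exact Submodule.add_mem _ (hS a ha w hw) (hc y w hw)
  exact le_bot_iff.1 (hbot ▸ le_sSup (show N ∈ S from ⟨hN, h0⟩))

end IsHighestWeight

end HighestWeight

/-! ### Tensor products of highest weight representations. -/

section TensorHighestWeight

set_option linter.unusedSectionVars false

attribute [local instance] LieRing.ofAssociativeRing

variable {κ : Type*} [Fintype κ] [DecidableEq κ] {M : κ → Type*} [∀ k, AddCommGroup (M k)]
  [∀ k, Module ℂ (M k)]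

/-- The product of linear functionals on the factors of a tensor product. -/
def dualProd (φ : ∀ k, Module.Dual ℂ (M k)) : Module.Dual ℂ (⨂[ℂ] k, M k) :=
  PiTensorProduct.lift ((MultilinearMap.mkPiAlgebra ℂ κ ℂ).compLinearMap φ)

theorem dualProd_tprod (φ : ∀ k, Module.Dual ℂ (M k)) (w : ∀ k, M k) :
    dualProd φ (PiTensorProduct.tprod ℂ w) = ∏ k, φ k (w k) := by
  rw [dualProd, PiTensorProduct.lift.tprod]; rfl

/-- Contraction of all factors but the `k`-th one with functionals. -/
def contract (φ : ∀ k, Module.Dual ℂ (M k)) (k : κ) : (⨂[ℂ] k, M k) →ₗ[ℂ] M k :=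
  PiTensorProduct.lift (MultilinearMap.mk' (fun w => (∏ l ∈ Finset.univ.erase k, φ l (w l)) • w k)
    (by
      intro w i a b
      by_cases hi : i = k
      · subst hi
        have : ∀ c, ∏ l ∈ Finset.univ.erase i, φ l (Function.update w i c l) =
            ∏ l ∈ Finset.univ.erase i, φ l (w l) := fun c =>
          Finset.prod_congr rfl fun l hl => by
            rw [Function.update_of_ne (Finset.ne_of_mem_erase hl)]
        simp only [this, Function.update_self, smul_add]
      · have hmem : i ∈ Finset.univ.erase k := Finset.mem_erase.2 ⟨hi, Finset.mem_univ i⟩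
        have : ∀ c, ∏ l ∈ Finset.univ.erase k, φ l (Function.update w i c l) =
            φ i c * ∏ l ∈ (Finset.univ.erase k).erase i, φ l (w l) := fun c => by
          rw [← Finset.mul_prod_erase _ _ hmem, Function.update_self]
          congr 1
          exact Finset.prod_congr rfl fun l hl => by
            rw [Function.update_of_ne (Finset.ne_of_mem_erase hl)]
        simp only [this, Function.update_of_ne (Ne.symm hi), map_add, add_mul, add_smul])
    (by
      intro w i t a
      by_cases hi : i = k
      · subst hi
        have : ∀ c, ∏ l ∈ Finset.univ.erase i, φ l (Function.update w i c l) =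
            ∏ l ∈ Finset.univ.erase i, φ l (w l) := fun c =>
          Finset.prod_congr rfl fun l hl => by
            rw [Function.update_of_ne (Finset.ne_of_mem_erase hl)]
        simp only [this, Function.update_self]
        rw [smul_comm]
      · have hmem : i ∈ Finset.univ.erase k := Finset.mem_erase.2 ⟨hi, Finset.mem_univ i⟩
        have : ∀ c, ∏ l ∈ Finset.univ.erase k, φ l (Function.update w i c l) =
            φ i c * ∏ l ∈ (Finset.univ.erase k).erase i, φ l (w l) := fun c => by
          rw [← Finset.mul_prod_erase _ _ hmem, Function.update_self]
          congr 1
          exact Finset.prod_congr rfl fun l hl => by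
            rw [Function.update_of_ne (Finset.ne_of_mem_erase hl)]
        simp only [this, Function.update_of_ne (Ne.symm hi), map_smul, smul_eq_mul, mul_assoc,
          mul_smul]))

theorem contract_tprod (φ : ∀ k, Module.Dual ℂ (M k)) (k : κ) (w : ∀ k, M k) :
    contract φ k (PiTensorProduct.tprod ℂ w) = (∏ l ∈ Finset.univ.erase k, φ l (w l)) • w k := by
  rw [contract, PiTensorProduct.lift.tprod]; rfl

theorem dualProd_eq_contract (φ : ∀ k, Module.Dual ℂ (M k)) (k : κ) (w : ⨂[ℂ] k, M k) :
    dualProd φ w = φ k (contract φ k w) := by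
  have : dualProd φ = φ k ∘ₗ contract φ k := by
    refine PiTensorProduct.ext (MultilinearMap.ext fun w => ?_)
    simp only [LinearMap.compMultilinearMap_apply, LinearMap.comp_apply, contract_tprod,
      dualProd_tprod, map_smul, smul_eq_mul]
    rw [mul_comm, Finset.mul_prod_erase _ (fun l => φ l (w l)) (Finset.mem_univ k)]
  rw [this]; rfl

/-- The k-th functional does not enter the contraction, so it can be exchanged freely in the
induction over slots. -/
theorem contract_congr {φ χ : ∀ k, Module.Dual ℂ (M k)} {k : κ} (h : ∀ l, l ≠ k → φ l = χ l) :
    contract φ k = contract χ k := by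
  refine PiTensorProduct.ext (MultilinearMap.ext fun w => ?_)
  simp only [LinearMap.compMultilinearMap_apply, contract_tprod]
  congr 1
  exact Finset.prod_congr rfl fun l hl => by rw [h l (Finset.ne_of_mem_erase hl)]

/-- The coordinates with respect to a tensor product of bases are themselves products of
functionals. -/
theorem eq_zero_of_dualProd {w : ⨂[ℂ] k, M k} (h : ∀ φ, dualProd φ w = 0) : w = 0 := by
  let b := fun k => Module.Basis.ofVectorSpace ℂ (M k)
  refine (Basis.piTensorProduct b).ext_elem fun p => ?_
  have key : (Basis.piTensorProduct b).coord p = dualProd fun k => (b k).coord (p k) := by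
    refine PiTensorProduct.ext (MultilinearMap.ext fun w => ?_)
    simp only [LinearMap.compMultilinearMap_apply, dualProd_tprod, Module.Basis.coord_apply]
    exact Basis.piTensorProduct_repr_tprod_apply b w p
  have := LinearMap.congr_fun key w
  rw [h, Module.Basis.coord_apply] at this
  rw [this, map_zero]; rfl

variable {L 𝔥 : Type*} [LieRing L] [LieAlgebra ℂ L] [AddCommGroup 𝔥] [Module ℂ 𝔥]
  [∀ k, LieRingModule L (M k)] [∀ k, LieModule ℂ L (M k)]

theorem tensor_lie_apply (x : L) (w : ⨂[ℂ] k, M k) : ⁅x, w⁆ = ∑ k, factorAct x k w := by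
  change tensorAct x w = _
  rw [tensorAct, LinearMap.sum_apply]

theorem contract_factorAct (φ : ∀ k, Module.Dual ℂ (M k)) (k : κ) (x : L) (w : ⨂[ℂ] k, M k) :
    contract φ k (factorAct x k w) = ⁅x, contract φ k w⁆ := by
  have : contract φ k ∘ₗ factorAct x k = LieModule.toEnd ℂ L (M k) x ∘ₗ contract φ k := by
    refine PiTensorProduct.ext (MultilinearMap.ext fun w => ?_)
    simp only [LinearMap.compMultilinearMap_apply, LinearMap.comp_apply, factorAct_tprod,
      contract_tprod, map_smul, Function.update_self, LieModule.toEnd_apply_apply]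
    congr 1
    exact Finset.prod_congr rfl fun l hl => by
      rw [Function.update_of_ne (Finset.ne_of_mem_erase hl)]
  exact LinearMap.congr_fun this w

theorem dualProd_factorAct (φ : ∀ k, Module.Dual ℂ (M k)) (k : κ) (x : L) (w : ⨂[ℂ] k, M k) :
    dualProd φ (factorAct x k w) = φ k ⁅x, contract φ k w⁆ := by
  rw [dualProd_eq_contract φ k, contract_factorAct]

theorem lie_eq_factorAct {x x' : L} {k : κ} (hk : ∀ w : M k, ⁅x', w⁆ = ⁅x, w⁆)
    (hl : ∀ l, l ≠ k → ∀ w : M l, ⁅x', w⁆ = 0) (w : ⨂[ℂ] k, M k) :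
    ⁅x', w⁆ = factorAct x k w := by
  rw [tensor_lie_apply, Finset.sum_eq_single k]
  · have : factorAct (M := M) x' k = factorAct x k := by
      refine PiTensorProduct.ext (MultilinearMap.ext fun w => ?_)
      simp only [LinearMap.compMultilinearMap_apply, factorAct_tprod, hk]
    rw [this]
  · intro l _ hlk
    have : factorAct (M := M) x' l = 0 := by
      refine PiTensorProduct.ext (MultilinearMap.ext fun w => ?_)
      simp only [LinearMap.compMultilinearMap_apply, factorAct_tprod, hl l hlk,
        LinearMap.zero_apply]
      exact MultilinearMap.map_coord_zero _ l (Function.update_self _ _ _)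
    rw [this]; rfl
  · simp

variable {τ : TriData L 𝔥} {ψ : κ → Module.Dual ℂ 𝔥} {v : ∀ k, M k}
  {top : ∀ k, Module.Dual ℂ (M k)} {L' : Submodule ℂ L}

/-- The separation hypothesis turns the action in one slot into the action of a genuine Lie algebra
element, so submodules are stable under it. -/
theorem factorAct_mem
    (hsep : ∀ k, ∀ x ∈ L', ∃ x' : L, (∀ w : M k, ⁅x', w⁆ = ⁅x, w⁆) ∧
      ∀ l, l ≠ k → ∀ w : M l, ⁅x', w⁆ = 0) {N : Submodule ℂ (⨂[ℂ] k, M k)}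
    (hN : ∀ x : L, ∀ w ∈ N, ⁅x, w⁆ ∈ N) {x : L} (hx : x ∈ L') (k : κ) {w : ⨂[ℂ] k, M k}
    (hw : w ∈ N) : factorAct x k w ∈ N := by
  obtain ⟨x', h₁, h₂⟩ := hsep k x hx
  rw [← lie_eq_factorAct h₁ h₂]
  exact hN x' w hw

/-- All conditions except generation hold slot by slot through the Leibniz rule. Generation changes
the slots of the vector ⊗ v_k one at a time, which requires only the negative generators to act in a
single slot. -/
theorem isHighestWeight_tensor
    (h : ∀ k, IsHighestWeight τ (ψ k) (LieModule.toEnd ℂ L (M k)) (v k) (top k))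
    (hF : τ.F ≤ L')
    (hsep : ∀ k, ∀ x ∈ L', ∃ x' : L, (∀ w : M k, ⁅x', w⁆ = ⁅x, w⁆) ∧
      ∀ l, l ≠ k → ∀ w : M l, ⁅x', w⁆ = 0) :
    IsHighestWeight τ (∑ k, ψ k) (LieModule.toEnd ℂ L (⨂[ℂ] k, M k))
      (PiTensorProduct.tprod ℂ v) (dualProd top) where
  top_v := by
    rw [dualProd_tprod]
    exact Finset.prod_eq_one fun k _ => (h k).top_v
  act_E e he := by
    rw [LieModule.toEnd_apply_apply, tensor_lie_apply]
    refine Finset.sum_eq_zero fun k _ => ?_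
    rw [factorAct_tprod]
    refine MultilinearMap.map_coord_zero _ k ?_
    rw [Function.update_self]
    exact (h k).act_E e he
  act_c y := by
    rw [LieModule.toEnd_apply_apply, tensor_lie_apply, LinearMap.sum_apply, Finset.sum_smul]
    refine Finset.sum_congr rfl fun k _ => ?_
    rw [factorAct_tprod, show ⁅τ.c y, v k⁆ = ψ k y • v k from (h k).act_c y,
      MultilinearMap.map_update_smul, Function.update_eq_self]
  top_F f hf w := by
    rw [LieModule.toEnd_apply_apply, tensor_lie_apply, map_sum]
    refine Finset.sum_eq_zero fun k _ => ?_
    rw [dualProd_factorAct]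
    exact (h k).top_F f hf _
  top_c y w := by
    rw [LieModule.toEnd_apply_apply, tensor_lie_apply, map_sum, LinearMap.sum_apply,
      Finset.sum_mul]
    refine Finset.sum_congr rfl fun k _ => ?_
    rw [dualProd_factorAct, dualProd_eq_contract top k]
    exact (h k).top_c y _
  gen N hv hN := by
    have key : ∀ S : Finset κ, ∀ w : ∀ k, M k, (∀ k, k ∉ S → w k = v k) →
        PiTensorProduct.tprod ℂ w ∈ N := by
      intro S
      induction S using Finset.induction_on with
      | empty =>
        intro w hw
        rwa [show w = v from funext fun k => hw k (Finset.notMem_empty k)]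
      | insert k S hk ih =>
        intro w hw
        -- The vectors that may be put in slot k without leaving N form a subspace containing v_k
        -- and stable under the f's.
        have htop : Submodule.comap ((PiTensorProduct.tprod ℂ).toLinearMap w k) N = ⊤ := by
          refine (h k).eq_top_of_stable ?_ fun f hf m hm => ?_
          · refine ih _ fun l hl => ?_
            by_cases hlk : l = k
            · subst hlk; exact Function.update_self _ _ _
            · rw [Function.update_of_ne hlk]
              exact hw l (by simp [hlk, hl])
          · have := factorAct_mem hsep hN (hF hf) k
              (show PiTensorProduct.tprod ℂ (Function.update w k m) ∈ N from hm)
            rwa [factorAct_tprod, Function.update_self, Function.update_idem] at this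
        have hm : w k ∈ Submodule.comap ((PiTensorProduct.tprod ℂ).toLinearMap w k) N :=
          htop ▸ Submodule.mem_top
        rw [Submodule.mem_comap, MultilinearMap.toLinearMap_apply, Function.update_eq_self] at hm
        exact hm
    rw [eq_top_iff, ← PiTensorProduct.span_tprod_eq_top, Submodule.span_le]
    rintro _ ⟨w, rfl⟩
    exact key Finset.univ w fun k hk => absurd (Finset.mem_univ k) hk

/-- Replace the functionals `top k` by arbitrary ones, one slot at a time. Once products of
arbitrary functionals vanish on N, they separate points and N is zero. -/
theorem isNondeg_tensor
    (h : ∀ k, IsHighestWeight τ (ψ k) (LieModule.toEnd ℂ L (M k)) (v k) (top k))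
    (hnd : ∀ k, IsNondeg (LieModule.toEnd ℂ L (M k)) (top k))
    (hL' : ∀ x : L, ∀ j ∈ L', ⁅x, j⁆ ∈ L') (hsup : L' ⊔ LinearMap.range τ.c = ⊤)
    (hsep : ∀ k, ∀ x ∈ L', ∃ x' : L, (∀ w : M k, ⁅x', w⁆ = ⁅x, w⁆) ∧
      ∀ l, l ≠ k → ∀ w : M l, ⁅x', w⁆ = 0) :
    IsNondeg (LieModule.toEnd ℂ L (⨂[ℂ] k, M k)) (dualProd top) := by
  intro N hN h0
  have key : ∀ S : Finset κ, ∀ φ : ∀ k, Module.Dual ℂ (M k), (∀ k, k ∉ S → φ k = top k) →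
      ∀ w ∈ N, dualProd φ w = 0 := by
    intro S
    induction S using Finset.induction_on with
    | empty =>
      intro φ hφ w hw
      rw [show φ = top from funext fun k => hφ k (Finset.notMem_empty k)]
      exact h0 w hw
    | insert k S hk ih =>
      intro φ hφ w hw
      -- The contraction of N to slot k is stable under L' only, not under all of L, and lies in the
      -- kernel of `top k` by induction. This is why nondegeneracy relative to the ideal L' is
      -- needed.
      have hbot : Submodule.map (contract φ k) N = ⊥ := by
        refine (h k).eq_bot_of_ideal_stable (hnd k) hL' hsup ?_ ?_
        · rintro x hx _ ⟨w, hw, rfl⟩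
          exact ⟨_, factorAct_mem hsep hN hx k hw, contract_factorAct φ k x w⟩
        · rintro _ ⟨w, hw, rfl⟩
          have := ih (Function.update φ k (top k)) (fun l hl => ?_) w hw
          · rw [dualProd_eq_contract _ k, Function.update_self] at this
            rwa [contract_congr (χ := φ) fun l hl => Function.update_of_ne hl _ _] at this
          · by_cases hlk : l = k
            · subst hlk; exact Function.update_self _ _ _
            · rw [Function.update_of_ne hlk]
              exact hφ l (by simp [hlk, hl])
      have hm : contract φ k w ∈ Submodule.map (contract φ k) N := ⟨w, hw, rfl⟩
      rw [hbot, Submodule.mem_bot] at hm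
      rw [dualProd_eq_contract φ k, hm, map_zero]
  refine (Submodule.eq_bot_iff N).2 fun w hw => eq_zero_of_dualProd fun φ => ?_
  exact key Finset.univ φ (fun k hk => absurd (Finset.mem_univ k) hk) w hw

end TensorHighestWeight

/-! ### Triangular decompositions from generators. -/

section Triangular

variable {L : Type*} [LieRing L] [LieAlgebra ℂ L]

theorem lieSpan_span (S : Set L) :
    LieSubalgebra.lieSpan ℂ L (Submodule.span ℂ S : Set L) = LieSubalgebra.lieSpan ℂ L S := by
  refine le_antisymm (LieSubalgebra.lieSpan_le.2 ?_)
    (LieSubalgebra.lieSpan_mono Submodule.subset_span)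
  exact (Submodule.span_le (p := (LieSubalgebra.lieSpan ℂ L S).toSubmodule)).2
    LieSubalgebra.subset_lieSpan

theorem lie_mem_lieSpan {S : Set L} {x : L}
    (h : ∀ s ∈ S, ⁅x, s⁆ ∈ LieSubalgebra.lieSpan ℂ L S) {y : L}
    (hy : y ∈ LieSubalgebra.lieSpan ℂ L S) : ⁅x, y⁆ ∈ LieSubalgebra.lieSpan ℂ L S := by
  induction hy using LieSubalgebra.lieSpan_induction with
  | mem s hs => exact h s hs
  | zero => rw [lie_zero]; exact LieSubalgebra.zero_mem _
  | add a b _ _ ha hb => rw [lie_add]; exact LieSubalgebra.add_mem _ ha hb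
  | smul c a _ ha => rw [lie_smul]; exact LieSubalgebra.smul_mem _ c ha
  | lie a b ha hb iha ihb =>
    rw [leibniz_lie]
    exact LieSubalgebra.add_mem _ (LieSubalgebra.lie_mem _ iha hb) (LieSubalgebra.lie_mem _ ha ihb)

/-- Here ad x is a derivation sending F to H₀, and both H₀ and the subalgebra generated by F
normalize that subalgebra. In a bracket of two elements the Cartan contributions are thus absorbed.
-/
theorem lie_mem_lieSpan_sup {F H₀ : Submodule ℂ L} {x : L} (hx : ∀ f ∈ F, ⁅x, f⁆ ∈ H₀)
    (hHF : ∀ h ∈ H₀, ∀ f ∈ F, ⁅h, f⁆ ∈ F) {y : L}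
    (hy : y ∈ LieSubalgebra.lieSpan ℂ L (F : Set L)) :
    ⁅x, y⁆ ∈ (LieSubalgebra.lieSpan ℂ L (F : Set L)).toSubmodule ⊔ H₀ := by
  have hstab : ∀ z ∈ (LieSubalgebra.lieSpan ℂ L (F : Set L)).toSubmodule ⊔ H₀,
      ∀ b ∈ LieSubalgebra.lieSpan ℂ L (F : Set L),
      ⁅z, b⁆ ∈ LieSubalgebra.lieSpan ℂ L (F : Set L) := by
    intro z hz b hb
    obtain ⟨a, ha, h, hh, rfl⟩ := Submodule.mem_sup.1 hz
    rw [add_lie]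
    exact LieSubalgebra.add_mem _ (LieSubalgebra.lie_mem _ ha hb)
      (lie_mem_lieSpan (fun f hf => LieSubalgebra.subset_lieSpan (hHF h hh f hf)) hb)
  induction hy using LieSubalgebra.lieSpan_induction with
  | mem s hs => exact Submodule.mem_sup_right (hx s hs)
  | zero => rw [lie_zero]; exact Submodule.zero_mem _
  | add a b _ _ ha hb => rw [lie_add]; exact Submodule.add_mem _ ha hb
  | smul c a _ ha => rw [lie_smul]; exact Submodule.smul_mem _ c ha
  | lie a b ha hb iha ihb =>
    rw [leibniz_lie, ← lie_skew a]
    exact Submodule.mem_sup_left (LieSubalgebra.add_mem _ (hstab _ iha b hb)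
      (neg_mem (hstab _ ihb a ha)))

/-- The triangular decomposition of a Lie algebra generated by spaces `F`, `H₀` and `E`. -/
theorem lieSpan_le_triangular {E F H₀ : Submodule ℂ L} (hHH : ∀ x ∈ H₀, ∀ y ∈ H₀, ⁅x, y⁆ ∈ H₀)
    (hHE : ∀ x ∈ H₀, ∀ e ∈ E, ⁅x, e⁆ ∈ E) (hHF : ∀ x ∈ H₀, ∀ f ∈ F, ⁅x, f⁆ ∈ F)
    (hEF : ∀ e ∈ E, ∀ f ∈ F, ⁅e, f⁆ ∈ H₀) :
    (LieSubalgebra.lieSpan ℂ L (F ∪ H₀ ∪ E : Set L)).toSubmodule ≤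
      (LieSubalgebra.lieSpan ℂ L (F : Set L)).toSubmodule ⊔ H₀ ⊔
        (LieSubalgebra.lieSpan ℂ L (E : Set L)).toSubmodule := by
  set NF := (LieSubalgebra.lieSpan ℂ L (F : Set L)).toSubmodule with hNF
  set NE := (LieSubalgebra.lieSpan ℂ L (E : Set L)).toSubmodule with hNE
  set K := NF ⊔ H₀ ⊔ NE with hK
  have hFK : NF ≤ K := le_sup_left.trans le_sup_left
  have hHK : H₀ ≤ K := le_sup_right.trans le_sup_left
  have hEK : NE ≤ K := le_sup_right
  have hfE : ∀ f ∈ F, ∀ e ∈ E, ⁅f, e⁆ ∈ H₀ := fun f hf e he => by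
    rw [← lie_skew]; exact H₀.neg_mem (hEF e he f hf)
  have step : ∀ x ∈ (F ∪ H₀ ∪ E : Set L), K ≤ Submodule.comap (LieAlgebra.ad ℂ L x) K := by
    rintro x ((hx | hx) | hx)
    · refine sup_le (sup_le (fun y hy => ?_) fun y hy => ?_) fun y hy => ?_
      · exact hFK (LieSubalgebra.lie_mem _ (LieSubalgebra.subset_lieSpan hx) hy)
      · refine hFK (LieSubalgebra.subset_lieSpan ?_)
        change ⁅x, y⁆ ∈ F
        rw [← lie_skew]; exact F.neg_mem (hHF y hy x hx)
      · exact (sup_le hEK hHK : NE ⊔ H₀ ≤ K) (lie_mem_lieSpan_sup (hfE x hx) hHE hy)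
    · refine sup_le (sup_le (fun y hy => ?_) fun y hy => ?_) fun y hy => ?_
      · exact hFK (lie_mem_lieSpan (fun f hf => LieSubalgebra.subset_lieSpan (hHF x hx f hf)) hy)
      · exact hHK (hHH x hx y hy)
      · exact hEK (lie_mem_lieSpan (fun f hf => LieSubalgebra.subset_lieSpan (hHE x hx f hf)) hy)
    · refine sup_le (sup_le (fun y hy => ?_) fun y hy => ?_) fun y hy => ?_
      · exact (sup_le hFK hHK : NF ⊔ H₀ ≤ K) (lie_mem_lieSpan_sup (hEF x hx) hHF hy)
      · refine hEK (LieSubalgebra.subset_lieSpan ?_)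
        change ⁅x, y⁆ ∈ E
        rw [← lie_skew]; exact E.neg_mem (hHE y hy x hx)
      · exact hEK (LieSubalgebra.lie_mem _ (LieSubalgebra.subset_lieSpan hx) hy)
  -- Stability of K under ad of the generators passes to the whole subalgebra. Since K contains the
  -- generators, K then contains the subalgebra.
  have hnorm : LieSubalgebra.lieSpan ℂ L (F ∪ H₀ ∪ E : Set L) ≤
      stabilizer (LieAlgebra.ad ℂ L) K := LieSubalgebra.lieSpan_le.2 step
  have hsub : (F ∪ H₀ ∪ E : Set L) ⊆ K := Set.union_subset (Set.union_subset
    (fun x hx => hFK (LieSubalgebra.subset_lieSpan hx)) hHK)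
    fun x hx => hEK (LieSubalgebra.subset_lieSpan hx)
  intro x hx
  have hx' : x ∈ LieSubalgebra.lieSpan ℂ L (F ∪ H₀ ∪ E : Set L) := hx
  induction hx' using LieSubalgebra.lieSpan_induction with
  | mem s hs => exact hsub hs
  | zero => exact K.zero_mem
  | add a b ha' hb' ha hb => exact K.add_mem (ha ha') (hb hb')
  | smul c a ha' ha => exact K.smul_mem c (ha ha')
  | lie a b ha' hb' ha hb => exact hnorm ha' b (hb hb')

theorem lie_mem_span {L : Type*} [LieRing L] [LieAlgebra ℂ L] {S T U : Set L}
    (h : ∀ x ∈ S, ∀ y ∈ T, ⁅x, y⁆ ∈ Submodule.span ℂ U) :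
    ∀ x ∈ Submodule.span ℂ S, ∀ y ∈ Submodule.span ℂ T, ⁅x, y⁆ ∈ Submodule.span ℂ U := by
  intro x hx y hy
  induction hx using Submodule.span_induction with
  | zero => rw [zero_lie]; exact Submodule.zero_mem _
  | add a b _ _ ha hb => rw [add_lie]; exact Submodule.add_mem _ ha hb
  | smul c a _ ha => rw [smul_lie]; exact Submodule.smul_mem _ c ha
  | mem x hx =>
    induction hy using Submodule.span_induction with
    | zero => rw [lie_zero]; exact Submodule.zero_mem _
    | add a b _ _ ha hb => rw [lie_add]; exact Submodule.add_mem _ ha hb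
    | smul c a _ ha => rw [lie_smul]; exact Submodule.smul_mem _ c ha
    | mem y hy => exact h x hx y hy

/-- The span of the eigenvectors of `ad D` with positive integral eigenvalues. -/
def positivePart (D : L) : LieSubalgebra ℂ L where
  toSubmodule := Submodule.span ℂ {x | ∃ j : ℕ, ⁅D, x⁆ = ((j : ℂ) + 1) • x}
  lie_mem' := by
    intro x y hx hy
    change x ∈ Submodule.span ℂ {x | ∃ j : ℕ, ⁅D, x⁆ = ((j : ℂ) + 1) • x} at hx
    change y ∈ Submodule.span ℂ {x | ∃ j : ℕ, ⁅D, x⁆ = ((j : ℂ) + 1) • x} at hy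
    change ⁅x, y⁆ ∈ Submodule.span ℂ {x | ∃ j : ℕ, ⁅D, x⁆ = ((j : ℂ) + 1) • x}
    induction hx using Submodule.span_induction with
    | zero => rw [zero_lie]; exact Submodule.zero_mem _
    | add a b _ _ ha hb => rw [add_lie]; exact Submodule.add_mem _ ha hb
    | smul c a _ ha => rw [smul_lie]; exact Submodule.smul_mem _ c ha
    | mem x hx =>
      obtain ⟨j, hj⟩ := hx
      induction hy using Submodule.span_induction with
      | zero => rw [lie_zero]; exact Submodule.zero_mem _
      | add a b _ _ ha hb => rw [lie_add]; exact Submodule.add_mem _ ha hb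
      | smul c a _ ha => rw [lie_smul]; exact Submodule.smul_mem _ c ha
      | mem y hy =>
        obtain ⟨i, hi⟩ := hy
        refine Submodule.subset_span ⟨j + i + 1, ?_⟩
        rw [leibniz_lie, hj, hi, smul_lie, lie_smul, ← add_smul]
        congr 1
        push_cast
        ring

/-- Eigenspaces of ad D are independent: x has eigenvalue 0, while -(a + b) lies in the sum of the
nonzero eigenspaces. This provides directness of the triangular decomposition at the Cartan part. -/
theorem eq_zero_of_add_eq_zero {D a x b : L} (ha : a ∈ positivePart (-D)) (hx : ⁅D, x⁆ = 0)
    (hb : b ∈ positivePart D) (h : a + x + b = 0) : x = 0 := by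
  have hind := Module.End.eigenspaces_iSupIndep (LieAlgebra.ad ℂ L D) 0
  rw [Submodule.disjoint_def] at hind
  refine hind x ?_ ?_
  · rw [Module.End.mem_eigenspace_iff, LieAlgebra.ad_apply, hx, zero_smul]
  · have hpos : ∀ D' : L, (∀ (j : ℕ) (x : L), ⁅D', x⁆ = ((j : ℂ) + 1) • x →
        x ∈ ⨆ μ, ⨆ (_ : μ ≠ 0), Module.End.eigenspace (LieAlgebra.ad ℂ L D) μ) →
        (positivePart D').toSubmodule ≤
          ⨆ μ, ⨆ (_ : μ ≠ 0), Module.End.eigenspace (LieAlgebra.ad ℂ L D) μ := by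
      intro D' hD'
      refine Submodule.span_le.2 ?_
      rintro x ⟨j, hj⟩
      exact hD' j x hj
    have h1 : ∀ j : ℕ, (j : ℂ) + 1 ≠ 0 := fun j => by exact_mod_cast Nat.succ_ne_zero j
    have hb' := hpos D (fun j x hj => Submodule.mem_iSup_of_mem ((j : ℂ) + 1)
      (Submodule.mem_iSup_of_mem (h1 j) (Module.End.mem_eigenspace_iff.2 hj))) hb
    have ha' := hpos (-D) (fun j x hj => Submodule.mem_iSup_of_mem (-((j : ℂ) + 1))
      (Submodule.mem_iSup_of_mem (neg_ne_zero.2 (h1 j)) (Module.End.mem_eigenspace_iff.2 (by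
        rw [LieAlgebra.ad_apply, neg_smul, ← hj, neg_lie, neg_neg])))) ha
    have : x = -(a + b) := by
      rw [eq_neg_iff_add_eq_zero, ← h]; abel
    rw [this]
    exact Submodule.neg_mem _ (Submodule.add_mem _ ha' hb')

end Triangular

/-! ### Relations and triangular decomposition of the Kac-Moody algebra. -/

section KacMoody

variable {ι : Type u} [Fintype ι] {C : Matrix ι ι ℤ} {H : Type v} [AddCommGroup H] [Module ℂ H]
  (Z : Realization C H)

/-- The projection of the free Lie algebra onto the Kac-Moody algebra. -/
def kmProj : FreeLieAlgebra ℂ (Gen ι H) →ₗ⁅ℂ⁆ KM Z where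
  toFun x := LieSubmodule.Quotient.mk (N := maxIdeal Z)
    (LieSubmodule.Quotient.mk (N := relIdeal Z) x : Aux Z)
  map_add' _ _ := rfl
  map_smul' _ _ := rfl
  map_lie' := rfl

theorem kmProj_of (x : Gen ι H) : kmProj Z (FreeLieAlgebra.of ℂ x) = kmGen Z x := rfl

theorem kmProj_surjective : Function.Surjective (kmProj Z) := by
  intro x
  obtain ⟨y, rfl⟩ := LieSubmodule.Quotient.surjective_mk' (maxIdeal Z) x
  obtain ⟨z, rfl⟩ := LieSubmodule.Quotient.surjective_mk' (relIdeal Z) y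
  exact ⟨z, rfl⟩

theorem kmProj_rel {x : FreeLieAlgebra ℂ (Gen ι H)} (hx : Rel Z x) : kmProj Z x = 0 := by
  have h : (LieSubmodule.Quotient.mk (N := relIdeal Z) x : Aux Z) = 0 :=
    (LieSubmodule.Quotient.mk_eq_zero' (N := relIdeal Z)).2
      (LieSubmodule.subset_lieSpan hx)
  change LieSubmodule.Quotient.mk (N := maxIdeal Z)
    (LieSubmodule.Quotient.mk (N := relIdeal Z) x : Aux Z) = 0
  rw [h]; rfl

/-- The map from `H` to the Kac-Moody algebra. -/
def kmH : H →ₗ[ℂ] KM Z where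
  toFun x := kmGen Z (.h x)
  map_add' x y := by
    have := kmProj_rel Z (Rel.add (Z := Z) x y)
    rw [map_sub, map_sub, sub_sub, sub_eq_zero] at this
    exact this
  map_smul' c x := by
    have := kmProj_rel Z (Rel.smul (Z := Z) c x)
    rw [map_sub, map_smul, sub_eq_zero] at this
    exact this

/-- The generator `e i`. -/
def kmE (i : ι) : KM Z := kmGen Z (.e i)

/-- The generator `f i`. -/
def kmF (i : ι) : KM Z := kmGen Z (.f i)

theorem kmH_lie_kmH (x y : H) : ⁅kmH Z x, kmH Z y⁆ = 0 := by
  have := kmProj_rel Z (Rel.hh x y)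
  rwa [LieHom.map_lie] at this

theorem kmH_lie_kmE (x : H) (i : ι) : ⁅kmH Z x, kmE Z i⁆ = Z.root i x • kmE Z i := by
  have := kmProj_rel Z (Rel.he x i)
  rw [map_sub, LieHom.map_lie, map_smul, sub_eq_zero] at this
  exact this

theorem kmH_lie_kmF (x : H) (i : ι) : ⁅kmH Z x, kmF Z i⁆ = -(Z.root i x • kmF Z i) := by
  have := kmProj_rel Z (Rel.hf x i)
  rw [map_add, LieHom.map_lie, map_smul] at this
  exact eq_neg_of_add_eq_zero_left this

theorem kmE_lie_kmF_same (i : ι) : ⁅kmE Z i, kmF Z i⁆ = kmH Z (Z.coroot i) := by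
  have := kmProj_rel Z (Rel.ef_same i)
  rw [map_sub, LieHom.map_lie, sub_eq_zero] at this
  exact this

theorem kmE_lie_kmF_ne {i j : ι} (hij : i ≠ j) : ⁅kmE Z i, kmF Z j⁆ = 0 := by
  have := kmProj_rel Z (Rel.ef_ne i j hij)
  rwa [LieHom.map_lie] at this

theorem cartan_eq : cartan Z = LinearMap.range (kmH Z) := by
  refine le_antisymm (Submodule.span_le.2 ?_) ?_
  · rintro _ ⟨x, rfl⟩
    exact ⟨x, rfl⟩
  · rintro _ ⟨x, rfl⟩
    exact Submodule.subset_span ⟨x, rfl⟩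

/-- The negative part of the Kac-Moody algebra. -/
def nNeg : LieSubalgebra ℂ (KM Z) :=
  LieSubalgebra.lieSpan ℂ (KM Z) (Set.range (kmF Z))

theorem lieSpan_gen_eq_top {K : LieSubalgebra ℂ (KM Z)} (hh : ∀ x, kmH Z x ∈ K)
    (he : ∀ i, kmE Z i ∈ K) (hf : ∀ i, kmF Z i ∈ K) : K = ⊤ := by
  rw [eq_top_iff]
  intro x _
  obtain ⟨y, rfl⟩ := kmProj_surjective Z x
  -- Since all generators lie in K, the projection from the free Lie algebra factors through K.
  let g : FreeLieAlgebra ℂ (Gen ι H) →ₗ⁅ℂ⁆ K := FreeLieAlgebra.lift ℂ fun x =>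
    ⟨kmGen Z x, by cases x with
      | h x => exact hh x
      | e i => exact he i
      | f i => exact hf i⟩
  have hg : K.incl.comp g = kmProj Z := by
    refine FreeLieAlgebra.hom_ext fun x => ?_
    rw [LieHom.comp_apply, FreeLieAlgebra.lift_of_apply, kmProj_of]; rfl
  rw [← hg]
  exact (g y).2

theorem km_triangular :
    (nNeg Z).toSubmodule ⊔ cartan Z ⊔ (nPos Z).toSubmodule = ⊤ := by
  have key := lieSpan_le_triangular (E := Submodule.span ℂ (Set.range (kmE Z)))
    (F := Submodule.span ℂ (Set.range (kmF Z))) (H₀ := cartan Z)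
    (lie_mem_span (by
      rintro _ ⟨x, rfl⟩ _ ⟨y, rfl⟩
      exact (kmH_lie_kmH Z x y).symm ▸ Submodule.zero_mem _))
    (lie_mem_span (by
      rintro _ ⟨x, rfl⟩ _ ⟨i, rfl⟩
      exact (kmH_lie_kmE Z x i).symm ▸ Submodule.smul_mem _ _ (Submodule.subset_span ⟨i, rfl⟩)))
    (lie_mem_span (by
      rintro _ ⟨x, rfl⟩ _ ⟨i, rfl⟩
      exact (kmH_lie_kmF Z x i).symm ▸ Submodule.neg_mem _
        (Submodule.smul_mem _ _ (Submodule.subset_span ⟨i, rfl⟩))))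
    (lie_mem_span (by
      rintro _ ⟨i, rfl⟩ _ ⟨j, rfl⟩
      by_cases hij : i = j
      · subst hij
        exact (kmE_lie_kmF_same Z i).symm ▸ Submodule.subset_span ⟨_, rfl⟩
      · exact (kmE_lie_kmF_ne Z hij).symm ▸ Submodule.zero_mem _))
  rw [lieSpan_span, lieSpan_span] at key
  rw [eq_top_iff]
  refine le_trans ?_ key
  rw [lieSpan_gen_eq_top Z (K := LieSubalgebra.lieSpan ℂ (KM Z) _)]
  · exact le_rfl
  · exact fun x => LieSubalgebra.subset_lieSpan (Or.inl (Or.inr (Submodule.subset_span ⟨x, rfl⟩)))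
  · exact fun i => LieSubalgebra.subset_lieSpan (Or.inr (Submodule.subset_span ⟨i, rfl⟩))
  · exact fun i => LieSubalgebra.subset_lieSpan
      (Or.inl (Or.inl (Submodule.subset_span ⟨i, rfl⟩)))

/-- Linear independence of the roots gives a functional on the dual of H with value 1 on each of
them; it is evaluation at a point because H is finite-dimensional. -/
theorem exists_root_eq_one : ∃ x : H, ∀ i, Z.root i x = 1 := by
  have := Z.finiteDimensional
  obtain ⟨g, hg⟩ := LinearMap.exists_extend
    ((Finsupp.linearCombination ℂ fun _ : ι => (1 : ℂ)) ∘ₗ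
      Z.linearIndependent_root.repr)
  obtain ⟨x, hx⟩ := (Module.evalEquiv ℂ H).surjective g
  refine ⟨x, fun i => ?_⟩
  have h1 := LinearMap.congr_fun hg ⟨Z.root i, Submodule.subset_span ⟨i, rfl⟩⟩
  rw [← hx] at h1
  simp only [LinearMap.comp_apply, Submodule.subtype_apply] at h1
  rw [Z.linearIndependent_root.repr_eq_single i _ rfl, Finsupp.linearCombination_single] at h1
  simpa using h1

/-- An element of `H` on which all simple roots take the value `1`. -/
def rhoCheck : H := (exists_root_eq_one Z).choose

theorem root_rhoCheck (i : ι) : Z.root i (rhoCheck Z) = 1 := (exists_root_eq_one Z).choose_spec i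

theorem rhoCheck_lie_kmE (i : ι) : ⁅kmH Z (rhoCheck Z), kmE Z i⁆ = kmE Z i := by
  rw [kmH_lie_kmE, root_rhoCheck, one_smul]

theorem rhoCheck_lie_kmF (i : ι) : ⁅kmH Z (rhoCheck Z), kmF Z i⁆ = -kmF Z i := by
  rw [kmH_lie_kmF, root_rhoCheck, one_smul]

theorem lie_mem_derived (x y : KM Z) : ⁅x, y⁆ ∈ (derived Z).toSubmodule :=
  LieSubmodule.lie_mem_lie (LieSubmodule.mem_top x) (LieSubmodule.mem_top y)

theorem kmE_mem_derived (i : ι) : kmE Z i ∈ (derived Z).toSubmodule := by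
  rw [← rhoCheck_lie_kmE]; exact lie_mem_derived Z _ _

theorem kmF_mem_derived (i : ι) : kmF Z i ∈ (derived Z).toSubmodule := by
  rw [← neg_neg (kmF Z i), ← rhoCheck_lie_kmF]; exact Submodule.neg_mem _ (lie_mem_derived Z _ _)

theorem nPos_le_derived : (nPos Z).toSubmodule ≤ (derived Z).toSubmodule := by
  refine (LieSubalgebra.lieSpan_le (K := (derived Z).toLieSubalgebra)).2 ?_
  rintro _ ⟨i, rfl⟩
  exact kmE_mem_derived Z i

theorem nNeg_le_derived : (nNeg Z).toSubmodule ≤ (derived Z).toSubmodule := by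
  refine (LieSubalgebra.lieSpan_le (K := (derived Z).toLieSubalgebra)).2 ?_
  rintro _ ⟨i, rfl⟩
  exact kmF_mem_derived Z i

theorem coroot_mem_cartan' (i : ι) : kmH Z (Z.coroot i) ∈ cartan' Z :=
  ⟨Submodule.subset_span ⟨_, rfl⟩, by
    rw [← kmE_lie_kmF_same]; exact lie_mem_derived Z _ _⟩

/-- Both nilpotent parts lie in g', so the Cartan part of an element of g' is in h ∩ g' = h'. -/
theorem derived_decomp {x : KM Z} (hx : x ∈ (derived Z).toSubmodule) :
    ∃ a ∈ nNeg Z, ∃ h : cartan' Z, ∃ b ∈ nPos Z, x = a + h + b := by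
  have hx' : x ∈ (nNeg Z).toSubmodule ⊔ cartan Z ⊔ (nPos Z).toSubmodule :=
    km_triangular Z ▸ Submodule.mem_top
  obtain ⟨y, hy, b, hb, rfl⟩ := Submodule.mem_sup.1 hx'
  obtain ⟨a, ha, h, hh, rfl⟩ := Submodule.mem_sup.1 hy
  refine ⟨a, ha, ⟨h, hh, ?_⟩, b, hb, rfl⟩
  have : h = (a + h + b) - a - b := by abel
  rw [this]
  exact Submodule.sub_mem _ (Submodule.sub_mem _ hx (nNeg_le_derived Z ha)) (nPos_le_derived Z hb)

end KacMoody

/-! ### Triangular structure of the loop algebra. -/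

section LoopTriangular

variable {ι : Type u} [Fintype ι] {C : Matrix ι ι ℤ} {H : Type v} [AddCommGroup H] [Module ℂ H]
  {Z : Realization C H} {n : ℕ} {H2 : Submodule ℂ (KM Z)}

theorem tmul_mem_loopSub (a : Laurent n) {S : Submodule ℂ (KM Z)} {s : KM Z} (hs : s ∈ S) :
    a ⊗ₜ[ℂ] s ∈ loopSub n S := ⟨a ⊗ₜ[ℂ] ⟨s, hs⟩, rfl⟩

theorem loopSub_le {S : Submodule ℂ (KM Z)} {N : Submodule ℂ (Laurent n ⊗[ℂ] KM Z)}
    (h : ∀ a : Laurent n, ∀ s ∈ S, a ⊗ₜ[ℂ] s ∈ N) : loopSub n S ≤ N := by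
  rintro _ ⟨z, rfl⟩
  induction z using TensorProduct.induction_on with
  | zero => rw [map_zero]; exact N.zero_mem
  | add x y hx hy => rw [map_add]; exact N.add_mem hx hy
  | tmul a s => exact h a s s.2

theorem loopSub_mono {S T : Submodule ℂ (KM Z)} (h : S ≤ T) : loopSub n S ≤ loopSub n T :=
  loopSub_le fun a _ hs => tmul_mem_loopSub a (h hs)

theorem tmul_lie_tmul (a b : Laurent n) (x y : KM Z) :
    ⁅a ⊗ₜ[ℂ] x, b ⊗ₜ[ℂ] y⁆ = (a * b) ⊗ₜ[ℂ] ⁅x, y⁆ := rfl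

theorem loopSub_lie {S T U : Submodule ℂ (KM Z)} (h : ∀ x ∈ S, ∀ y ∈ T, ⁅x, y⁆ ∈ U)
    {x y : Laurent n ⊗[ℂ] KM Z} (hx : x ∈ loopSub n S) (hy : y ∈ loopSub n T) :
    ⁅x, y⁆ ∈ loopSub n U := by
  have h1 : loopSub n T ≤ Submodule.comap (LieAlgebra.ad ℂ (Laurent n ⊗[ℂ] KM Z) x)
      (loopSub n U) := by
    refine loopSub_le fun b y hy => ?_
    have h2 : loopSub n S ≤ Submodule.comap
        (LieAlgebra.ad ℂ (Laurent n ⊗[ℂ] KM Z) (b ⊗ₜ[ℂ] y)) (loopSub n U) := by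
      refine loopSub_le fun a x hx => ?_
      rw [Submodule.mem_comap, LieAlgebra.ad_apply, tmul_lie_tmul, ← lie_skew]
      exact tmul_mem_loopSub _ (U.neg_mem (h x hx y hy))
    rw [Submodule.mem_comap, LieAlgebra.ad_apply, ← lie_skew]
    exact Submodule.neg_mem _ (h2 hx)
  exact h1 hy

/-- Lifting the elements a ⊗ s with s a generator is enough to lift the whole loop algebra of the
generated subalgebra. Applied to the inclusion of g_A it shows that N^± ⊗ A is generated by the
loops of Chevalley generators; applied to the algebra of pairs it gives surjectivity onto g ⊗ A. -/
theorem exists_lift_of_mem_lieSpan {L : Type*} [LieRing L] [LieAlgebra ℂ L]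
    (φ : L →ₗ⁅ℂ⁆ Laurent n ⊗[ℂ] KM Z) {K : LieSubalgebra ℂ L} {S : Set (KM Z)}
    (h : ∀ a : Laurent n, ∀ s ∈ S, ∃ z ∈ K, φ z = a ⊗ₜ[ℂ] s) {x : Laurent n ⊗[ℂ] KM Z}
    (hx : x ∈ loopSub n (LieSubalgebra.lieSpan ℂ (KM Z) S).toSubmodule) : ∃ z ∈ K, φ z = x := by
  have key : ∀ y ∈ LieSubalgebra.lieSpan ℂ (KM Z) S, ∀ a : Laurent n,
      ∃ z ∈ K, φ z = a ⊗ₜ[ℂ] y := by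
    intro y hy
    induction hy using LieSubalgebra.lieSpan_induction with
    | mem s hs => exact fun a => h a s hs
    | zero => exact fun a => ⟨0, K.zero_mem, by rw [map_zero, TensorProduct.tmul_zero]⟩
    | add x y _ _ hx hy =>
      intro a
      obtain ⟨z, hz, hz'⟩ := hx a
      obtain ⟨w, hw, hw'⟩ := hy a
      exact ⟨z + w, K.add_mem hz hw, by rw [map_add, hz', hw', TensorProduct.tmul_add]⟩
    | smul c x _ hx =>
      intro a
      obtain ⟨z, hz, hz'⟩ := hx a
      exact ⟨c • z, K.smul_mem c hz, by rw [map_smul, hz', TensorProduct.tmul_smul]⟩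
    -- The coefficient is put on one factor only: a ⊗ [x, y] = [a ⊗ x, 1 ⊗ y].
    | lie x y _ _ hx hy =>
      intro a
      obtain ⟨z, hz, hz'⟩ := hx a
      obtain ⟨w, hw, hw'⟩ := hy 1
      exact ⟨⁅z, w⁆, K.lie_mem hz hw, by rw [LieHom.map_lie, hz', hw', tmul_lie_tmul, mul_one]⟩
  have : loopSub n (LieSubalgebra.lieSpan ℂ (KM Z) S).toSubmodule ≤
      Submodule.map (φ : L →ₗ[ℂ] Laurent n ⊗[ℂ] KM Z) K.toSubmodule :=
    loopSub_le fun a s hs => key s hs a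
  exact this hx

theorem derived_le_loopKM : loopSub n (derived Z).toSubmodule ≤ (loopKM Z n H2).toSubmodule :=
  le_sup_left

/-- The subspace `S ⊗ A` of `g_A`, intersected with `g_A`. -/
def loopPart (n : ℕ) (H2 S : Submodule ℂ (KM Z)) : Submodule ℂ (loopKM Z n H2) :=
  Submodule.comap (loopKM Z n H2).toSubmodule.subtype (loopSub n S)

/-- The inclusion of `h_A` in `g_A` as a linear map. -/
def loopCartanLin (Z : Realization C H) (n : ℕ) (H2 : Submodule ℂ (KM Z)) :
    LoopCartan Z n H2 →ₗ[ℂ] loopKM Z n H2 where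
  toFun := loopCartanIncl Z n H2
  map_add' x y := Subtype.ext (map_add (loopCartanMap Z n H2) x y)
  map_smul' c x := Subtype.ext (map_smul (loopCartanMap Z n H2) c x)

theorem loopCartanMap_apply (a : Laurent n ⊗[ℂ] cartan' Z) (b : H2) :
    loopCartanMap Z n H2 (a, b) =
      LinearMap.lTensor (Laurent n) (cartan' Z).subtype a + 1 ⊗ₜ[ℂ] (b : KM Z) := by
  rw [loopCartanMap, LinearMap.coprod_apply]; rfl

theorem loopCartanMap_mem_loopSub (hH2 : IsCartanCompl Z H2) (y : LoopCartan Z n H2) :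
    loopCartanMap Z n H2 y ∈ loopSub n (cartan Z) := by
  obtain ⟨a, b⟩ := y
  rw [loopCartanMap_apply]
  refine Submodule.add_mem _ (loopSub_mono (inf_le_left : cartan' Z ≤ cartan Z) ⟨a, rfl⟩)
    (tmul_mem_loopSub _ ?_)
  rw [← hH2.2]
  exact Submodule.mem_sup_right b.2

theorem cartan'_le_range : loopSub n (cartan' Z) ≤ LinearMap.range (loopCartanMap Z n H2) := by
  rintro _ ⟨a, rfl⟩
  exact ⟨(a, 0), by
    rw [loopCartanMap_apply, Submodule.coe_zero, TensorProduct.tmul_zero, add_zero]⟩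

/-- The element with all roots equal to 1 need not lie in h'; the summand h'' of h_A is what
supplies the rest of it. -/
theorem exists_grading (hH2 : IsCartanCompl Z H2) :
    ∃ d : LoopCartan Z n H2, loopCartanMap Z n H2 d = 1 ⊗ₜ[ℂ] kmH Z (rhoCheck Z) := by
  have h : kmH Z (rhoCheck Z) ∈ cartan' Z ⊔ H2 := by
    rw [hH2.2]; exact Submodule.subset_span ⟨_, rfl⟩
  obtain ⟨x, hx, y, hy, hxy⟩ := Submodule.mem_sup.1 h
  refine ⟨(1 ⊗ₜ[ℂ] ⟨x, hx⟩, ⟨y, hy⟩), ?_⟩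
  rw [loopCartanMap_apply, LinearMap.lTensor_tmul, ← hxy, TensorProduct.tmul_add]; rfl

theorem cartan_lie_negGen {x y : KM Z} (hx : x ∈ cartan Z)
    (hy : y ∈ Submodule.span ℂ (Set.range (kmF Z))) :
    ⁅x, y⁆ ∈ Submodule.span ℂ (Set.range (kmF Z)) := by
  rw [cartan_eq] at hx
  obtain ⟨x, rfl⟩ := hx
  have : Submodule.span ℂ (Set.range (kmF Z)) ≤ Submodule.comap
      (LieAlgebra.ad ℂ (KM Z) (kmH Z x)) (Submodule.span ℂ (Set.range (kmF Z))) := by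
    refine Submodule.span_le.2 ?_
    rintro _ ⟨i, rfl⟩
    change ⁅kmH Z x, kmF Z i⁆ ∈ Submodule.span ℂ (Set.range (kmF Z))
    rw [kmH_lie_kmF]
    exact Submodule.neg_mem _ (Submodule.smul_mem _ _ (Submodule.subset_span ⟨i, rfl⟩))
  exact this hy

theorem posGen_lie_negGen {x y : KM Z} (hx : x ∈ Submodule.span ℂ (Set.range (kmE Z)))
    (hy : y ∈ Submodule.span ℂ (Set.range (kmF Z))) : ⁅x, y⁆ ∈ cartan' Z := by
  induction hx using Submodule.span_induction with
  | zero => rw [zero_lie]; exact Submodule.zero_mem _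
  | add a b _ _ ha hb => rw [add_lie]; exact Submodule.add_mem _ ha hb
  | smul c a _ ha => rw [smul_lie]; exact Submodule.smul_mem _ c ha
  | mem x hx =>
    obtain ⟨i, rfl⟩ := hx
    induction hy using Submodule.span_induction with
    | zero => rw [lie_zero]; exact Submodule.zero_mem _
    | add a b _ _ ha hb => rw [lie_add]; exact Submodule.add_mem _ ha hb
    | smul c a _ ha => rw [lie_smul]; exact Submodule.smul_mem _ c ha
    | mem y hy =>
      obtain ⟨j, rfl⟩ := hy
      by_cases hij : i = j
      · subst hij
        rw [kmE_lie_kmF_same]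
        exact coroot_mem_cartan' Z i
      · rw [kmE_lie_kmF_ne Z hij]; exact Submodule.zero_mem _

theorem rhoCheck_lie_loop {f : Laurent n ⊗[ℂ] KM Z}
    (hf : f ∈ loopSub n (Submodule.span ℂ (Set.range (kmF Z)))) :
    ⁅(1 : Laurent n) ⊗ₜ[ℂ] kmH Z (rhoCheck Z), f⁆ = -f := by
  have h1 : Submodule.span ℂ (Set.range (kmF Z)) ≤
      LinearMap.ker
        (LieAlgebra.ad ℂ (KM Z) (kmH Z (rhoCheck Z)) + LinearMap.id : Module.End ℂ (KM Z)) := by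
    refine Submodule.span_le.2 ?_
    rintro _ ⟨i, rfl⟩
    change ⁅kmH Z (rhoCheck Z), kmF Z i⁆ + kmF Z i = 0
    rw [rhoCheck_lie_kmF, neg_add_cancel]
  have h2 : loopSub n (Submodule.span ℂ (Set.range (kmF Z))) ≤
      LinearMap.ker (LieAlgebra.ad ℂ (Laurent n ⊗[ℂ] KM Z)
        ((1 : Laurent n) ⊗ₜ[ℂ] kmH Z (rhoCheck Z)) + LinearMap.id :
          Module.End ℂ (Laurent n ⊗[ℂ] KM Z)) := by
    refine loopSub_le fun a s hs => ?_
    have hs' : ⁅kmH Z (rhoCheck Z), s⁆ + s = 0 := h1 hs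
    rw [LinearMap.mem_ker, LinearMap.add_apply, LieAlgebra.ad_apply, tmul_lie_tmul, one_mul,
      LinearMap.id_apply, ← TensorProduct.tmul_add, hs', TensorProduct.tmul_zero]
  exact eq_neg_of_add_eq_zero_left (h2 hf)

theorem negPart_mem_lieSpan {x : loopKM Z n H2}
    (hx : (x : Laurent n ⊗[ℂ] KM Z) ∈ loopSub n (nNeg Z).toSubmodule) :
    x ∈ LieSubalgebra.lieSpan ℂ (loopKM Z n H2)
      (loopPart n H2 (Submodule.span ℂ (Set.range (kmF Z))) : Set (loopKM Z n H2)) := by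
  obtain ⟨z, hz, hzx⟩ := exists_lift_of_mem_lieSpan (loopKM Z n H2).incl
    (K := LieSubalgebra.lieSpan ℂ (loopKM Z n H2)
      (loopPart n H2 (Submodule.span ℂ (Set.range (kmF Z))) : Set (loopKM Z n H2)))
    (fun a s hs => by
      obtain ⟨i, rfl⟩ := hs
      refine ⟨⟨a ⊗ₜ[ℂ] kmF Z i, derived_le_loopKM (tmul_mem_loopSub a (kmF_mem_derived Z i))⟩,
        LieSubalgebra.subset_lieSpan ?_, rfl⟩
      exact tmul_mem_loopSub a (Submodule.subset_span ⟨i, rfl⟩)) hx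
  rwa [← show z = x from Subtype.ext hzx]

theorem posPart_mem_lieSpan {x : loopKM Z n H2}
    (hx : (x : Laurent n ⊗[ℂ] KM Z) ∈ loopSub n (nPos Z).toSubmodule) :
    x ∈ LieSubalgebra.lieSpan ℂ (loopKM Z n H2)
      (loopPart n H2 (Submodule.span ℂ (Set.range (kmE Z))) : Set (loopKM Z n H2)) := by
  obtain ⟨z, hz, hzx⟩ := exists_lift_of_mem_lieSpan (loopKM Z n H2).incl
    (K := LieSubalgebra.lieSpan ℂ (loopKM Z n H2)
      (loopPart n H2 (Submodule.span ℂ (Set.range (kmE Z))) : Set (loopKM Z n H2)))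
    (fun a s hs => by
      obtain ⟨i, rfl⟩ := hs
      refine ⟨⟨a ⊗ₜ[ℂ] kmE Z i, derived_le_loopKM (tmul_mem_loopSub a (kmE_mem_derived Z i))⟩,
        LieSubalgebra.subset_lieSpan ?_, rfl⟩
      exact tmul_mem_loopSub a (Submodule.subset_span ⟨i, rfl⟩)) hx
  rwa [← show z = x from Subtype.ext hzx]

/-- The elements `a ⊗ x` with `x ∈ g'` decompose along the triangular decomposition. -/
theorem tmul_derived_decomp (a : Laurent n) {x : KM Z} (hx : x ∈ (derived Z).toSubmodule)
    {z : loopKM Z n H2} (hz : (z : Laurent n ⊗[ℂ] KM Z) = a ⊗ₜ[ℂ] x) :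
    ∃ p ∈ LieSubalgebra.lieSpan ℂ (loopKM Z n H2)
      (loopPart n H2 (Submodule.span ℂ (Set.range (kmF Z))) : Set (loopKM Z n H2)),
    ∃ q ∈ LieSubalgebra.lieSpan ℂ (loopKM Z n H2)
      (loopPart n H2 (Submodule.span ℂ (Set.range (kmE Z))) : Set (loopKM Z n H2)),
    ∃ h : cartan' Z, z = p + loopCartanLin Z n H2 (a ⊗ₜ[ℂ] h, 0) + q := by
  obtain ⟨y, hy, h, w, hw, rfl⟩ := derived_decomp Z hx
  refine ⟨⟨a ⊗ₜ[ℂ] y, derived_le_loopKM (tmul_mem_loopSub a (nNeg_le_derived Z hy))⟩,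
    negPart_mem_lieSpan (tmul_mem_loopSub a hy),
    ⟨a ⊗ₜ[ℂ] w, derived_le_loopKM (tmul_mem_loopSub a (nPos_le_derived Z hw))⟩,
    posPart_mem_lieSpan (tmul_mem_loopSub a hw), h, Subtype.ext ?_⟩
  change (z : Laurent n ⊗[ℂ] KM Z) = a ⊗ₜ[ℂ] y + loopCartanMap Z n H2 (a ⊗ₜ[ℂ] h, 0) + a ⊗ₜ[ℂ] w
  rw [hz, loopCartanMap_apply, Submodule.coe_zero, TensorProduct.tmul_zero, add_zero,
    LinearMap.lTensor_tmul, TensorProduct.tmul_add, TensorProduct.tmul_add]; rfl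

/-- The triangular structure of the loop Kac-Moody algebra. -/
def loopTri (n : ℕ) (hH2 : IsCartanCompl Z H2) : TriData (loopKM Z n H2) (LoopCartan Z n H2) where
  F := loopPart n H2 (Submodule.span ℂ (Set.range (kmF Z)))
  E := loopPart n H2 (Submodule.span ℂ (Set.range (kmE Z)))
  c := loopCartanLin Z n H2
  d := (exists_grading hH2).choose
  lie_c_F y f hf := loopSub_lie (fun _ hx _ hy => cartan_lie_negGen hx hy)
    (loopCartanMap_mem_loopSub hH2 y) hf
  lie_E_F e he f hf := by
    obtain ⟨y, hy⟩ := cartan'_le_range (H2 := H2)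
      (loopSub_lie (fun _ hx _ hy => posGen_lie_negGen hx hy) he hf)
    exact ⟨y, Subtype.ext hy⟩
  lie_d f hf := Subtype.ext (by
    change ⁅loopCartanMap Z n H2 _, (f : Laurent n ⊗[ℂ] KM Z)⁆ = -(f : Laurent n ⊗[ℂ] KM Z)
    rw [(exists_grading hH2).choose_spec]
    exact rhoCheck_lie_loop hf)
  span := by
    rw [eq_top_iff]
    set T := (LieSubalgebra.lieSpan ℂ (loopKM Z n H2)
      (loopPart n H2 (Submodule.span ℂ (Set.range (kmF Z))) : Set (loopKM Z n H2))).toSubmodule ⊔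
      LinearMap.range (loopCartanLin Z n H2) ⊔ (LieSubalgebra.lieSpan ℂ (loopKM Z n H2)
      (loopPart n H2 (Submodule.span ℂ (Set.range (kmE Z))) : Set (loopKM Z n H2))).toSubmodule
      with hT
    have key : (loopKM Z n H2).toSubmodule ≤
        Submodule.map (loopKM Z n H2).toSubmodule.subtype T := by
      refine sup_le (loopSub_le fun a s hs => ?_) ?_
      · let z : loopKM Z n H2 := ⟨a ⊗ₜ[ℂ] s, derived_le_loopKM (tmul_mem_loopSub a hs)⟩
        obtain ⟨p, hp, q, hq, h, hz⟩ := tmul_derived_decomp (z := z) a hs rfl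
        refine ⟨z, ?_, rfl⟩
        rw [hz]
        exact Submodule.add_mem_sup (Submodule.add_mem_sup hp ⟨_, rfl⟩) hq
      · rintro _ ⟨b, hb, rfl⟩
        refine ⟨loopCartanLin Z n H2 (0, ⟨b, hb⟩),
          Submodule.mem_sup_left (Submodule.mem_sup_right ⟨_, rfl⟩), ?_⟩
        change loopCartanMap Z n H2 (0, ⟨b, hb⟩) = _
        rw [loopCartanMap_apply, map_zero, zero_add]; rfl
    rintro ⟨x, hx⟩ _
    obtain ⟨z, hz, hzx⟩ := key hx
    rwa [← show z = ⟨x, hx⟩ from Subtype.ext hzx]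

end LoopTriangular

theorem mono_mul {n : ℕ} (m k : Fin n → ℤ) : (mono m * mono k : Laurent n) = mono (m + k) := by
  have := AddMonoidAlgebra.single_mul_single (R := ℂ) m k 1 1
  rw [mul_one] at this
  exact this

theorem mono_zero {n : ℕ} : (mono 0 : Laurent n) = 1 := rfl

section Descent

variable {S L L₂ : Type*} [LieRing S] [LieAlgebra ℂ S] [LieRing L] [LieAlgebra ℂ L]
  [LieRing L₂] [LieAlgebra ℂ L₂]

/-- Choose a linear section of φ; the kernel condition makes the result independent of the choice
and hence compatible with brackets. -/
theorem exists_lieHom_of_surjective (φ : S →ₗ⁅ℂ⁆ L) (hφ : Function.Surjective φ)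
    (ρ : S →ₗ⁅ℂ⁆ L₂) (h : ∀ s, φ s = 0 → ρ s = 0) : ∃ σ : L →ₗ⁅ℂ⁆ L₂, ∀ s, σ (φ s) = ρ s := by
  obtain ⟨g, hg⟩ := (φ : S →ₗ[ℂ] L).exists_rightInverse_of_surjective
    (LinearMap.range_eq_top.2 hφ)
  have hg' : ∀ x, φ (g x) = x := fun x => LinearMap.congr_fun hg x
  have key : ∀ s t, φ s = φ t → ρ s = ρ t := fun s t hst => by
    rw [← sub_eq_zero, ← map_sub]
    exact h _ (by rw [map_sub, hst, sub_self])
  refine ⟨{ (ρ : S →ₗ[ℂ] L₂) ∘ₗ g with map_lie' := fun {x y} => ?_ }, fun s => key _ _ (hg' _)⟩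
  change ρ (g ⁅x, y⁆) = ⁅ρ (g x), ρ (g y)⁆
  rw [← LieHom.map_lie]
  exact key _ _ (by rw [LieHom.map_lie, hg', hg', hg'])

end Descent

/-! ### The word module and its operators. -/

section WordModule

set_option linter.unusedSectionVars false

variable {ι : Type u} [Fintype ι] {C : Matrix ι ι ℤ} {H : Type v} [AddCommGroup H] [Module ℂ H]
  (Z : Realization C H) {n : ℕ} (θ : (Fin n → ℤ) → Module.Dual ℂ H)

/-- The space with basis the words in the letters `f i ⊗ t^p`. -/
abbrev WordSpace (ι : Type u) (n : ℕ) := List (ι × (Fin n → ℤ)) →₀ ℂ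

/-- Left multiplication by the letter `f i ⊗ t^p`. -/
def fOp (i : ι) (p : Fin n → ℤ) : Module.End ℂ (WordSpace ι n) :=
  Finsupp.lmapDomain ℂ ℂ (List.cons (i, p))

/-- The action of `x ⊗ t^m`, `x ∈ H`, on a word. -/
def hWord (x : H) (m : Fin n → ℤ) : List (ι × (Fin n → ℤ)) → WordSpace ι n
  | [] => Finsupp.single [] (θ m x)
  | (i, p) :: w => fOp i p (hWord x m w) - Z.root i x • Finsupp.single ((i, p + m) :: w) 1

/-- The action of `x ⊗ t^m`, `x ∈ H`. -/
def hOp (x : H) (m : Fin n → ℤ) : Module.End ℂ (WordSpace ι n) :=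
  Finsupp.linearCombination ℂ (hWord Z θ x m)

open Classical in
/-- The action of `e j ⊗ t^m` on a word. -/
def eWord (j : ι) (m : Fin n → ℤ) : List (ι × (Fin n → ℤ)) → WordSpace ι n
  | [] => 0
  | (i, p) :: w => fOp i p (eWord j m w) +
      if j = i then hWord Z θ (Z.coroot j) (m + p) w else 0

/-- The action of `e j ⊗ t^m`. -/
def eOp (j : ι) (m : Fin n → ℤ) : Module.End ℂ (WordSpace ι n) :=
  Finsupp.linearCombination ℂ (eWord Z θ j m)

/-- The empty word. -/
def emptyWord (ι : Type u) (n : ℕ) : WordSpace ι n := Finsupp.single [] 1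

/-- The coefficient of the empty word. -/
def wordTop (ι : Type u) (n : ℕ) : Module.Dual ℂ (WordSpace ι n) := Finsupp.lapply []

/-- Induction on words for linear maps: the commutation relations with `fOp` reduce each identity of
operators to the empty word. -/
theorem wordSpace_ext {N : Type*} [AddCommGroup N] [Module ℂ N] {φ χ : WordSpace ι n →ₗ[ℂ] N}
    (h₀ : φ (emptyWord ι n) = χ (emptyWord ι n))
    (h : ∀ i p t, φ t = χ t → φ (fOp i p t) = χ (fOp i p t)) : φ = χ := by
  refine Finsupp.lhom_ext' fun w => LinearMap.ext_ring ?_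
  change φ (Finsupp.single w 1) = χ (Finsupp.single w 1)
  induction w with
  | nil => exact h₀
  | cons a w ih =>
    have := h a.1 a.2 _ ih
    rwa [fOp, Finsupp.lmapDomain_apply, Finsupp.mapDomain_single] at this

theorem hOp_single (x : H) (m : Fin n → ℤ) (w : List (ι × (Fin n → ℤ))) :
    hOp Z θ x m (Finsupp.single w 1) = hWord Z θ x m w := by
  rw [hOp, Finsupp.linearCombination_single, one_smul]

theorem eOp_single (j : ι) (m : Fin n → ℤ) (w : List (ι × (Fin n → ℤ))) :
    eOp Z θ j m (Finsupp.single w 1) = eWord Z θ j m w := by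
  rw [eOp, Finsupp.linearCombination_single, one_smul]

theorem fOp_single (i : ι) (p : Fin n → ℤ) (w : List (ι × (Fin n → ℤ))) :
    fOp i p (Finsupp.single w 1) = Finsupp.single ((i, p) :: w) (1 : ℂ) := by
  rw [fOp, Finsupp.lmapDomain_apply, Finsupp.mapDomain_single]

theorem hOp_emptyWord (x : H) (m : Fin n → ℤ) :
    hOp Z θ x m (emptyWord ι n) = θ m x • emptyWord ι n := by
  rw [emptyWord, hOp_single, hWord, Finsupp.smul_single, smul_eq_mul, mul_one]

theorem eOp_emptyWord (j : ι) (m : Fin n → ℤ) : eOp Z θ j m (emptyWord ι n) = 0 := by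
  rw [emptyWord, eOp_single, eWord]

theorem hOp_fOp (x : H) (m : Fin n → ℤ) (i : ι) (p : Fin n → ℤ) (t : WordSpace ι n) :
    hOp Z θ x m (fOp i p t) = fOp i p (hOp Z θ x m t) - Z.root i x • fOp i (p + m) t := by
  have : hOp Z θ x m ∘ₗ fOp i p = fOp i p ∘ₗ hOp Z θ x m - Z.root i x • fOp i (p + m) := by
    refine Finsupp.lhom_ext' fun w => LinearMap.ext_ring ?_
    change hOp Z θ x m (fOp i p (Finsupp.single w 1)) =
      fOp i p (hOp Z θ x m (Finsupp.single w 1)) - Z.root i x • fOp i (p + m) (Finsupp.single w 1)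
    rw [fOp_single, fOp_single, hOp_single, hOp_single, hWord]
  exact LinearMap.congr_fun this t

open Classical in
theorem eOp_fOp (j : ι) (m : Fin n → ℤ) (i : ι) (p : Fin n → ℤ) (t : WordSpace ι n) :
    eOp Z θ j m (fOp i p t) = fOp i p (eOp Z θ j m t) +
      if j = i then hOp Z θ (Z.coroot j) (m + p) t else 0 := by
  have : eOp Z θ j m ∘ₗ fOp i p = fOp i p ∘ₗ eOp Z θ j m +
      if j = i then hOp Z θ (Z.coroot j) (m + p) else 0 := by
    refine Finsupp.lhom_ext' fun w => LinearMap.ext_ring ?_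
    change eOp Z θ j m (fOp i p (Finsupp.single w 1)) =
      fOp i p (eOp Z θ j m (Finsupp.single w 1)) +
        (if j = i then hOp Z θ (Z.coroot j) (m + p) else 0 : Module.End ℂ (WordSpace ι n))
          (Finsupp.single w 1)
    rw [fOp_single, eOp_single, eOp_single, eWord]
    split_ifs
    · rw [hOp_single]
    · rfl
  have h := LinearMap.congr_fun this t
  rw [LinearMap.add_apply, LinearMap.comp_apply, LinearMap.comp_apply] at h
  rw [h]
  split_ifs <;> rfl

theorem hOp_hOp (x y : H) (m k : Fin n → ℤ) (t : WordSpace ι n) :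
    hOp Z θ x m (hOp Z θ y k t) = hOp Z θ y k (hOp Z θ x m t) := by
  have : hOp Z θ x m ∘ₗ hOp Z θ y k = hOp Z θ y k ∘ₗ hOp Z θ x m := by
    refine wordSpace_ext ?_ fun i p t ih => ?_
    · simp only [LinearMap.comp_apply, hOp_emptyWord, map_smul]
      exact smul_comm _ _ _
    · simp only [LinearMap.comp_apply] at ih ⊢
      simp only [hOp_fOp, map_sub, map_smul, ih, smul_sub]
      rw [add_right_comm p k m, smul_comm (Z.root i y) (Z.root i x)]
      abel
  exact LinearMap.congr_fun this t

theorem hOp_eOp (x : H) (m : Fin n → ℤ) (j : ι) (k : Fin n → ℤ) (t : WordSpace ι n) :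
    hOp Z θ x m (eOp Z θ j k t) = eOp Z θ j k (hOp Z θ x m t) +
      Z.root j x • eOp Z θ j (m + k) t := by
  have : hOp Z θ x m ∘ₗ eOp Z θ j k = eOp Z θ j k ∘ₗ hOp Z θ x m +
      Z.root j x • eOp Z θ j (m + k) := by
    refine wordSpace_ext ?_ fun i p t ih => ?_
    · simp only [LinearMap.comp_apply, LinearMap.add_apply, LinearMap.smul_apply, hOp_emptyWord,
        eOp_emptyWord, map_smul, map_zero, smul_zero, add_zero]
    · simp only [LinearMap.comp_apply, LinearMap.add_apply, LinearMap.smul_apply] at ih ⊢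
      by_cases hij : j = i
      · subst hij
        simp only [hOp_fOp, eOp_fOp, map_sub, map_add, map_smul, ih, smul_add, if_true,
          hOp_hOp Z θ x (Z.coroot j)]
        rw [show m + k + p = k + (p + m) by abel]
        module
      · simp only [hOp_fOp, eOp_fOp, map_sub, map_add, map_smul, ih, if_neg hij, add_zero]
        abel
  exact LinearMap.congr_fun this t

theorem wordTop_emptyWord : wordTop ι n (emptyWord ι n) = 1 := by
  simp [wordTop, emptyWord]

theorem wordTop_fOp (i : ι) (p : Fin n → ℤ) (t : WordSpace ι n) : wordTop ι n (fOp i p t) = 0 := by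
  have : wordTop ι n ∘ₗ fOp i p = 0 := by
    refine Finsupp.lhom_ext' fun w => LinearMap.ext_ring ?_
    change wordTop ι n (fOp i p (Finsupp.single w 1)) = 0
    rw [fOp_single]
    simp [wordTop]
  exact LinearMap.congr_fun this t

/-- Cartan operators preserve the length of words, so only the empty word contributes. -/
theorem wordTop_hOp (x : H) (m : Fin n → ℤ) (t : WordSpace ι n) :
    wordTop ι n (hOp Z θ x m t) = θ m x * wordTop ι n t := by
  have : wordTop ι n ∘ₗ hOp Z θ x m = θ m x • wordTop ι n := by
    refine wordSpace_ext ?_ fun i p t _ => ?_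
    · rw [LinearMap.comp_apply, hOp_emptyWord, map_smul]; rfl
    · rw [LinearMap.comp_apply, hOp_fOp, map_sub, map_smul, wordTop_fOp, wordTop_fOp,
        LinearMap.smul_apply, wordTop_fOp]
      simp
  exact LinearMap.congr_fun this t

end WordModule

/-! ### Extending weights from the loop Cartan subalgebra. -/

section LoopCartanExtension

variable {ι : Type u} [Fintype ι] {C : Matrix ι ι ℤ} {H : Type v} [AddCommGroup H] [Module ℂ H]
  {Z : Realization C H} {n : ℕ} {H2 : Submodule ℂ (KM Z)}

theorem loopCartanMap_injective (hH2 : IsCartanCompl Z H2) :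
    Function.Injective (loopCartanMap Z n H2) := by
  have hinj : Function.Injective ((cartan' Z).subtype.coprod H2.subtype) := by
    rw [injective_iff_map_eq_zero]
    rintro ⟨x, y⟩ h
    have h : (x : KM Z) + y = 0 := h
    have hx : (x : KM Z) ∈ cartan' Z ⊓ H2 :=
      ⟨x.2, by rw [eq_neg_of_add_eq_zero_left h]; exact H2.neg_mem y.2⟩
    rw [hH2.1, Submodule.mem_bot] at hx
    rw [hx, zero_add] at h
    exact Prod.ext (Subtype.ext hx) (Subtype.ext h)
  obtain ⟨g, hg⟩ := LinearMap.exists_leftInverse_of_injective _ (LinearMap.ker_eq_bot.2 hinj)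
  have hgx : ∀ x : cartan' Z, g x = (x, 0) := fun x => by
    have := LinearMap.congr_fun hg (x, 0)
    simpa using this
  have hgy : ∀ y : H2, g y = (0, y) := fun y => by
    have := LinearMap.congr_fun hg (0, y)
    simpa using this
  let P₁ : Laurent n ⊗[ℂ] KM Z →ₗ[ℂ] Laurent n ⊗[ℂ] cartan' Z :=
    LinearMap.lTensor (Laurent n) (LinearMap.fst ℂ _ _ ∘ₗ g)
  -- Together with `P₁` this is a left inverse. Since h'' occurs only as 1 ⊗ h'', its component is
  -- recovered from the coefficient of t^0.
  let P₂ : Laurent n ⊗[ℂ] KM Z →ₗ[ℂ] H2 :=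
    (TensorProduct.lid ℂ H2).toLinearMap ∘ₗ
      TensorProduct.map ((monoBasis n).coord 0) (LinearMap.snd ℂ _ _ ∘ₗ g)
  refine Function.LeftInverse.injective (g := P₁.prod P₂) ?_
  rintro ⟨a, b⟩
  have h1 : ∀ a : Laurent n ⊗[ℂ] cartan' Z,
      P₁ (LinearMap.lTensor (Laurent n) (cartan' Z).subtype a) = a := by
    intro a
    induction a using TensorProduct.induction_on with
    | zero => rw [map_zero, map_zero]
    | add x y hx hy => rw [map_add, map_add, hx, hy]
    | tmul a x =>
      simp only [P₁, LinearMap.lTensor_tmul, LinearMap.comp_apply, Submodule.subtype_apply, hgx,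
        LinearMap.fst_apply]
  have h2 : ∀ a : Laurent n ⊗[ℂ] cartan' Z,
      P₂ (LinearMap.lTensor (Laurent n) (cartan' Z).subtype a) = 0 := by
    intro a
    induction a using TensorProduct.induction_on with
    | zero => rw [map_zero, map_zero]
    | add x y hx hy => rw [map_add, map_add, hx, hy, add_zero]
    | tmul a x =>
      simp only [P₂, LinearMap.lTensor_tmul, LinearMap.comp_apply, Submodule.subtype_apply, hgx,
        LinearMap.snd_apply, TensorProduct.map_tmul, TensorProduct.tmul_zero, map_zero]
  have h3 : P₁ (1 ⊗ₜ[ℂ] (b : KM Z)) = 0 := by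
    simp only [P₁, LinearMap.lTensor_tmul, LinearMap.comp_apply, hgy,
        LinearMap.fst_apply, TensorProduct.tmul_zero]
  have h4 : P₂ (1 ⊗ₜ[ℂ] (b : KM Z)) = b := by
    have h0 : (monoBasis n).coord 0 1 = 1 := by
      rw [← mono_zero, ← monoBasis_apply, Module.Basis.coord_apply, Module.Basis.repr_self,
        Finsupp.single_eq_same]
    simp only [P₂, LinearMap.comp_apply, hgy, LinearMap.snd_apply, TensorProduct.map_tmul, h0,
      LinearEquiv.coe_coe, TensorProduct.lid_tmul, one_smul]
  rw [loopCartanMap_apply]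
  refine Prod.ext ?_ ?_
  · change P₁ (_ + _) = a
    rw [map_add, h1, h3, add_zero]
  · change P₂ (_ + _) = b
    rw [map_add, h2, h4, zero_add]

/-- The word module is built for all of g ⊗ A, hence needs a weight on h ⊗ A and not only on h_A. -/
theorem exists_extend_loopCartan (hH2 : IsCartanCompl Z H2)
    (ψ : Module.Dual ℂ (LoopCartan Z n H2)) :
    ∃ χ : Module.Dual ℂ (Laurent n ⊗[ℂ] KM Z), ∀ y, χ (loopCartanMap Z n H2 y) = ψ y := by
  obtain ⟨g, hg⟩ := LinearMap.exists_leftInverse_of_injective _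
    (LinearMap.ker_eq_bot.2 (loopCartanMap_injective (n := n) hH2))
  exact ⟨ψ ∘ₗ g, fun y => congrArg ψ (LinearMap.congr_fun hg y)⟩

end LoopCartanExtension

/-! ### A nonzero highest weight representation without a basis theorem. -/

section Existence

attribute [local instance] LieRing.ofAssociativeRing

variable {ι : Type u} [Fintype ι] {C : Matrix ι ι ℤ} {H : Type v} [AddCommGroup H] [Module ℂ H]
  (Z : Realization C H) {n : ℕ} (θ : (Fin n → ℤ) → Module.Dual ℂ H)

/-- The ambient Lie algebra for pairs of an element of `g ⊗ A` and an operator on words. -/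
abbrev PairAlg (Z : Realization C H) (n : ℕ) :=
  (Laurent n ⊗[ℂ] KM Z) × Module.End ℂ (WordSpace ι n)

/-- The element `f i ⊗ t^p` with its operator. -/
def fPair (q : ι × (Fin n → ℤ)) : PairAlg Z n := (mono q.2 ⊗ₜ[ℂ] kmF Z q.1, fOp q.1 q.2)

/-- The element `e i ⊗ t^p` with its operator. -/
def ePair (q : ι × (Fin n → ℤ)) : PairAlg Z n := (mono q.2 ⊗ₜ[ℂ] kmE Z q.1, eOp Z θ q.1 q.2)

/-- The element `x ⊗ t^p`, `x ∈ H`, with its operator. -/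
def hPair (q : H × (Fin n → ℤ)) : PairAlg Z n := (mono q.2 ⊗ₜ[ℂ] kmH Z q.1, hOp Z θ q.1 q.2)

/-- The span of the negative pairs. -/
def fPairs (n : ℕ) : Submodule ℂ (PairAlg Z n) := Submodule.span ℂ (Set.range (fPair Z))

/-- The span of the positive pairs. -/
def ePairs : Submodule ℂ (PairAlg Z n) := Submodule.span ℂ (Set.range (ePair Z θ))

/-- The span of the Cartan pairs. -/
def hPairs : Submodule ℂ (PairAlg Z n) := Submodule.span ℂ (Set.range (hPair Z θ))

/-- The Lie algebra generated by the pairs. -/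
def pairLie : LieSubalgebra ℂ (PairAlg Z n) :=
  LieSubalgebra.lieSpan ℂ (PairAlg Z n) (fPairs Z n ∪ hPairs Z θ ∪ ePairs Z θ : Set (PairAlg Z n))

theorem hPair_lie_hPair (x y : H × (Fin n → ℤ)) : ⁅hPair Z θ x, hPair Z θ y⁆ = 0 := by
  refine Prod.ext ?_ (LinearMap.ext fun t => ?_)
  · change ⁅mono x.2 ⊗ₜ[ℂ] kmH Z x.1, mono y.2 ⊗ₜ[ℂ] kmH Z y.1⁆ = 0
    rw [tmul_lie_tmul, kmH_lie_kmH, TensorProduct.tmul_zero]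
  · exact sub_eq_zero.2 (hOp_hOp Z θ _ _ _ _ t)

theorem hPair_lie_ePair (x : H × (Fin n → ℤ)) (y : ι × (Fin n → ℤ)) :
    ⁅hPair Z θ x, ePair Z θ y⁆ = Z.root y.1 x.1 • ePair Z θ (y.1, x.2 + y.2) := by
  refine Prod.ext ?_ (LinearMap.ext fun t => ?_)
  · change ⁅mono x.2 ⊗ₜ[ℂ] kmH Z x.1, mono y.2 ⊗ₜ[ℂ] kmE Z y.1⁆ =
      Z.root y.1 x.1 • (mono (x.2 + y.2) ⊗ₜ[ℂ] kmE Z y.1)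
    rw [tmul_lie_tmul, kmH_lie_kmE, TensorProduct.tmul_smul, mono_mul]
  · exact sub_eq_iff_eq_add'.2 (hOp_eOp Z θ _ _ _ _ t)

theorem hPair_lie_fPair (x : H × (Fin n → ℤ)) (y : ι × (Fin n → ℤ)) :
    ⁅hPair Z θ x, fPair Z y⁆ = -(Z.root y.1 x.1 • fPair Z (y.1, y.2 + x.2)) := by
  refine Prod.ext ?_ (LinearMap.ext fun t => ?_)
  · change ⁅mono x.2 ⊗ₜ[ℂ] kmH Z x.1, mono y.2 ⊗ₜ[ℂ] kmF Z y.1⁆ =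
      -(Z.root y.1 x.1 • (mono (y.2 + x.2) ⊗ₜ[ℂ] kmF Z y.1))
    rw [tmul_lie_tmul, kmH_lie_kmF, TensorProduct.tmul_neg, TensorProduct.tmul_smul, mono_mul,
      add_comm]
  · refine sub_eq_iff_eq_add'.2 ((hOp_fOp Z θ _ _ _ _ t).trans ?_)
    exact sub_eq_add_neg _ _

theorem ePair_lie_fPair_same (i : ι) (m p : Fin n → ℤ) :
    ⁅ePair Z θ (i, m), fPair Z (i, p)⁆ = hPair Z θ (Z.coroot i, m + p) := by
  refine Prod.ext ?_ (LinearMap.ext fun t => ?_)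
  · change ⁅mono m ⊗ₜ[ℂ] kmE Z i, mono p ⊗ₜ[ℂ] kmF Z i⁆ = mono (m + p) ⊗ₜ[ℂ] kmH Z (Z.coroot i)
    rw [tmul_lie_tmul, kmE_lie_kmF_same, mono_mul]
  · refine sub_eq_iff_eq_add'.2 ((eOp_fOp Z θ _ _ _ _ t).trans ?_)
    rw [if_pos rfl]; rfl

theorem ePair_lie_fPair_ne {i j : ι} (hij : i ≠ j) (m p : Fin n → ℤ) :
    ⁅ePair Z θ (i, m), fPair Z (j, p)⁆ = 0 := by
  refine Prod.ext ?_ (LinearMap.ext fun t => ?_)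
  · change ⁅mono m ⊗ₜ[ℂ] kmE Z i, mono p ⊗ₜ[ℂ] kmF Z j⁆ = 0
    rw [tmul_lie_tmul, kmE_lie_kmF_ne Z hij, TensorProduct.tmul_zero]
  · refine sub_eq_iff_eq_add'.2 ((eOp_fOp Z θ _ _ _ _ t).trans ?_)
    rw [if_neg hij]; rfl

theorem pairLie_triangular : (pairLie Z θ).toSubmodule ≤
    (LieSubalgebra.lieSpan ℂ (PairAlg Z n) (Set.range (fPair Z))).toSubmodule ⊔ hPairs Z θ ⊔
      (LieSubalgebra.lieSpan ℂ (PairAlg Z n) (Set.range (ePair Z θ))).toSubmodule := by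
  have hHH : ∀ x ∈ hPairs Z θ, ∀ y ∈ hPairs Z θ, ⁅x, y⁆ ∈ hPairs Z θ :=
      lie_mem_span (S := Set.range (hPair Z θ)) (T := Set.range (hPair Z θ)) (by
    rintro _ ⟨x, rfl⟩ _ ⟨y, rfl⟩
    exact (hPair_lie_hPair Z θ x y).symm ▸ Submodule.zero_mem _)
  have hHE : ∀ x ∈ hPairs Z θ, ∀ y ∈ ePairs Z θ, ⁅x, y⁆ ∈ ePairs Z θ :=
      lie_mem_span (S := Set.range (hPair Z θ)) (T := Set.range (ePair Z θ)) (by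
    rintro _ ⟨x, rfl⟩ _ ⟨i, rfl⟩
    exact (hPair_lie_ePair Z θ x i).symm ▸
      Submodule.smul_mem _ _ (Submodule.subset_span ⟨_, rfl⟩))
  have hHF : ∀ x ∈ hPairs Z θ, ∀ y ∈ fPairs Z n, ⁅x, y⁆ ∈ fPairs Z n :=
      lie_mem_span (S := Set.range (hPair Z θ)) (T := Set.range (fPair Z)) (by
    rintro _ ⟨x, rfl⟩ _ ⟨i, rfl⟩
    exact (hPair_lie_fPair Z θ x i).symm ▸ Submodule.neg_mem _
      (Submodule.smul_mem _ _ (Submodule.subset_span ⟨_, rfl⟩)))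
  have hEF : ∀ x ∈ ePairs Z θ, ∀ y ∈ fPairs Z n, ⁅x, y⁆ ∈ hPairs Z θ :=
      lie_mem_span (S := Set.range (ePair Z θ)) (T := Set.range (fPair Z)) (by
    rintro _ ⟨⟨i, m⟩, rfl⟩ _ ⟨⟨j, p⟩, rfl⟩
    by_cases hij : i = j
    · subst hij
      exact (ePair_lie_fPair_same Z θ i m p).symm ▸ Submodule.subset_span ⟨_, rfl⟩
    · exact (ePair_lie_fPair_ne Z θ hij m p).symm ▸ Submodule.zero_mem _)
  have key := lieSpan_le_triangular (L := PairAlg Z n) (E := ePairs Z θ) (F := fPairs Z n)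
    (H₀ := hPairs Z θ) hHH hHE hHF hEF
  rwa [fPairs, ePairs, lieSpan_span, lieSpan_span] at key

/-- The grading element of `g ⊗ A`. -/
def loopRho (n : ℕ) : Laurent n ⊗[ℂ] KM Z := 1 ⊗ₜ[ℂ] kmH Z (rhoCheck Z)

/-- The tautological action of pairs on words. -/
abbrev pairAct (n : ℕ) : PairAlg Z n →ₗ⁅ℂ⁆ Module.End ℂ (WordSpace ι n) :=
  LieHom.snd ℂ (Laurent n ⊗[ℂ] KM Z) (Module.End ℂ (WordSpace ι n))

/-- The projection of pairs to `g ⊗ A`. -/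
abbrev pairProj (n : ℕ) : PairAlg Z n →ₗ⁅ℂ⁆ Laurent n ⊗[ℂ] KM Z :=
  LieHom.fst ℂ (Laurent n ⊗[ℂ] KM Z) (Module.End ℂ (WordSpace ι n))

/-- Records two facts at once: negative pairs have negative degree in g ⊗ A, and their operators
never produce the empty word. -/
theorem fPair_lieSpan_le : LieSubalgebra.lieSpan ℂ (PairAlg Z n) (Set.range (fPair Z)) ≤
    (positivePart (-loopRho Z n)).comap (pairProj Z n) ⊓
      topKiller (pairAct Z n) (wordTop ι n) := by
  refine LieSubalgebra.lieSpan_le.2 ?_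
  rintro _ ⟨⟨i, p⟩, rfl⟩
  refine ⟨Submodule.subset_span ⟨0, ?_⟩, fun t => wordTop_fOp i p t⟩
  change ⁅-loopRho Z n, mono p ⊗ₜ[ℂ] kmF Z i⁆ = (((0 : ℕ) : ℂ) + 1) • (mono p ⊗ₜ[ℂ] kmF Z i)
  rw [neg_lie, loopRho, tmul_lie_tmul, rhoCheck_lie_kmF, TensorProduct.tmul_neg, neg_neg, one_mul,
    Nat.cast_zero, zero_add, one_smul]

/-- The positive counterpart: positive degree in g ⊗ A, and operators that kill the empty word. -/
theorem ePair_lieSpan_le : LieSubalgebra.lieSpan ℂ (PairAlg Z n) (Set.range (ePair Z θ)) ≤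
    (positivePart (loopRho Z n)).comap (pairProj Z n) ⊓
      annihilatorLie (pairAct Z n) (emptyWord ι n) := by
  refine LieSubalgebra.lieSpan_le.2 ?_
  rintro _ ⟨⟨i, p⟩, rfl⟩
  refine ⟨Submodule.subset_span ⟨0, ?_⟩, eOp_emptyWord Z θ i p⟩
  change ⁅loopRho Z n, mono p ⊗ₜ[ℂ] kmE Z i⁆ = (((0 : ℕ) : ℂ) + 1) • (mono p ⊗ₜ[ℂ] kmE Z i)
  rw [loopRho, tmul_lie_tmul, rhoCheck_lie_kmE, one_mul, Nat.cast_zero, zero_add, one_smul]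

variable {θ}

theorem rho_lie_hPairs {s : PairAlg Z n} (hs : s ∈ hPairs Z θ) : ⁅loopRho Z n, s.1⁆ = 0 := by
  have : hPairs Z θ ≤ LinearMap.ker (LieAlgebra.ad ℂ _ (loopRho Z n) ∘ₗ LinearMap.fst ℂ _ _) := by
    refine Submodule.span_le.2 ?_
    rintro _ ⟨⟨x, m⟩, rfl⟩
    change ⁅loopRho Z n, mono m ⊗ₜ[ℂ] kmH Z x⁆ = 0
    rw [loopRho, tmul_lie_tmul, kmH_lie_kmH, TensorProduct.tmul_zero]
  exact this hs

variable {χ : Module.Dual ℂ (Laurent n ⊗[ℂ] KM Z)}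

theorem hPairs_emptyWord (hχ : ∀ m x, χ (mono m ⊗ₜ[ℂ] kmH Z x) = θ m x) {s : PairAlg Z n}
    (hs : s ∈ hPairs Z θ) : s.2 (emptyWord ι n) = χ s.1 • emptyWord ι n := by
  have : hPairs Z θ ≤ LinearMap.eqLocus (LinearMap.applyₗ (emptyWord ι n) ∘ₗ LinearMap.snd ℂ _ _)
      ((LinearMap.toSpanSingleton ℂ _ (emptyWord ι n)) ∘ₗ χ ∘ₗ LinearMap.fst ℂ _ _) := by
    refine Submodule.span_le.2 ?_
    rintro _ ⟨⟨x, m⟩, rfl⟩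
    change hOp Z θ x m (emptyWord ι n) = χ (mono m ⊗ₜ[ℂ] kmH Z x) • emptyWord ι n
    rw [hOp_emptyWord, hχ]
  exact this hs

theorem hPairs_wordTop (hχ : ∀ m x, χ (mono m ⊗ₜ[ℂ] kmH Z x) = θ m x) {s : PairAlg Z n}
    (hs : s ∈ hPairs Z θ) (t : WordSpace ι n) :
    wordTop ι n (s.2 t) = χ s.1 * wordTop ι n t := by
  have : hPairs Z θ ≤ LinearMap.eqLocus
      (wordTop ι n ∘ₗ LinearMap.applyₗ t ∘ₗ LinearMap.snd ℂ _ _)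
      ((LinearMap.toSpanSingleton ℂ ℂ (wordTop ι n t)) ∘ₗ χ ∘ₗ LinearMap.fst ℂ _ _) := by
    refine Submodule.span_le.2 ?_
    rintro _ ⟨⟨x, m⟩, rfl⟩
    change wordTop ι n (hOp Z θ x m t) = χ (mono m ⊗ₜ[ℂ] kmH Z x) * wordTop ι n t
    rw [wordTop_hOp, hχ]
  exact this hs

/-- Operators that are paired with zero have image in the kernel of `wordTop`. -/
theorem wordTop_eq_zero_of_fst_eq_zero (hχ : ∀ m x, χ (mono m ⊗ₜ[ℂ] kmH Z x) = θ m x)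
    (t : WordSpace ι n) : ∀ s ∈ pairLie Z θ, s.1 = 0 → wordTop ι n (s.2 t) = 0 := by
  induction t using Finsupp.induction_linear with
  | zero => intro s _ _; rw [map_zero, map_zero]
  | add a b ha hb => intro s hs h0; rw [map_add, map_add, ha s hs h0, hb s hs h0, add_zero]
  | single w c =>
    suffices h : ∀ s ∈ pairLie Z θ, s.1 = 0 → wordTop ι n (s.2 (Finsupp.single w 1)) = 0 by
      intro s hs h0
      rw [show Finsupp.single w c = c • Finsupp.single w (1 : ℂ) by
        rw [Finsupp.smul_single, smul_eq_mul, mul_one], map_smul, map_smul, h s hs h0, smul_zero]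
    induction w with
    | nil =>
      intro s hs h0
      obtain ⟨s', hs', b, hb, rfl⟩ := Submodule.mem_sup.1 (pairLie_triangular Z θ hs)
      obtain ⟨a, ha, h, hh, rfl⟩ := Submodule.mem_sup.1 hs'
      have ha' := fPair_lieSpan_le Z ha
      have hb' := ePair_lieSpan_le Z θ hb
      -- The decomposition of s need not be trivial, but its first components have negative, zero
      -- and positive degree and sum to 0. Hence the Cartan pair has first component 0 and
      -- contributes χ(0) = 0 on the empty word.
      have hh0 : h.1 = 0 := eq_zero_of_add_eq_zero ha'.1 (rho_lie_hPairs Z hh) hb'.1 h0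
      change wordTop ι n (a.2 (emptyWord ι n) + h.2 (emptyWord ι n) + b.2 (emptyWord ι n)) = 0
      rw [show b.2 (emptyWord ι n) = 0 from hb'.2, map_add, map_add,
        show wordTop ι n (a.2 (emptyWord ι n)) = 0 from ha'.2 _, hPairs_wordTop Z hχ hh, hh0]
      simp
    | cons q w ih =>
      intro s hs h0
      have hq : fPair Z q ∈ pairLie Z θ := LieSubalgebra.subset_lieSpan
        (Or.inl (Or.inl (Submodule.subset_span ⟨q, rfl⟩)))
      -- Pairs with first component 0 form an ideal, so after commuting s past the first letter the
      -- induction hypothesis applies to the commutator.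
      have h1 := ih ⁅s, fPair Z q⁆ (LieSubalgebra.lie_mem _ hs hq) (by
        change ⁅s.1, (fPair Z q).1⁆ = 0
        rw [h0, zero_lie])
      have h2 : s.2 (fOp q.1 q.2 (Finsupp.single w 1)) =
          fOp q.1 q.2 (s.2 (Finsupp.single w 1)) + (⁅s, fPair Z q⁆).2 (Finsupp.single w 1) :=
        rep_comm (pairAct Z n) s (fPair Z q) _
      rw [fOp_single] at h2
      change wordTop ι n (s.2 (Finsupp.single ((q.1, q.2) :: w) 1)) = 0
      rw [h2, map_add, wordTop_fOp, h1, add_zero]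

variable (θ) in
/-- The subspace spanned by the images of operators that are paired with zero. -/
def pairKer : Submodule ℂ (WordSpace ι n) :=
  Submodule.span ℂ {w | ∃ s ∈ pairLie Z θ, s.1 = 0 ∧ ∃ t, w = s.2 t}

theorem pairKer_stable {s : PairAlg Z n} (hs : s ∈ pairLie Z θ) :
    pairKer Z θ ≤ Submodule.comap s.2 (pairKer Z θ) := by
  refine Submodule.span_le.2 ?_
  rintro _ ⟨s', hs', h0, t, rfl⟩
  change pairAct Z n s (pairAct Z n s' t) ∈ pairKer Z θ
  rw [rep_comm]
  refine Submodule.add_mem _ (Submodule.subset_span ⟨s', hs', h0, _, rfl⟩)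
    (Submodule.subset_span ⟨⁅s, s'⁆, LieSubalgebra.lie_mem _ hs hs', ?_, t, rfl⟩)
  change ⁅s.1, s'.1⁆ = 0
  rw [h0, lie_zero]

/-- This keeps the empty word nonzero in the quotient: `wordTop` descends to it. -/
theorem pairKer_le_ker (hχ : ∀ m x, χ (mono m ⊗ₜ[ℂ] kmH Z x) = θ m x) :
    pairKer Z θ ≤ LinearMap.ker (wordTop ι n) := by
  refine Submodule.span_le.2 ?_
  rintro _ ⟨s, hs, h0, t, rfl⟩
  exact wordTop_eq_zero_of_fst_eq_zero Z hχ t s hs h0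

variable (θ) in
/-- The action of the Lie algebra of pairs on the quotient by `pairKer`. -/
def pairQuotAct : pairLie Z θ →ₗ⁅ℂ⁆ Module.End ℂ (WordSpace ι n ⧸ pairKer Z θ) where
  toFun s := (pairKer Z θ).mapQ (pairKer Z θ) (s : PairAlg Z n).2 (pairKer_stable Z s.2)
  map_add' _ _ := Submodule.linearMap_qext _ rfl
  map_smul' _ _ := Submodule.linearMap_qext _ rfl
  map_lie' := Submodule.linearMap_qext _ rfl

theorem pairQuotAct_eq_zero {s : pairLie Z θ} (hs : (s : PairAlg Z n).1 = 0) :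
    pairQuotAct Z θ s = 0 := by
  refine Submodule.linearMap_qext _ (LinearMap.ext fun t => ?_)
  change (pairKer Z θ).mkQ ((s : PairAlg Z n).2 t) = 0
  rw [Submodule.mkQ_apply, Submodule.Quotient.mk_eq_zero]
  exact Submodule.subset_span ⟨s, s.2, hs, t, rfl⟩

theorem tmul_mem_of_mono {N : Submodule ℂ (Laurent n ⊗[ℂ] KM Z)} {x : KM Z}
    (h : ∀ m, mono m ⊗ₜ[ℂ] x ∈ N) (a : Laurent n) : a ⊗ₜ[ℂ] x ∈ N := by
  have ha : a ∈ Submodule.span ℂ (Set.range (monoBasis n)) :=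
    (monoBasis n).span_eq ▸ Submodule.mem_top
  induction ha using Submodule.span_induction with
  | mem a ha =>
    obtain ⟨m, rfl⟩ := ha
    rw [monoBasis_apply]; exact h m
  | zero => rw [TensorProduct.zero_tmul]; exact N.zero_mem
  | add a b _ _ ha hb => rw [TensorProduct.add_tmul]; exact N.add_mem ha hb
  | smul c a _ ha => rw [← TensorProduct.smul_tmul']; exact N.smul_mem c ha

theorem exists_fPairs {x : KM Z} (hx : x ∈ Submodule.span ℂ (Set.range (kmF Z)))
    (a : Laurent n) : ∃ s ∈ fPairs Z n, s.1 = a ⊗ₜ[ℂ] x := by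
  have h : a ⊗ₜ[ℂ] x ∈ Submodule.map (LinearMap.fst ℂ _ _) (fPairs Z n) := by
    induction hx using Submodule.span_induction with
    | mem x hx =>
      obtain ⟨i, rfl⟩ := hx
      exact tmul_mem_of_mono Z
        (N := Submodule.map (LinearMap.fst ℂ _ _) (fPairs Z n))
        (fun m => ⟨fPair Z (i, m), Submodule.subset_span ⟨_, rfl⟩, rfl⟩) a
    | zero => rw [TensorProduct.tmul_zero]; exact Submodule.zero_mem _
    | add x y _ _ hx hy => rw [TensorProduct.tmul_add]; exact Submodule.add_mem _ hx hy
    | smul c x _ hx => rw [TensorProduct.tmul_smul]; exact Submodule.smul_mem _ c hx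
  exact h

variable (θ) in
theorem exists_ePairs (i : ι) (a : Laurent n) : ∃ s ∈ ePairs Z θ, s.1 = a ⊗ₜ[ℂ] kmE Z i := by
  have h : a ⊗ₜ[ℂ] kmE Z i ∈ Submodule.map (LinearMap.fst ℂ _ _) (ePairs Z θ) :=
    tmul_mem_of_mono Z
      (N := Submodule.map (LinearMap.fst ℂ _ _) (ePairs Z θ))
      (fun m => ⟨ePair Z θ (i, m), Submodule.subset_span ⟨_, rfl⟩, rfl⟩) a
  exact h

variable (θ) in
theorem exists_hPairs (x : H) (a : Laurent n) : ∃ s ∈ hPairs Z θ, s.1 = a ⊗ₜ[ℂ] kmH Z x := by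
  have h : a ⊗ₜ[ℂ] kmH Z x ∈ Submodule.map (LinearMap.fst ℂ _ _) (hPairs Z θ) :=
    tmul_mem_of_mono Z
      (N := Submodule.map (LinearMap.fst ℂ _ _) (hPairs Z θ))
      (fun m => ⟨hPair Z θ (x, m), Submodule.subset_span ⟨_, rfl⟩, rfl⟩) a
  exact h

variable (θ) in
theorem pairProj_surjective (x : Laurent n ⊗[ℂ] KM Z) : ∃ s ∈ pairLie Z θ, s.1 = x := by
  have htop : LieSubalgebra.lieSpan ℂ (KM Z)
      (Set.range (kmF Z) ∪ Set.range (kmH Z) ∪ Set.range (kmE Z)) = ⊤ :=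
    lieSpan_gen_eq_top Z (fun x => LieSubalgebra.subset_lieSpan (Or.inl (Or.inr ⟨x, rfl⟩)))
      (fun i => LieSubalgebra.subset_lieSpan (Or.inr ⟨i, rfl⟩))
      (fun i => LieSubalgebra.subset_lieSpan (Or.inl (Or.inl ⟨i, rfl⟩)))
  refine exists_lift_of_mem_lieSpan (pairProj Z n) (K := pairLie Z θ)
    (S := Set.range (kmF Z) ∪ Set.range (kmH Z) ∪ Set.range (kmE Z)) ?_ ?_
  · rintro a _ ((⟨i, rfl⟩ | ⟨x, rfl⟩) | ⟨i, rfl⟩)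
    · obtain ⟨s, hs, h⟩ := exists_fPairs Z (Submodule.subset_span ⟨i, rfl⟩) a
      exact ⟨s, LieSubalgebra.subset_lieSpan (Or.inl (Or.inl hs)), h⟩
    · obtain ⟨s, hs, h⟩ := exists_hPairs Z θ x a
      exact ⟨s, LieSubalgebra.subset_lieSpan (Or.inl (Or.inr hs)), h⟩
    · obtain ⟨s, hs, h⟩ := exists_ePairs Z θ i a
      exact ⟨s, LieSubalgebra.subset_lieSpan (Or.inr hs), h⟩
  · rw [htop]
    induction x using TensorProduct.induction_on with
    | zero => exact Submodule.zero_mem _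
    | add x y hx hy => exact Submodule.add_mem _ hx hy
    | tmul a x => exact tmul_mem_loopSub a (LieSubalgebra.mem_top x)

/-- Existence of a representation with a nonzero highest weight vector of given weight. -/
theorem exists_highest_weight_rep (χ : Module.Dual ℂ (Laurent n ⊗[ℂ] KM Z)) :
    ∃ (M : Type u) (_ : AddCommGroup M) (_ : Module ℂ M)
      (σ : Laurent n ⊗[ℂ] KM Z →ₗ⁅ℂ⁆ Module.End ℂ M) (v : M) (top : Module.Dual ℂ M),
      top v = 1 ∧ (∀ x ∈ loopSub n (nPos Z).toSubmodule, σ x v = 0) ∧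
      (∀ x ∈ loopSub n (cartan Z), σ x v = χ x • v) ∧
      (∀ x ∈ loopSub n (Submodule.span ℂ (Set.range (kmF Z))), ∀ w, top (σ x w) = 0) ∧
      ∀ x ∈ loopSub n (cartan Z), ∀ w, top (σ x w) = χ x * top w := by
  let θ : (Fin n → ℤ) → Module.Dual ℂ H := fun m =>
    χ ∘ₗ TensorProduct.mk ℂ _ _ (mono m) ∘ₗ kmH Z
  have hχ : ∀ m x, χ (mono m ⊗ₜ[ℂ] kmH Z x) = θ m x := fun m x => rfl
  -- Pairs over 0 act by zero on the quotient, so the action of the pairs descends along the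
  -- projection to g ⊗ A.
  obtain ⟨σ, hσ⟩ := exists_lieHom_of_surjective ((pairProj Z n).comp (pairLie Z θ).incl)
    (fun x => by
      obtain ⟨s, hs, h⟩ := pairProj_surjective Z θ x
      exact ⟨⟨s, hs⟩, h⟩) (pairQuotAct Z θ) (fun s hs => pairQuotAct_eq_zero Z hs)
  have hσ' : ∀ s (hs : s ∈ pairLie Z θ) (t : WordSpace ι n),
      σ s.1 ((pairKer Z θ).mkQ t) = (pairKer Z θ).mkQ (s.2 t) := fun s hs t =>
    LinearMap.congr_fun (hσ ⟨s, hs⟩) _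
  let top : Module.Dual ℂ (WordSpace ι n ⧸ pairKer Z θ) :=
    (pairKer Z θ).liftQ (wordTop ι n) (pairKer_le_ker Z hχ)
  have htop : ∀ t, top ((pairKer Z θ).mkQ t) = wordTop ι n t := fun t => rfl
  have hcartan : ∀ x ∈ loopSub n (cartan Z), ∃ s ∈ hPairs Z θ, s.1 = x := by
    have : loopSub n (cartan Z) ≤ Submodule.map (LinearMap.fst ℂ _ _) (hPairs Z θ) := by
      refine loopSub_le fun a x hx => ?_
      rw [cartan_eq] at hx
      obtain ⟨x, rfl⟩ := hx
      exact exists_hPairs Z θ x a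
    exact this
  have hneg : ∀ x ∈ loopSub n (Submodule.span ℂ (Set.range (kmF Z))),
      ∃ s ∈ fPairs Z n, s.1 = x := by
    have : loopSub n (Submodule.span ℂ (Set.range (kmF Z))) ≤
        Submodule.map (LinearMap.fst ℂ _ _) (fPairs Z n) :=
      loopSub_le fun a x hx => exists_fPairs Z hx a
    exact this
  refine ⟨WordSpace ι n ⧸ pairKer Z θ, inferInstance, inferInstance, σ,
    (pairKer Z θ).mkQ (emptyWord ι n), top, ?_, ?_, ?_, ?_, ?_⟩
  · rw [htop, wordTop_emptyWord]
  · intro x hx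
    -- The lift must be chosen inside the subalgebra generated by the positive pairs, whose
    -- operators kill the empty word.
    obtain ⟨s, hs, rfl⟩ := exists_lift_of_mem_lieSpan (pairProj Z n)
      (K := LieSubalgebra.lieSpan ℂ (PairAlg Z n) (ePairs Z θ : Set (PairAlg Z n))) (by
        rintro a _ ⟨i, rfl⟩
        obtain ⟨s, hs, h⟩ := exists_ePairs Z θ i a
        exact ⟨s, LieSubalgebra.subset_lieSpan hs, h⟩) hx
    have hs' : s ∈ pairLie Z θ :=
      LieSubalgebra.lieSpan_mono (fun y hy => Or.inr hy) hs
    rw [ePairs, lieSpan_span] at hs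
    change σ s.1 _ = 0
    rw [hσ' s hs', show s.2 (emptyWord ι n) = 0 from (ePair_lieSpan_le Z θ hs).2, map_zero]
  · intro x hx
    obtain ⟨s, hs, rfl⟩ := hcartan x hx
    rw [hσ' s (LieSubalgebra.subset_lieSpan (Or.inl (Or.inr hs))), hPairs_emptyWord Z hχ hs,
      map_smul]
  · intro x hx w
    obtain ⟨s, hs, rfl⟩ := hneg x hx
    obtain ⟨t, rfl⟩ := (pairKer Z θ).mkQ_surjective w
    rw [hσ' s (LieSubalgebra.subset_lieSpan (Or.inl (Or.inl hs))), htop]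
    have hs' : s ∈ LieSubalgebra.lieSpan ℂ (PairAlg Z n) (Set.range (fPair Z)) := by
      rw [← lieSpan_span]; exact LieSubalgebra.subset_lieSpan hs
    exact (fPair_lieSpan_le Z hs').2 t
  · intro x hx w
    obtain ⟨s, hs, rfl⟩ := hcartan x hx
    obtain ⟨t, rfl⟩ := (pairKer Z θ).mkQ_surjective w
    rw [hσ' s (LieSubalgebra.subset_lieSpan (Or.inl (Or.inr hs))), htop, htop,
      hPairs_wordTop Z hχ hs]

end Existence

/-! ### A nondegenerate highest weight representation is determined by its weight. -/

section Uniqueness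

attribute [local instance] LieRing.ofAssociativeRing

variable {L 𝔥 M₁ M₂ : Type*} [LieRing L] [LieAlgebra ℂ L] [AddCommGroup 𝔥] [Module ℂ 𝔥]
  [AddCommGroup M₁] [Module ℂ M₁] [AddCommGroup M₂] [Module ℂ M₂]

/-- The direct sum of two representations. -/
def prodRep (ρ₁ : L →ₗ⁅ℂ⁆ Module.End ℂ M₁) (ρ₂ : L →ₗ⁅ℂ⁆ Module.End ℂ M₂) :
    L →ₗ⁅ℂ⁆ Module.End ℂ (M₁ × M₂) where
  toFun x := LinearMap.prodMap (ρ₁ x) (ρ₂ x)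
  map_add' x y := by rw [map_add, map_add]; rfl
  map_smul' c x := by rw [map_smul, map_smul]; rfl
  map_lie' {x y} := LinearMap.ext fun w => Prod.ext (rep_lie ρ₁ x y w.1) (rep_lie ρ₂ x y w.2)

/-- The restriction of a representation to a stable subspace. -/
def restrictRep (ρ : L →ₗ⁅ℂ⁆ Module.End ℂ M₁) (N : Submodule ℂ M₁)
    (hN : ∀ x, ∀ w ∈ N, ρ x w ∈ N) : L →ₗ⁅ℂ⁆ Module.End ℂ N where
  toFun x := (ρ x).restrict (hN x)
  map_add' x y := LinearMap.ext fun w => Subtype.ext (by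
    change ρ (x + y) w = ρ x w + ρ y w
    rw [map_add]; rfl)
  map_smul' c x := LinearMap.ext fun w => Subtype.ext (by
    change ρ (c • x) w = c • ρ x w
    rw [map_smul]; rfl)
  map_lie' {x y} := LinearMap.ext fun w => Subtype.ext (rep_lie ρ x y w)

/-- The subrepresentation generated by a vector. -/
def cyclicSub (ρ : L →ₗ⁅ℂ⁆ Module.End ℂ M₁) (v : M₁) : Submodule ℂ M₁ :=
  sInf {N | v ∈ N ∧ ∀ x, ∀ w ∈ N, ρ x w ∈ N}

theorem mem_cyclicSub (ρ : L →ₗ⁅ℂ⁆ Module.End ℂ M₁) (v : M₁) : v ∈ cyclicSub ρ v :=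
  (Submodule.mem_sInf).2 fun _ hN => hN.1

theorem cyclicSub_stable (ρ : L →ₗ⁅ℂ⁆ Module.End ℂ M₁) (v : M₁) :
    ∀ x, ∀ w ∈ cyclicSub ρ v, ρ x w ∈ cyclicSub ρ v := fun x w hw =>
  (Submodule.mem_sInf).2 fun N hN => hN.2 x w ((Submodule.mem_sInf).1 hw N hN)

theorem isHighestWeight_cyclicSub {τ : TriData L 𝔥} {ψ : Module.Dual ℂ 𝔥}
    {ρ : L →ₗ⁅ℂ⁆ Module.End ℂ M₁} {v : M₁} {top : Module.Dual ℂ M₁} (top_v : top v = 1)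
    (act_E : ∀ e ∈ τ.E, ρ e v = 0) (act_c : ∀ y, ρ (τ.c y) v = ψ y • v)
    (top_F : ∀ f ∈ τ.F, ∀ w, top (ρ f w) = 0)
    (top_c : ∀ y w, top (ρ (τ.c y) w) = ψ y * top w) :
    IsHighestWeight τ ψ (restrictRep ρ (cyclicSub ρ v) (cyclicSub_stable ρ v))
      ⟨v, mem_cyclicSub ρ v⟩ (top ∘ₗ (cyclicSub ρ v).subtype) where
  top_v := top_v
  act_E e he := Subtype.ext (act_E e he)
  act_c y := Subtype.ext (act_c y)
  top_F f hf w := top_F f hf w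
  top_c y w := top_c y w
  gen N hv hN := by
    have h : cyclicSub ρ v ≤ Submodule.map (cyclicSub ρ v).subtype N := by
      refine sInf_le ⟨⟨_, hv, rfl⟩, ?_⟩
      rintro x _ ⟨w, hw, rfl⟩
      exact ⟨_, hN x w hw, rfl⟩
    rw [eq_top_iff]
    rintro w _
    obtain ⟨w', hw', h'⟩ := h w.2
    rwa [← Subtype.ext h']

variable {τ : TriData L 𝔥} {ψ : Module.Dual ℂ 𝔥} {ρ₁ : L →ₗ⁅ℂ⁆ Module.End ℂ M₁}
  {ρ₂ : L →ₗ⁅ℂ⁆ Module.End ℂ M₂} {v₁ : M₁} {v₂ : M₂} {top₁ : Module.Dual ℂ M₁}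
  {top₂ : Module.Dual ℂ M₂}

/-- Two nondegenerate highest weight representations of the same weight are isomorphic. -/
theorem exists_equiv_of_isHighestWeight (h₁ : IsHighestWeight τ ψ ρ₁ v₁ top₁)
    (h₂ : IsHighestWeight τ ψ ρ₂ v₂ top₂) (hnd₁ : IsNondeg ρ₁ top₁) (hnd₂ : IsNondeg ρ₂ top₂) :
    ∃ e : M₁ ≃ₗ[ℂ] M₂, ∀ x w, e (ρ₁ x w) = ρ₂ x (e w) := by
  set ρ := prodRep ρ₁ ρ₂
  set Γ := cyclicSub ρ (v₁, v₂)
  have hE : ∀ e ∈ τ.E, ρ e (v₁, v₂) = 0 := fun e he => Prod.ext (h₁.act_E e he) (h₂.act_E e he)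
  have hc : ∀ y, ρ (τ.c y) (v₁, v₂) = ψ y • (v₁, v₂) := fun y =>
    Prod.ext (h₁.act_c y) (h₂.act_c y)
  -- The submodule generated by (v₁, v₂) is to be the graph of the isomorphism. It is a highest
  -- weight module with respect to the `top` of either factor.
  have hΓ₁ := isHighestWeight_cyclicSub (top := top₁ ∘ₗ LinearMap.fst ℂ M₁ M₂)
    h₁.top_v hE hc (fun f hf w => h₁.top_F f hf w.1) (fun y w => h₁.top_c y w.1)
  have hΓ₂ := isHighestWeight_cyclicSub (top := top₂ ∘ₗ LinearMap.snd ℂ M₁ M₂)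
    h₂.top_v hE hc (fun f hf w => h₂.top_F f hf w.2) (fun y w => h₂.top_c y w.2)
  let p₁ : Γ →ₗ[ℂ] M₁ := LinearMap.fst ℂ M₁ M₂ ∘ₗ Γ.subtype
  let p₂ : Γ →ₗ[ℂ] M₂ := LinearMap.snd ℂ M₁ M₂ ∘ₗ Γ.subtype
  let ρΓ := restrictRep ρ Γ (cyclicSub_stable ρ (v₁, v₂))
  have hp₁ : ∀ x w, p₁ (ρΓ x w) = ρ₁ x (p₁ w) := fun x w => rfl
  have hp₂ : ∀ x w, p₂ (ρΓ x w) = ρ₂ x (p₂ w) := fun x w => rfl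
  have hs₁ : Function.Surjective p₁ := by
    rw [← LinearMap.range_eq_top]
    refine h₁.gen _ ⟨⟨_, mem_cyclicSub ρ (v₁, v₂)⟩, rfl⟩ ?_
    rintro x _ ⟨w, rfl⟩
    exact ⟨ρΓ x w, hp₁ x w⟩
  have hs₂ : Function.Surjective p₂ := by
    rw [← LinearMap.range_eq_top]
    refine h₂.gen _ ⟨⟨_, mem_cyclicSub ρ (v₁, v₂)⟩, rfl⟩ ?_
    rintro x _ ⟨w, rfl⟩
    exact ⟨ρΓ x w, hp₂ x w⟩
  have hi₁ : Function.Injective p₁ := by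
    have hker : ∀ x, ∀ w ∈ LinearMap.ker p₁, ρΓ x w ∈ LinearMap.ker p₁ := fun x w hw => by
      rw [LinearMap.mem_ker, hp₁, (hw : p₁ w = 0), map_zero]
    have hne : LinearMap.ker p₁ ≠ ⊤ := fun htop => by
      have : (⟨_, mem_cyclicSub ρ (v₁, v₂)⟩ : Γ) ∈ LinearMap.ker p₁ := htop ▸ Submodule.mem_top
      have h0 : v₁ = 0 := this
      have := h₁.top_v
      rw [h0, map_zero] at this
      exact zero_ne_one this
    -- The kernel of p₁ is a proper submodule, so `top₂` vanishes on its image in M₂, and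
    -- nondegeneracy of M₂ kills that image.
    have hbot : Submodule.map p₂ (LinearMap.ker p₁) = ⊥ := by
      refine hnd₂ _ ?_ ?_
      · rintro x _ ⟨w, hw, rfl⟩
        exact ⟨ρΓ x w, hker x w hw, hp₂ x w⟩
      · rintro _ ⟨w, hw, rfl⟩
        exact hΓ₂.top_eq_zero hker hne hw
    rw [← LinearMap.ker_eq_bot, Submodule.eq_bot_iff]
    intro w hw
    have h2 : p₂ w ∈ Submodule.map p₂ (LinearMap.ker p₁) := ⟨w, hw, rfl⟩
    rw [hbot] at h2
    exact Subtype.ext (Prod.ext hw h2)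
  have hi₂ : Function.Injective p₂ := by
    have hker : ∀ x, ∀ w ∈ LinearMap.ker p₂, ρΓ x w ∈ LinearMap.ker p₂ := fun x w hw => by
      rw [LinearMap.mem_ker, hp₂, (hw : p₂ w = 0), map_zero]
    have hne : LinearMap.ker p₂ ≠ ⊤ := fun htop => by
      have : (⟨_, mem_cyclicSub ρ (v₁, v₂)⟩ : Γ) ∈ LinearMap.ker p₂ := htop ▸ Submodule.mem_top
      have h0 : v₂ = 0 := this
      have := h₂.top_v
      rw [h0, map_zero] at this
      exact zero_ne_one this
    have hbot : Submodule.map p₁ (LinearMap.ker p₂) = ⊥ := by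
      refine hnd₁ _ ?_ ?_
      · rintro x _ ⟨w, hw, rfl⟩
        exact ⟨ρΓ x w, hker x w hw, hp₁ x w⟩
      · rintro _ ⟨w, hw, rfl⟩
        exact hΓ₁.top_eq_zero hker hne hw
    rw [← LinearMap.ker_eq_bot, Submodule.eq_bot_iff]
    intro w hw
    have h2 : p₁ w ∈ Submodule.map p₁ (LinearMap.ker p₂) := ⟨w, hw, rfl⟩
    rw [hbot] at h2
    exact Subtype.ext (Prod.ext h2 hw)
  let e₁ := LinearEquiv.ofBijective p₁ ⟨hi₁, hs₁⟩
  let e₂ := LinearEquiv.ofBijective p₂ ⟨hi₂, hs₂⟩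
  refine ⟨e₁.symm.trans e₂, fun x w => ?_⟩
  obtain ⟨w, rfl⟩ := e₁.surjective w
  have : ρ₁ x (e₁ w) = e₁ (ρΓ x w) := (hp₁ x w).symm
  rw [this, LinearEquiv.trans_apply, LinearEquiv.trans_apply, LinearEquiv.symm_apply_apply,
    LinearEquiv.symm_apply_apply]
  exact hp₂ x w

end Uniqueness

/-! ### The modules M(ψ) and V(ψ). -/

section Verma

attribute [local instance] LieRing.ofAssociativeRing

/-- The elements of U(L) preserving N form a subalgebra containing L; by the universal property the
identity of U(L) factors through it. -/
theorem smul_mem_of_stable {L M : Type*} [LieRing L] [LieAlgebra ℂ L] [AddCommGroup M] [Module ℂ M]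
    [Module (UniversalEnvelopingAlgebra ℂ L) M] [IsScalarTower ℂ (UniversalEnvelopingAlgebra ℂ L) M]
    {N : Submodule ℂ M} (hN : ∀ x : L, ∀ w ∈ N, UniversalEnvelopingAlgebra.ι ℂ x • w ∈ N)
    (u : UniversalEnvelopingAlgebra ℂ L) : ∀ w ∈ N, u • w ∈ N := by
  let A : Subalgebra ℂ (UniversalEnvelopingAlgebra ℂ L) :=
    { carrier := {u | ∀ w ∈ N, u • w ∈ N}
      mul_mem' := fun ha hb w hw => by rw [mul_smul]; exact ha _ (hb w hw)
      add_mem' := fun ha hb w hw => by rw [add_smul]; exact N.add_mem (ha w hw) (hb w hw)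
      algebraMap_mem' := fun c w hw => by rw [algebraMap_smul]; exact N.smul_mem c hw }
  let g : L →ₗ⁅ℂ⁆ A :=
    { toFun := fun x => ⟨UniversalEnvelopingAlgebra.ι ℂ x, hN x⟩
      map_add' := fun x y => Subtype.ext (map_add (UniversalEnvelopingAlgebra.ι ℂ) x y)
      map_smul' := fun c x => Subtype.ext (map_smul (UniversalEnvelopingAlgebra.ι ℂ) c x)
      map_lie' := fun {x y} => Subtype.ext (LieHom.map_lie (UniversalEnvelopingAlgebra.ι ℂ) x y) }
  have h : A.val.comp (UniversalEnvelopingAlgebra.lift ℂ g) = AlgHom.id ℂ _ := by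
    refine UniversalEnvelopingAlgebra.hom_ext ℂ (LieHom.ext fun x => ?_)
    change ((UniversalEnvelopingAlgebra.lift ℂ g (UniversalEnvelopingAlgebra.ι ℂ x) : A) :
      UniversalEnvelopingAlgebra ℂ L) = UniversalEnvelopingAlgebra.ι ℂ x
    rw [UniversalEnvelopingAlgebra.lift_ι_apply]
    rfl
  have hu : u = A.val (UniversalEnvelopingAlgebra.lift ℂ g u) := (AlgHom.congr_fun h u).symm
  rw [hu]
  exact (UniversalEnvelopingAlgebra.lift ℂ g u).2

variable {ι : Type u} [Fintype ι] {C : Matrix ι ι ℤ} {H : Type v} [AddCommGroup H] [Module ℂ H]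
  {Z : Realization C H} {n : ℕ} {H2 : Submodule ℂ (KM Z)}

/-- The action of `g_A` on a module over its enveloping algebra. -/
def envRep (M : Type*) [AddCommGroup M] [Module ℂ M] [Module (UEA Z n H2) M]
    [IsScalarTower ℂ (UEA Z n H2) M] [SMulCommClass ℂ (UEA Z n H2) M] :
    loopKM Z n H2 →ₗ⁅ℂ⁆ Module.End ℂ M :=
  ((Algebra.lsmul ℂ ℂ M : UEA Z n H2 →ₐ[ℂ] Module.End ℂ M) : UEA Z n H2 →ₗ⁅ℂ⁆ _).comp
    (UniversalEnvelopingAlgebra.ι ℂ)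

/-- The functional on `U(g_A)` that gives the coefficient of the highest weight vector. -/
theorem exists_env_functional (hH2 : IsCartanCompl Z H2) (ψ : Module.Dual ℂ (LoopCartan Z n H2)) :
    ∃ t : Module.Dual ℂ (UEA Z n H2), t 1 = 1 ∧ (∀ u ∈ vermaIdeal ψ, t u = 0) ∧
      (∀ f ∈ (loopTri n hH2).F, ∀ u, t (UniversalEnvelopingAlgebra.ι ℂ f * u) = 0) ∧
      ∀ y u, t (UniversalEnvelopingAlgebra.ι ℂ (loopCartanLin Z n H2 y) * u) = ψ y * t u := by
  obtain ⟨χ, hχ⟩ := exists_extend_loopCartan hH2 ψ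
  obtain ⟨M, _, _, σ, v, top, h1, h2, h3, h4, h5⟩ := exists_highest_weight_rep Z χ
  let s : UEA Z n H2 →ₐ[ℂ] Module.End ℂ M :=
    UniversalEnvelopingAlgebra.lift ℂ (σ.comp (loopKM Z n H2).incl)
  have hs : ∀ (x : loopKM Z n H2) u w, s (UniversalEnvelopingAlgebra.ι ℂ x * u) w =
      σ x (s u w) := by
    intro x u w
    rw [map_mul, UniversalEnvelopingAlgebra.lift_ι_apply]; rfl
  -- The annihilator of the constructed highest weight vector; it contains the defining left ideal
  -- of M(ψ), so the coefficient functional vanishes there.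
  let J : Submodule (UEA Z n H2) (UEA Z n H2) :=
    { carrier := {u | s u v = 0}
      add_mem' := fun {a b} (ha : s a v = 0) (hb : s b v = 0) => by
        change s (a + b) v = 0
        rw [map_add, LinearMap.add_apply, ha, hb, add_zero]
      zero_mem' := by change s 0 v = 0; rw [map_zero]; rfl
      smul_mem' := fun c x (hx : s x v = 0) => by
        change s (c * x) v = 0
        rw [map_mul, Module.End.mul_apply, hx, map_zero] }
  have hJ : vermaIdeal ψ ≤ J := by
    refine Submodule.span_le.2 ?_
    rintro _ (⟨x, hx, rfl⟩ | ⟨y, rfl⟩)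
    · change s (UniversalEnvelopingAlgebra.ι ℂ x) v = 0
      rw [UniversalEnvelopingAlgebra.lift_ι_apply]
      exact h2 x hx
    · change s (_ - _) v = 0
      rw [map_sub, UniversalEnvelopingAlgebra.lift_ι_apply, AlgHom.commutes, LinearMap.sub_apply,
        sub_eq_zero, Module.algebraMap_end_apply]
      exact (h3 _ (loopCartanMap_mem_loopSub hH2 y)).trans (by rw [hχ])
  refine ⟨top ∘ₗ LinearMap.applyₗ v ∘ₗ s.toLinearMap, ?_, ?_, ?_, ?_⟩
  · change top (s 1 v) = 1
    rw [map_one]; exact h1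
  · intro u hu
    change top (s u v) = 0
    rw [show s u v = 0 from hJ hu, map_zero]
  · intro f hf u
    change top (s _ v) = 0
    rw [hs]; exact h4 f hf _
  · intro y u
    change top (s _ v) = ψ y * top (s u v)
    rw [hs, ← hχ y]
    exact h5 _ (loopCartanMap_mem_loopSub hH2 y) _

theorem nPos_gen_le : Submodule.span ℂ (Set.range (kmE Z)) ≤ (nPos Z).toSubmodule :=
  Submodule.span_le.2 LieSubalgebra.subset_lieSpan

theorem exists_verma_top (hH2 : IsCartanCompl Z H2) (ψ : Module.Dual ℂ (LoopCartan Z n H2)) :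
    ∃ top : Module.Dual ℂ (Verma ψ), IsHighestWeight (loopTri n hH2) ψ (envRep (Verma ψ))
      ((vermaIdeal ψ).mkQ 1) top := by
  obtain ⟨t, h1, h2, h3, h4⟩ := exists_env_functional hH2 ψ
  let top : Module.Dual ℂ (Verma ψ) :=
    (Submodule.liftQ ((vermaIdeal ψ).restrictScalars ℂ) t h2) ∘ₗ
      (Submodule.Quotient.restrictScalarsEquiv ℂ (vermaIdeal ψ)).symm.toLinearMap
  have htop : ∀ u, top ((vermaIdeal ψ).mkQ u) = t u := fun u => rfl
  have hact : ∀ x u, envRep (Verma ψ) x ((vermaIdeal ψ).mkQ u) =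
    (vermaIdeal ψ).mkQ (UniversalEnvelopingAlgebra.ι ℂ x * u) := fun x u => rfl
  refine ⟨top, ?_, ?_, ?_, ?_, ?_, ?_⟩
  · rw [htop, h1]
  · intro e he
    rw [hact, mul_one, Submodule.mkQ_apply, Submodule.Quotient.mk_eq_zero]
    exact Submodule.subset_span (Or.inl ⟨e, loopSub_mono nPos_gen_le he, rfl⟩)
  · intro y
    rw [hact, mul_one]
    have : ψ y • (vermaIdeal ψ).mkQ (1 : UEA Z n H2) =
        (vermaIdeal ψ).mkQ (algebraMap ℂ (UEA Z n H2) (ψ y)) := by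
      rw [Algebra.algebraMap_eq_smul_one]; rfl
    rw [this, ← sub_eq_zero, ← map_sub, Submodule.mkQ_apply, Submodule.Quotient.mk_eq_zero]
    exact Submodule.subset_span (Or.inr ⟨y, rfl⟩)
  · intro f hf w
    obtain ⟨u, rfl⟩ := (vermaIdeal ψ).mkQ_surjective w
    rw [hact, htop, h3 f hf]
  · intro y w
    obtain ⟨u, rfl⟩ := (vermaIdeal ψ).mkQ_surjective w
    rw [hact, htop, htop]
    exact h4 y u
  · intro N hv hN
    rw [eq_top_iff]
    rintro w _
    obtain ⟨u, rfl⟩ := (vermaIdeal ψ).mkQ_surjective w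
    have := smul_mem_of_stable (N := N) hN u _ hv
    rwa [← map_smul, smul_eq_mul, mul_one] at this

/-- The highest weight vector of `V(ψ)`. -/
def vTop (ψ : Module.Dual ℂ (LoopCartan Z n H2)) : V ψ :=
  (vermaMax ψ).mkQ ((vermaIdeal ψ).mkQ 1)

/-- The functional on M(ψ) vanishes on every proper submodule, hence descends to V(ψ). Nondegeneracy
holds because all proper submodules have been divided out. -/
theorem exists_isHighestWeight_V (hH2 : IsCartanCompl Z H2)
    (ψ : Module.Dual ℂ (LoopCartan Z n H2)) : ∃ top : Module.Dual ℂ (V ψ),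
      IsHighestWeight (loopTri n hH2) ψ (LieModule.toEnd ℂ (loopKM Z n H2) (V ψ)) (vTop ψ) top ∧
      IsNondeg (LieModule.toEnd ℂ (loopKM Z n H2) (V ψ)) top := by
  obtain ⟨t, ht⟩ := exists_verma_top hH2 ψ
  have hmax : ∀ w ∈ vermaMax ψ, t w = 0 := by
    -- The largest submodule inside the kernel of t. Being closed under sums, it contains `vermaMax
    -- ψ` as soon as it contains each proper submodule.
    let K : Submodule (UEA Z n H2) (Verma ψ) :=
      { carrier := {w | ∀ u : UEA Z n H2, t (u • w) = 0}
        add_mem' := fun ha hb u => by rw [smul_add, map_add, ha, hb, add_zero]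
        zero_mem' := fun u => by rw [smul_zero, map_zero]
        smul_mem' := fun c x hx u => by rw [smul_smul]; exact hx _ }
    have hK : vermaMax ψ ≤ K := by
      refine sSup_le fun N hN w hw u => ?_
      refine ht.top_eq_zero (N := N.restrictScalars ℂ)
        (fun x w hw => N.smul_mem (UniversalEnvelopingAlgebra.ι ℂ x) hw) (fun h => hN ?_)
        (N.smul_mem u hw)
      rw [eq_top_iff]
      intro w _
      have : w ∈ N.restrictScalars ℂ := h ▸ Submodule.mem_top
      exact this
    intro w hw
    have := hK hw 1
    rwa [one_smul] at this
  let top : Module.Dual ℂ (V ψ) :=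
    (Submodule.liftQ ((vermaMax ψ).restrictScalars ℂ) t hmax) ∘ₗ
      (Submodule.Quotient.restrictScalarsEquiv ℂ (vermaMax ψ)).symm.toLinearMap
  let π : Verma ψ →ₗ[UEA Z n H2] V ψ := (vermaMax ψ).mkQ
  have hπ : Function.Surjective π := (vermaMax ψ).mkQ_surjective
  have htop : ∀ w, top (π w) = t w := fun w => rfl
  have hact : ∀ x w, LieModule.toEnd ℂ (loopKM Z n H2) (V ψ) x (π w) =
    π (envRep (Verma ψ) x w) := fun x w => rfl
  have hsm : ∀ (c : ℂ) w, π (c • w) = c • π w := fun c w => rfl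
  refine ⟨top, ⟨?_, ?_, ?_, ?_, ?_, ?_⟩, ?_⟩
  · exact ht.top_v
  · intro e he
    change LieModule.toEnd ℂ (loopKM Z n H2) (V ψ) e (π _) = 0
    rw [hact, ht.act_E e he, map_zero]
  · intro y
    change LieModule.toEnd ℂ (loopKM Z n H2) (V ψ) _ (π _) = ψ y • π _
    rw [hact, ht.act_c y, hsm]
  · intro f hf w
    obtain ⟨w, rfl⟩ := hπ w
    rw [hact, htop, ht.top_F f hf]
  · intro y w
    obtain ⟨w, rfl⟩ := hπ w
    rw [hact, htop, htop, ht.top_c]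
  · intro N hv hN
    have := ht.gen (N.comap (π.restrictScalars ℂ)) hv fun x w hw => hN x _ hw
    rw [eq_top_iff]
    rintro w _
    obtain ⟨w, rfl⟩ := hπ w
    have hw : w ∈ N.comap (π.restrictScalars ℂ) := this ▸ Submodule.mem_top
    exact hw
  · intro N hN h0
    have hst := smul_mem_of_stable (N := N) hN
    -- The preimage of N in M(ψ) misses the generator, on which the functional is 1. It is therefore
    -- proper and dies in V(ψ).
    let N' : Submodule (UEA Z n H2) (Verma ψ) :=
      { carrier := {w | π w ∈ N}
        add_mem' := fun ha hb => by
          change π _ ∈ N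
          rw [map_add]; exact N.add_mem ha hb
        zero_mem' := by
          change π 0 ∈ N
          rw [map_zero]; exact N.zero_mem
        smul_mem' := fun c x hx => by
          change π _ ∈ N
          rw [map_smul]; exact hst c _ hx }
    have hN' : N' ≤ vermaMax ψ := by
      refine le_sSup fun h => ?_
      have h1 : (vermaIdeal ψ).mkQ 1 ∈ N' := h ▸ Submodule.mem_top
      have h2 := h0 _ h1
      rw [htop, ht.top_v] at h2
      exact one_ne_zero h2
    rw [Submodule.eq_bot_iff]
    intro w hw
    obtain ⟨w, rfl⟩ := hπ w
    exact (Submodule.Quotient.mk_eq_zero _).2 (hN' hw)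

theorem isIrreducible_V (hH2 : IsCartanCompl Z H2) (ψ : Module.Dual ℂ (LoopCartan Z n H2)) :
    LieModule.IsIrreducible ℂ (loopKM Z n H2) (V ψ) := by
  obtain ⟨top, h, hnd⟩ := exists_isHighestWeight_V hH2 ψ
  have hv : vTop ψ ≠ 0 := fun h0 => by
    have := h.top_v
    rw [h0, map_zero] at this
    exact zero_ne_one this
  have : Nontrivial (V ψ) := ⟨⟨_, _, hv⟩⟩
  refine LieModule.IsIrreducible.mk fun N hN => ?_
  rcases h.eq_bot_or_eq_top hnd (N := N.toSubmodule) (fun x w hw => N.lie_mem hw) with h' | h'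
  · exact absurd ((LieSubmodule.toSubmodule_eq_bot N).1 h') hN
  · exact (LieSubmodule.toSubmodule_eq_top N).1 h'

end Verma

/-! ### Comaximal weight ideals and tensor products. -/

section TensorDecomposition

variable {ι : Type u} [Fintype ι] {C : Matrix ι ι ℤ} {H : Type v} [AddCommGroup H] [Module ℂ H]
  {Z : Realization C H} {n : ℕ} {H2 : Submodule ℂ (KM Z)}

/-- The largest ideal `I` of `A` such that `ψ` vanishes on `h' ⊗ I`. -/
def weightIdeal (ψ : Module.Dual ℂ (LoopCartan Z n H2)) : Ideal (Laurent n) where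
  carrier := {a | ∀ (b : Laurent n) (h : cartan' Z), ψ ((a * b) ⊗ₜ[ℂ] h, 0) = 0}
  add_mem' := fun {a a'} ha ha' b h => by
    have : (((a + a') * b) ⊗ₜ[ℂ] h, 0) =
        (((a * b) ⊗ₜ[ℂ] h, 0) + ((a' * b) ⊗ₜ[ℂ] h, 0) : LoopCartan Z n H2) := by
      rw [Prod.mk_add_mk, add_zero, add_mul, TensorProduct.add_tmul]
    rw [this, map_add, ha, ha', add_zero]
  zero_mem' := fun b h => by
    rw [zero_mul, TensorProduct.zero_tmul]; exact map_zero ψ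
  smul_mem' := fun c a ha b h => by
    rw [smul_eq_mul, mul_comm c, mul_assoc]; exact ha _ h

/-- The span of the elements y ⊗ a, with y in g' and a in the weight ideal, is an ideal of g_A whose
Cartan parts are killed by ψ, so `act_eq_zero_of_ideal` applies. -/
theorem lie_eq_zero_of_mem_weightIdeal (hH2 : IsCartanCompl Z H2)
    (ψ : Module.Dual ℂ (LoopCartan Z n H2)) {a : Laurent n} (ha : a ∈ weightIdeal ψ) {y : KM Z}
    (hy : y ∈ (derived Z).toSubmodule) {x : loopKM Z n H2}
    (hx : (x : Laurent n ⊗[ℂ] KM Z) = a ⊗ₜ[ℂ] y) (w : V ψ) : ⁅x, w⁆ = 0 := by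
  obtain ⟨top, h, hnd⟩ := exists_isHighestWeight_V hH2 ψ
  let S : Set (loopKM Z n H2) := {x | ∃ a ∈ weightIdeal ψ, ∃ y ∈ (derived Z).toSubmodule,
    (x : Laurent n ⊗[ℂ] KM Z) = a ⊗ₜ[ℂ] y}
  have hlie : ∀ x : loopKM Z n H2, ∀ j ∈ Submodule.span ℂ S, ⁅x, j⁆ ∈ Submodule.span ℂ S := by
    intro x j hj
    induction hj using Submodule.span_induction with
    | zero => rw [lie_zero]; exact Submodule.zero_mem _
    | add j j' _ _ h h' => rw [lie_add]; exact Submodule.add_mem _ h h'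
    | smul c j _ h => rw [lie_smul]; exact Submodule.smul_mem _ c h
    | mem j hj =>
      obtain ⟨a, ha, y, hy, hj⟩ := hj
      have key : ∀ z : Laurent n ⊗[ℂ] KM Z, ∃ j ∈ Submodule.span ℂ S,
          (j : Laurent n ⊗[ℂ] KM Z) = ⁅z, a ⊗ₜ[ℂ] y⁆ := by
        intro z
        induction z using TensorProduct.induction_on with
        | zero => exact ⟨0, Submodule.zero_mem _, by rw [zero_lie]; rfl⟩
        | add z z' hz hz' =>
          obtain ⟨j, hj, h⟩ := hz
          obtain ⟨j', hj', h'⟩ := hz'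
          exact ⟨j + j', Submodule.add_mem _ hj hj', by rw [add_lie, ← h, ← h']; rfl⟩
        | tmul b z =>
          have hm : ⁅z, y⁆ ∈ (derived Z).toSubmodule := lie_mem_derived Z z y
          refine ⟨⟨(b * a) ⊗ₜ[ℂ] ⁅z, y⁆, derived_le_loopKM (tmul_mem_loopSub _ hm)⟩,
            Submodule.subset_span ⟨b * a, (weightIdeal ψ).mul_mem_left b ha, _, hm, rfl⟩, ?_⟩
          rw [tmul_lie_tmul]
      obtain ⟨j', hj', h'⟩ := key x
      have : ⁅x, j⁆ = j' := Subtype.ext (by rw [h', ← hj]; rfl)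
      rw [this]; exact hj'
  have hdec : ∀ j ∈ Submodule.span ℂ S,
      ∃ p ∈ LieSubalgebra.lieSpan ℂ (loopKM Z n H2)
        ((loopTri n hH2).F : Set (loopKM Z n H2)),
      ∃ q ∈ LieSubalgebra.lieSpan ℂ (loopKM Z n H2)
        ((loopTri n hH2).E : Set (loopKM Z n H2)),
      ∃ y, ψ y = 0 ∧ j = p + (loopTri n hH2).c y + q := by
    intro j hj
    induction hj using Submodule.span_induction with
    | zero =>
      exact ⟨0, LieSubalgebra.zero_mem _, 0, LieSubalgebra.zero_mem _, 0, map_zero _, by simp⟩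
    | add j j' _ _ h h' =>
      obtain ⟨p, hp, q, hq, y, hy, rfl⟩ := h
      obtain ⟨p', hp', q', hq', y', hy', rfl⟩ := h'
      refine ⟨p + p', LieSubalgebra.add_mem _ hp hp', q + q', LieSubalgebra.add_mem _ hq hq',
        y + y', by rw [map_add, hy, hy', add_zero], ?_⟩
      rw [map_add]; abel
    | smul c j _ h =>
      obtain ⟨p, hp, q, hq, y, hy, rfl⟩ := h
      refine ⟨c • p, LieSubalgebra.smul_mem _ c hp, c • q, LieSubalgebra.smul_mem _ c hq,
        c • y, by rw [map_smul, hy, smul_zero], ?_⟩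
      rw [map_smul, smul_add, smul_add]
    | mem j hj =>
      obtain ⟨a, ha, y, hy, hj⟩ := hj
      obtain ⟨p, hp, q, hq, h, hpq⟩ := tmul_derived_decomp a hy hj
      refine ⟨p, hp, q, hq, _, ?_, hpq⟩
      have := ha 1 h
      rwa [mul_one] at this
  have := h.act_eq_zero_of_ideal hnd (Submodule.span ℂ S) hlie hdec
    (Submodule.subset_span ⟨a, ha, y, hy, hx⟩ : x ∈ Submodule.span ℂ S)
  exact LinearMap.congr_fun this w

theorem loopPart_sup_range : loopPart n H2 (derived Z).toSubmodule ⊔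
    LinearMap.range (loopCartanLin Z n H2) = ⊤ := by
  rw [eq_top_iff]
  rintro ⟨x, hx⟩ _
  obtain ⟨a, ha, _, ⟨b, hb, rfl⟩, rfl⟩ := Submodule.mem_sup.1 hx
  refine Submodule.mem_sup.2 ⟨⟨a, derived_le_loopKM ha⟩, ha,
    loopCartanLin Z n H2 (0, ⟨b, hb⟩), ⟨_, rfl⟩, Subtype.ext ?_⟩
  change a + loopCartanMap Z n H2 (0, ⟨b, hb⟩) = a + constMap Z n b
  rw [loopCartanMap_apply, map_zero, zero_add]; rfl

theorem negGen_le_derived : Submodule.span ℂ (Set.range (kmF Z)) ≤ (derived Z).toSubmodule := by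
  refine Submodule.span_le.2 ?_
  rintro _ ⟨i, rfl⟩
  exact kmF_mem_derived Z i

variable {κ : Type*} [Fintype κ] [DecidableEq κ]

theorem exists_factor_element (hH2 : IsCartanCompl Z H2)
    {Ψ : κ → Module.Dual ℂ (LoopCartan Z n H2)}
    (hΨ : Pairwise (Function.onFun IsCoprime fun k => weightIdeal (Ψ k))) (k : κ)
    {x : loopKM Z n H2} (hx : x ∈ loopPart n H2 (derived Z).toSubmodule) :
    ∃ x' : loopKM Z n H2, (∀ w : V (Ψ k), ⁅x', w⁆ = ⁅x, w⁆) ∧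
      ∀ l, l ≠ k → ∀ w : V (Ψ l), ⁅x', w⁆ = 0 := by
  -- Chinese remainders: r is 1 modulo the k-th ideal and 0 modulo the others. Multiplying the loop
  -- coefficient by r isolates the k-th factor.
  obtain ⟨r, hr⟩ := Ideal.exists_forall_sub_mem_ideal hΨ (Pi.single k 1)
  have key : ∀ z : Laurent n ⊗[ℂ] (derived Z).toSubmodule, ∀ x : loopKM Z n H2,
      (x : Laurent n ⊗[ℂ] KM Z) =
        LinearMap.lTensor (Laurent n) (derived Z).toSubmodule.subtype z →
      ∃ x' : loopKM Z n H2, (∀ w : V (Ψ k), ⁅x', w⁆ = ⁅x, w⁆) ∧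
        ∀ l, l ≠ k → ∀ w : V (Ψ l), ⁅x', w⁆ = 0 := by
    intro z
    induction z using TensorProduct.induction_on with
    | zero =>
      intro x hx
      have hx0 : x = 0 := Subtype.ext (by rw [hx, map_zero]; rfl)
      exact ⟨0, fun w => by rw [hx0], fun l _ w => zero_lie w⟩
    | add z z' hz hz' =>
      intro x hx
      obtain ⟨x₁, h₁, h₁'⟩ := hz ⟨_, derived_le_loopKM ⟨z, rfl⟩⟩ rfl
      obtain ⟨x₂, h₂, h₂'⟩ := hz' ⟨_, derived_le_loopKM ⟨z', rfl⟩⟩ rfl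
      refine ⟨x₁ + x₂, fun w => ?_, fun l hl w => ?_⟩
      · rw [add_lie, h₁, h₂, ← add_lie]
        congr 1
        exact Subtype.ext (by rw [hx, map_add]; rfl)
      · rw [add_lie, h₁' l hl, h₂' l hl, add_zero]
    | tmul a y =>
      intro x hx
      let x' : loopKM Z n H2 := ⟨(r * a) ⊗ₜ[ℂ] y, derived_le_loopKM (tmul_mem_loopSub _ y.2)⟩
      refine ⟨x', fun w => ?_, fun l hl w => ?_⟩
      · have hk := hr k
        rw [Pi.single_eq_same] at hk
        rw [← sub_eq_zero, ← sub_lie]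
        refine lie_eq_zero_of_mem_weightIdeal hH2 (Ψ k)
          ((weightIdeal (Ψ k)).mul_mem_right a hk) y.2 ?_ w
        change (x' : Laurent n ⊗[ℂ] KM Z) - x = _
        rw [hx, sub_mul, one_mul, TensorProduct.sub_tmul]; rfl
      · have hk := hr l
        rw [Pi.single_eq_of_ne hl, sub_zero] at hk
        exact lie_eq_zero_of_mem_weightIdeal hH2 (Ψ l)
          ((weightIdeal (Ψ l)).mul_mem_right a hk) y.2 rfl w
  obtain ⟨z, hz⟩ := hx
  exact key z x hz.symm

/-- If the ideals `weightIdeal (Ψ k)` are pairwise comaximal, then `V(∑ Ψ k) ≅ ⨂ V(Ψ k)`. -/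
theorem nonempty_equiv_tensor (hH2 : IsCartanCompl Z H2)
    {Ψ : κ → Module.Dual ℂ (LoopCartan Z n H2)}
    (hΨ : Pairwise (Function.onFun IsCoprime fun k => weightIdeal (Ψ k))) :
    Nonempty (V (∑ k, Ψ k) ≃ₗ⁅ℂ, loopKM Z n H2⁆ ⨂[ℂ] k, V (Ψ k)) := by
  choose top htop hnd using fun k => exists_isHighestWeight_V hH2 (Ψ k)
  have hsep : ∀ k, ∀ x ∈ loopPart n H2 (derived Z).toSubmodule, ∃ x' : loopKM Z n H2,
      (∀ w : V (Ψ k), ⁅x', w⁆ = ⁅x, w⁆) ∧ ∀ l, l ≠ k → ∀ w : V (Ψ l), ⁅x', w⁆ = 0 :=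
    fun k x hx => exists_factor_element hH2 hΨ k hx
  have h₂ := isHighestWeight_tensor htop (L' := loopPart n H2 (derived Z).toSubmodule)
    (fun f hf => loopSub_mono negGen_le_derived hf) hsep
  have hnd₂ := isNondeg_tensor htop hnd
    (fun x j _ => lie_mem_loopSub (x : Laurent n ⊗[ℂ] KM Z) (j : Laurent n ⊗[ℂ] KM Z))
    loopPart_sup_range hsep
  obtain ⟨t, h₁, hnd₁⟩ := exists_isHighestWeight_V hH2 (∑ k, Ψ k)
  obtain ⟨e, he⟩ := exists_equiv_of_isHighestWeight h₁ h₂ hnd₁ hnd₂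
  exact ⟨{ e with map_lie' := fun {x w} => he x w }⟩

end TensorDecomposition

/-! ### Exponential monomials and the ideals that annihilate them. -/

section ExpMonomial

variable {n : ℕ}

/-- The function `m ↦ m₁^{ℓ₁} ⋯ mₙ^{ℓₙ} λ₁^{m₁} ⋯ λₙ^{mₙ}`. -/
def expMonomial (p : (Fin n → ℕ) × (Fin n → ℂˣ)) (m : Fin n → ℤ) : ℂ :=
  (∏ i, (m i : ℂ) ^ p.1 i) * ∏ i, (p.2 i : ℂ) ^ m i

/-- The functional on `A` with values `expMonomial p m` on the monomials `t^m`. -/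
def expFunctional (p : (Fin n → ℕ) × (Fin n → ℂˣ)) : Module.Dual ℂ (Laurent n) :=
  (monoBasis n).constr ℂ (expMonomial p)

theorem expFunctional_mono (p : (Fin n → ℕ) × (Fin n → ℂˣ)) (m : Fin n → ℤ) :
    expFunctional p (mono m) = expMonomial p m := by
  rw [expFunctional, ← monoBasis_apply, Module.Basis.constr_basis]

/-- The largest ideal of `A` in the kernel of `expFunctional p`. -/
def expIdeal (p : (Fin n → ℕ) × (Fin n → ℂˣ)) : Ideal (Laurent n) where
  carrier := {a | ∀ b : Laurent n, expFunctional p (a * b) = 0}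
  add_mem' := fun ha hb b => by rw [add_mul, map_add, ha, hb, add_zero]
  zero_mem' := fun b => by rw [zero_mul, map_zero]
  smul_mem' := fun c a ha b => by rw [smul_eq_mul, mul_comm c, mul_assoc]; exact ha _

theorem prod_zpow_add (l : Fin n → ℂˣ) (m k : Fin n → ℤ) :
    ∏ i, (l i : ℂ) ^ (m + k) i = (∏ i, (l i : ℂ) ^ m i) * ∏ i, (l i : ℂ) ^ k i := by
  rw [← Finset.prod_mul_distrib]
  exact Finset.prod_congr rfl fun i _ => zpow_add₀ (l i).ne_zero _ _

theorem prod_zpow_single (l : Fin n → ℂˣ) (i : Fin n) (k : ℤ) :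
    ∏ j, (l j : ℂ) ^ (Pi.single i k : Fin n → ℤ) j = (l i : ℂ) ^ k := by
  rw [Finset.prod_eq_single i, Pi.single_eq_same]
  · intro j _ hj
    rw [Pi.single_eq_of_ne hj, zpow_zero]
  · simp

/-- On functions of m, multiplication by t_i is the shift m ↦ m + e_i. After pulling out λ^m, the
factor t_i - λ_i becomes λ_i times the forward difference in the i-th coordinate. -/
theorem expFunctional_pow_mul (p : (Fin n → ℕ) × (Fin n → ℂˣ)) (i : Fin n) (N : ℕ)
    (m : Fin n → ℤ) :
    expFunctional p ((mono (Pi.single i 1) - algebraMap ℂ (Laurent n) (p.2 i)) ^ N * mono m) =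
      (p.2 i : ℂ) ^ N * (∏ j, (p.2 j : ℂ) ^ m j) *
        (∏ j ∈ Finset.univ.erase i, (m j : ℂ) ^ p.1 j) *
          ((fwdDiff (1 : ℂ))^[N] fun x => x ^ p.1 i) (m i) := by
  induction N generalizing m with
  | zero =>
    rw [pow_zero, one_mul, expFunctional_mono, expMonomial, pow_zero, one_mul,
      Function.iterate_zero, id, ← Finset.mul_prod_erase _ _ (Finset.mem_univ i)]
    ring
  | succ N ih =>
    have hsplit : (mono (Pi.single i 1) - algebraMap ℂ (Laurent n) (p.2 i)) ^ (N + 1) * mono m =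
        (mono (Pi.single i 1) - algebraMap ℂ (Laurent n) (p.2 i)) ^ N * mono (m + Pi.single i 1) -
          (p.2 i : ℂ) • ((mono (Pi.single i 1) - algebraMap ℂ (Laurent n) (p.2 i)) ^ N *
            mono m) := by
      rw [← mono_mul, Algebra.smul_def]; ring
    have hG : ∏ j ∈ Finset.univ.erase i, (((m + Pi.single i 1 : Fin n → ℤ) j : ℤ) : ℂ) ^ p.1 j =
        ∏ j ∈ Finset.univ.erase i, (m j : ℂ) ^ p.1 j := by
      refine Finset.prod_congr rfl fun j hj => ?_
      rw [Pi.add_apply, Pi.single_eq_of_ne (Finset.ne_of_mem_erase hj), add_zero]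
    rw [hsplit, map_sub, map_smul, ih, ih, hG, prod_zpow_add, prod_zpow_single, zpow_one,
      Function.iterate_succ_apply', fwdDiff, Pi.add_apply, Pi.single_eq_same, Int.cast_add,
      Int.cast_one, smul_eq_mul]
    ring

theorem pow_mem_expIdeal (p : (Fin n → ℕ) × (Fin n → ℂˣ)) (i : Fin n) :
    (mono (Pi.single i 1) - algebraMap ℂ (Laurent n) (p.2 i)) ^ (p.1 i + 1) ∈ expIdeal p := by
  intro b
  have hb : b ∈ Submodule.span ℂ (Set.range (monoBasis n)) :=
    (monoBasis n).span_eq ▸ Submodule.mem_top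
  induction hb using Submodule.span_induction with
  | mem b hb =>
    obtain ⟨m, rfl⟩ := hb
    -- The exponent ℓ_i + 1 exceeds the degree of x^{ℓ_i}, so the iterated difference vanishes.
    rw [monoBasis_apply, expFunctional_pow_mul, fwdDiff_iter_pow_eq_zero_of_lt (Nat.lt_succ_self _)]
    simp
  | zero => rw [mul_zero, map_zero]
  | add a b _ _ ha hb => rw [mul_add, map_add, ha, hb, add_zero]
  | smul c a _ ha => rw [mul_smul_comm, map_smul, ha, smul_zero]

/-- In a coordinate where the exponents differ, t_i - λ_i and t_i - μ_i differ by a unit, so their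
powers are coprime too. -/
theorem isCoprime_expIdeal {p q : (Fin n → ℕ) × (Fin n → ℂˣ)} (h : p.2 ≠ q.2) :
    IsCoprime (expIdeal p) (expIdeal q) := by
  obtain ⟨i, hi⟩ := Function.ne_iff.1 h
  have hne : (q.2 i : ℂ) - p.2 i ≠ 0 := sub_ne_zero.2 fun h => hi (Units.ext h.symm)
  have hc : IsCoprime ((mono (Pi.single i 1) : Laurent n) - algebraMap ℂ (Laurent n) (p.2 i))
      (mono (Pi.single i 1) - algebraMap ℂ (Laurent n) (q.2 i)) := by
    refine ⟨algebraMap ℂ _ ((q.2 i : ℂ) - p.2 i)⁻¹, -algebraMap ℂ _ ((q.2 i : ℂ) - p.2 i)⁻¹, ?_⟩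
    calc _ = algebraMap ℂ (Laurent n) ((q.2 i : ℂ) - p.2 i)⁻¹ *
        (algebraMap ℂ _ (q.2 i : ℂ) - algebraMap ℂ _ (p.2 i : ℂ)) := by ring
      _ = 1 := by rw [← map_sub, ← map_mul, inv_mul_cancel₀ hne, map_one]
  obtain ⟨a, b, hab⟩ := hc.pow (m := p.1 i + 1) (n := q.1 i + 1)
  exact Ideal.isCoprime_iff_exists.2 ⟨_, (expIdeal p).mul_mem_left a (pow_mem_expIdeal p i), _,
    (expIdeal q).mul_mem_left b (pow_mem_expIdeal q i), hab⟩

theorem IsExpPolyOn.add {S : Set (Fin n → ℂˣ)} {f g : (Fin n → ℤ) → ℂ} (hf : IsExpPolyOn S f)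
    (hg : IsExpPolyOn S g) : IsExpPolyOn S (f + g) := by
  classical
  obtain ⟨c, hc, hf⟩ := hf
  obtain ⟨d, hd, hg⟩ := hg
  refine ⟨c + d, fun p hp => ?_, fun m => ?_⟩
  · rcases Finset.mem_union.1 (Finsupp.support_add hp) with h | h
    exacts [hc p h, hd p h]
  · rw [Finsupp.sum_add_index' (fun p => by simp) (fun p a b => by ring), Pi.add_apply, hf, hg]

theorem IsExpPolyOn.smul {S : Set (Fin n → ℂˣ)} {f : (Fin n → ℤ) → ℂ} (a : ℂ)
    (hf : IsExpPolyOn S f) : IsExpPolyOn S (a • f) := by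
  obtain ⟨c, hc, hf⟩ := hf
  refine ⟨a • c, fun p hp => hc p (Finsupp.support_smul hp), fun m => ?_⟩
  rw [Finsupp.sum_smul_index' (fun p => by simp), Pi.smul_apply, hf, Finsupp.smul_sum]
  refine Finsupp.sum_congr fun p _ => ?_
  simp only [smul_eq_mul, mul_assoc]

theorem isExpPolyOn_zero (S : Set (Fin n → ℂˣ)) : IsExpPolyOn S (0 : (Fin n → ℤ) → ℂ) :=
  ⟨0, by simp, by simp⟩

end ExpMonomial

/-! ### Twists by roots of unity. -/

section Twist

variable {n : ℕ} {r : Fin n → ℕ} (ξ : Fin n → ℂˣ)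

/-- The scalar by which the twist by `k` multiplies `t^m`. -/
def twistScalar (k : ∀ i, ZMod (r i)) (m : Fin n → ℤ) : ℂ :=
  ∏ i, ((ξ i ^ (k i).val : ℂˣ) : ℂ) ^ m i

theorem laurentTwist_mono (k : ∀ i, ZMod (r i)) (m : Fin n → ℤ) :
    laurentTwist ξ k (mono m) = twistScalar ξ k m • mono m := by
  rw [laurentTwist, ← monoBasis_apply, Module.Basis.constr_basis, monoBasis_apply]; rfl

theorem twistScalar_add_right (k : ∀ i, ZMod (r i)) (m m' : Fin n → ℤ) :
    twistScalar ξ k (m + m') = twistScalar ξ k m * twistScalar ξ k m' :=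
  prod_zpow_add (fun i => ξ i ^ (k i).val) m m'

theorem prod_rotate_zpow (k : ∀ i, ZMod (r i)) (l : Fin n → ℂˣ) (m : Fin n → ℤ) :
    ∏ i, (rotate ξ k l i : ℂ) ^ m i = twistScalar ξ k m * ∏ i, (l i : ℂ) ^ m i := by
  rw [twistScalar, ← Finset.prod_mul_distrib]
  refine Finset.prod_congr rfl fun i _ => ?_
  rw [rotate, Units.val_mul, mul_zpow]

theorem laurentTwist_mul (k : ∀ i, ZMod (r i)) (a b : Laurent n) :
    laurentTwist ξ k (a * b) = laurentTwist ξ k a * laurentTwist ξ k b := by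
  have h : ∀ a : Laurent n, a ∈ Submodule.span ℂ (Set.range (monoBasis n)) := fun a =>
    (monoBasis n).span_eq ▸ Submodule.mem_top
  induction h a using Submodule.span_induction with
  | zero => rw [zero_mul, map_zero, zero_mul]
  | add a a' _ _ ha ha' => rw [add_mul, map_add, map_add, add_mul, ha, ha']
  | smul c a _ ha => rw [smul_mul_assoc, map_smul, map_smul, smul_mul_assoc, ha]
  | mem a ha =>
    obtain ⟨m, rfl⟩ := ha
    induction h b using Submodule.span_induction with
    | zero => rw [mul_zero, map_zero, mul_zero]
    | add a a' _ _ ha ha' => rw [mul_add, map_add, map_add, mul_add, ha, ha']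
    | smul c a _ ha => rw [mul_smul_comm, map_smul, map_smul, mul_smul_comm, ha]
    | mem b hb =>
      obtain ⟨m', rfl⟩ := hb
      rw [monoBasis_apply, monoBasis_apply, mono_mul, laurentTwist_mono, laurentTwist_mono,
        laurentTwist_mono, smul_mul_smul_comm, mono_mul, twistScalar_add_right]

variable {ξ}

/-- The twists fix the subalgebra `ℂ[t₁^{±r₁}, …, tₙ^{±rₙ}]`. -/
theorem laurentTwist_eq_self (hξ : ∀ i, IsPrimitiveRoot (ξ i) (r i)) (k : ∀ i, ZMod (r i))
    {a : Laurent n} (ha : a ∈ powerSubalgebra r) : laurentTwist ξ k a = a := by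
  have hroot : ∀ i, (ξ i ^ (k i).val) ^ r i = 1 := fun i => by
    rw [pow_right_comm, (hξ i).pow_eq_one, one_pow]
  have hpos : ∀ i, twistScalar ξ k (Pi.single i (r i : ℤ)) = 1 := fun i => by
    refine (prod_zpow_single (fun i => ξ i ^ (k i).val) i _).trans ?_
    rw [zpow_natCast, ← Units.val_pow_eq_pow_val, hroot, Units.val_one]
  have hneg : ∀ i, twistScalar ξ k (Pi.single i (-(r i : ℤ))) = 1 := fun i => by
    refine (prod_zpow_single (fun i => ξ i ^ (k i).val) i _).trans ?_
    rw [zpow_neg, zpow_natCast, ← Units.val_pow_eq_pow_val, hroot, Units.val_one, inv_one]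
  have hone : laurentTwist ξ k 1 = 1 := by
    rw [← mono_zero, laurentTwist_mono]
    simp [twistScalar]
  induction ha using Algebra.adjoin_induction with
  | mem a ha =>
    rcases ha with ⟨i, rfl⟩ | ⟨i, rfl⟩
    · change laurentTwist ξ k (mono _) = mono _
      rw [laurentTwist_mono, hpos, one_smul]
    · change laurentTwist ξ k (mono _) = mono _
      rw [laurentTwist_mono, hneg, one_smul]
  | algebraMap c => rw [Algebra.algebraMap_eq_smul_one, map_smul, hone]
  | add a b _ _ ha hb => rw [map_add, ha, hb]
  | mul a b _ _ ha hb => rw [laurentTwist_mul, ha, hb]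

theorem twistScalar_add_left [∀ i, NeZero (r i)] (hξ : ∀ i, IsPrimitiveRoot (ξ i) (r i))
    (k k' : ∀ i, ZMod (r i)) (m : Fin n → ℤ) :
    twistScalar ξ (k + k') m = twistScalar ξ k m * twistScalar ξ k' m := by
  rw [twistScalar, twistScalar, twistScalar, ← Finset.prod_mul_distrib]
  refine Finset.prod_congr rfl fun i _ => ?_
  have : ξ i ^ ((k + k') i).val = ξ i ^ (k i).val * ξ i ^ (k' i).val := by
    rw [← pow_add, Pi.add_apply, ZMod.val_add]
    exact (pow_eq_pow_mod _ (hξ i).pow_eq_one).symm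
  rw [this, Units.val_mul, mul_zpow]

/-- Uniqueness of representatives forces b = b'; then primitivity of the ξ_i, that is, freeness of
the action, forces k = k'. -/
theorem rotate_injOn [∀ i, NeZero (r i)] (hξ : ∀ i, IsPrimitiveRoot (ξ i) (r i))
    {B : Set (Fin n → ℂˣ)} (hB : IsTransversal r ξ B) {k k' : ∀ i, ZMod (r i)}
    {b b' : Fin n → ℂˣ} (hb : b ∈ B) (hb' : b' ∈ B) (h : rotate ξ k b = rotate ξ k' b') :
    k = k' := by
  have hbb : b = b' := (hB (rotate ξ k b)).unique ⟨hb, k, rfl⟩ ⟨hb', k', h⟩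
  subst hbb
  funext i
  have hi : ξ i ^ (k i).val = ξ i ^ (k' i).val := mul_right_cancel (congrFun h i)
  exact ZMod.val_injective _ ((hξ i).pow_inj (ZMod.val_lt _) (ZMod.val_lt _) hi)

end Twist

/-! ### Exp-polynomial weights and their decomposition. -/

section Functionals

variable {ι : Type u} [Fintype ι] {C : Matrix ι ι ℤ} {H : Type v} [AddCommGroup H] [Module ℂ H]
  {Z : Realization C H} {n : ℕ} {H2 : Submodule ℂ (KM Z)}

/-- The functional `a ↦ ψ(h ⊗ a)`. -/
def componentLin (ψ : Module.Dual ℂ (LoopCartan Z n H2)) (h : cartan' Z) :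
    Module.Dual ℂ (Laurent n) :=
  ψ ∘ₗ LinearMap.inl ℂ _ _ ∘ₗ (TensorProduct.mk ℂ (Laurent n) (cartan' Z)).flip h

theorem componentLin_apply (ψ : Module.Dual ℂ (LoopCartan Z n H2)) (h : cartan' Z)
    (a : Laurent n) : componentLin ψ h a = ψ (a ⊗ₜ[ℂ] h, 0) := rfl

theorem component_add (ψ : Module.Dual ℂ (LoopCartan Z n H2)) (h h' : cartan' Z) :
    component ψ (h + h') = component ψ h + component ψ h' := by
  funext m
  change ψ (mono m ⊗ₜ[ℂ] (h + h'), 0) = ψ (mono m ⊗ₜ[ℂ] h, 0) + ψ (mono m ⊗ₜ[ℂ] h', 0)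
  rw [← map_add, Prod.mk_add_mk, add_zero, TensorProduct.tmul_add]

theorem component_smul (ψ : Module.Dual ℂ (LoopCartan Z n H2)) (c : ℂ) (h : cartan' Z) :
    component ψ (c • h) = c • component ψ h := by
  funext m
  change ψ (mono m ⊗ₜ[ℂ] (c • h), 0) = c • ψ (mono m ⊗ₜ[ℂ] h, 0)
  rw [← map_smul, Prod.smul_mk, smul_zero, TensorProduct.tmul_smul]

theorem component_zero (ψ : Module.Dual ℂ (LoopCartan Z n H2)) : component ψ 0 = 0 := by
  have := component_smul ψ 0 0
  rwa [zero_smul, zero_smul] at this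

theorem finite_cartan' (Z : Realization C H) : Module.Finite ℂ (cartan' Z) := by
  have := Z.finiteDimensional
  have h : FiniteDimensional ℂ (cartan Z) := by
    rw [cartan_eq]; infer_instance
  exact Submodule.finiteDimensional_of_le (inf_le_left : cartan' Z ≤ cartan Z)

/-- `weightIdeal ψ` contains a finite intersection of ideals `expIdeal p` with exponents `p.2`
in `S` if `ψ` is exp-polynomial with exponents in `S`. -/
theorem exists_iInf_expIdeal_le {S : Set (Fin n → ℂˣ)} {ψ : Module.Dual ℂ (LoopCartan Z n H2)}
    (hψ : ExpPolyOn S ψ) : ∃ P : Finset ((Fin n → ℕ) × (Fin n → ℂˣ)), (∀ p ∈ P, p.2 ∈ S) ∧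
      ⨅ p ∈ P, expIdeal p ≤ weightIdeal ψ := by
  classical
  -- Finite dimension of h' ensures that finitely many exponential monomials describe all components
  -- at once.
  have := finite_cartan' Z
  let β := Module.finBasis ℂ (cartan' Z)
  choose c hc hcm using fun j => hψ (β j)
  refine ⟨Finset.univ.biUnion fun j => (c j).support, fun p hp => ?_, fun a ha b h => ?_⟩
  · obtain ⟨j, _, hj⟩ := Finset.mem_biUnion.1 hp
    exact hc j p hj
  · have hj : ∀ j, componentLin ψ (β j) = ∑ p ∈ (c j).support, c j p • expFunctional p := by
      intro j
      refine (monoBasis n).ext fun m => ?_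
      rw [monoBasis_apply, LinearMap.sum_apply]
      refine (hcm j m).trans (Finset.sum_congr rfl fun p _ => ?_)
      rw [LinearMap.smul_apply, expFunctional_mono, expMonomial, smul_eq_mul]
      exact mul_assoc _ _ _
    have hz : ∀ j, ψ ((a * b) ⊗ₜ[ℂ] β j, 0) = 0 := by
      intro j
      rw [← componentLin_apply, hj, LinearMap.sum_apply]
      refine Finset.sum_eq_zero fun p hp => ?_
      have hap : a ∈ expIdeal p := by
        rw [Submodule.mem_iInf] at ha
        exact (Submodule.mem_iInf _).1 (ha p) (Finset.mem_biUnion.2 ⟨j, Finset.mem_univ j, hp⟩)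
      rw [LinearMap.smul_apply, hap b, smul_zero]
    have hlin : ψ ∘ₗ LinearMap.inl ℂ _ _ ∘ₗ TensorProduct.mk ℂ (Laurent n) (cartan' Z) (a * b) =
        0 := β.ext hz
    exact LinearMap.congr_fun hlin h

theorem isCoprime_weightIdeal {S T : Set (Fin n → ℂˣ)} {ψ φ : Module.Dual ℂ (LoopCartan Z n H2)}
    (hψ : ExpPolyOn S ψ) (hφ : ExpPolyOn T φ) (hST : Disjoint S T) :
    IsCoprime (weightIdeal ψ) (weightIdeal φ) := by
  obtain ⟨P, hP, hPψ⟩ := exists_iInf_expIdeal_le hψ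
  obtain ⟨Q, hQ, hQφ⟩ := exists_iInf_expIdeal_le hφ
  have h : IsCoprime (⨅ p ∈ P, expIdeal p) (⨅ q ∈ Q, expIdeal q) :=
    Ideal.isCoprime_biInf fun q hq => IsCoprime.symm (Ideal.isCoprime_biInf fun p hp =>
      isCoprime_expIdeal fun h => Set.disjoint_left.1 hST (hP p hp) (h ▸ hQ q hq))
  rw [Ideal.isCoprime_iff_exists] at h ⊢
  obtain ⟨i, hi, j, hj, hij⟩ := h
  exact ⟨i, hPψ hi, j, hQφ hj, hij⟩

variable {r : Fin n → ℕ} {ξ : Fin n → ℂˣ}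

theorem component_twist (k : ∀ i, ZMod (r i)) (Φ : Module.Dual ℂ (LoopCartan Z n H2))
    (h : cartan' Z) (m : Fin n → ℤ) :
    component (twist ξ k Φ) h m = twistScalar ξ k m * component Φ h m := by
  change Φ (LinearMap.rTensor (cartan' Z) (laurentTwist ξ k) (mono m ⊗ₜ[ℂ] h), 0) =
    twistScalar ξ k m • Φ (mono m ⊗ₜ[ℂ] h, 0)
  rw [LinearMap.rTensor_tmul, laurentTwist_mono, ← map_smul, Prod.smul_mk, smul_zero,
    TensorProduct.smul_tmul']

theorem twist_inr (k : ∀ i, ZMod (r i)) (Φ : Module.Dual ℂ (LoopCartan Z n H2)) (y : H2) :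
    twist ξ k Φ (0, y) = Φ (0, y) := by
  change Φ (LinearMap.rTensor (cartan' Z) (laurentTwist ξ k) 0, y) = Φ (0, y)
  rw [map_zero]

theorem expPolyOn_twist {B : Set (Fin n → ℂˣ)} {Φ : Module.Dual ℂ (LoopCartan Z n H2)}
    (hΦ : ExpPolyOn B Φ) (k : ∀ i, ZMod (r i)) : ExpPolyOn (rotate ξ k '' B) (twist ξ k Φ) := by
  classical
  intro h
  obtain ⟨c, hc, hcm⟩ := hΦ h
  refine ⟨c.mapDomain fun p => (p.1, rotate ξ k p.2), fun p hp => ?_, fun m => ?_⟩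
  · obtain ⟨q, hq, rfl⟩ := Finset.mem_image.1 (Finsupp.mapDomain_support hp)
    exact ⟨q.2, hc q hq, rfl⟩
  · rw [Finsupp.sum_mapDomain_index (fun p => by simp) (fun p a b => by ring), component_twist,
      hcm, Finsupp.mul_sum]
    refine Finsupp.sum_congr fun p _ => ?_
    rw [prod_rotate_zpow]
    ring

theorem dual_ext {J : Type*} (β : Module.Basis J ℂ (cartan' Z))
    {φ ψ : Module.Dual ℂ (LoopCartan Z n H2)}
    (h₁ : ∀ j m, component φ (β j) m = component ψ (β j) m)
    (h₂ : ∀ y, φ (0, y) = ψ (0, y)) : φ = ψ := by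
  refine LinearMap.prod_ext (((monoBasis n).tensorProduct β).ext fun p => ?_) (LinearMap.ext h₂)
  rw [Module.Basis.tensorProduct_apply, monoBasis_apply]
  exact h₁ p.2 p.1

/-- The element ψ_h(m) t^m lies in A_ψ and so is fixed by the twists; compare the coefficients of
t^m. -/
theorem twistScalar_mul_component (hξ : ∀ i, IsPrimitiveRoot (ξ i) (r i))
    {ψ : Module.Dual ℂ (LoopCartan Z n H2)} (hA : imageAlgebra ψ ≤ powerSubalgebra r)
    (k : ∀ i, ZMod (r i)) (h : cartan' Z) (m : Fin n → ℤ) :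
    twistScalar ξ k m * component ψ h m = component ψ h m := by
  have hmem : component ψ h m • mono m ∈ powerSubalgebra r :=
    hA (Algebra.subset_adjoin ⟨(h, m), rfl⟩)
  have := congrArg ((monoBasis n).coord m) (laurentTwist_eq_self hξ k hmem)
  simp only [map_smul, laurentTwist_mono] at this
  rw [← monoBasis_apply, Module.Basis.coord_apply, Module.Basis.repr_self,
    Finsupp.single_eq_same] at this
  simp only [smul_eq_mul, mul_one] at this
  rw [mul_comm]; exact this

/-- Existence of the decomposition `ψ = ∑ ξ^k Φ`. -/
theorem exists_isDecomposition [∀ i, NeZero (r i)] (hξ : ∀ i, IsPrimitiveRoot (ξ i) (r i))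
    {B : Set (Fin n → ℂˣ)} (hB : IsTransversal r ξ B) {ψ : Module.Dual ℂ (LoopCartan Z n H2)}
    (hψ : ExpPoly ψ) (hA : imageAlgebra ψ ≤ powerSubalgebra r) :
    ∃ Φ, IsDecomposition r ξ B ψ Φ := by
  classical
  let β := Module.Basis.ofVectorSpace ℂ (cartan' Z)
  choose c _ hcm using fun j => hψ (β j)
  choose b hb hbk using fun l => (hB l).exists
  let R : ℂ := (Fintype.card (∀ i, ZMod (r i)) : ℂ)
  have hR : R ≠ 0 := Nat.cast_ne_zero.2 Fintype.card_ne_zero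
  -- The component ψ_h with each exponent replaced by its representative, divided by R to compensate
  -- for the sum over the R twists. On h'', where twists act trivially, the same factor is used.
  let g : _ → (Fin n → ℤ) → ℂ := fun j m =>
    R⁻¹ * (c j).sum fun p z => z * expMonomial (p.1, b p.2) m
  let Φ : Module.Dual ℂ (LoopCartan Z n H2) :=
    (((monoBasis n).tensorProduct β).constr ℂ fun p => g p.2 p.1).coprod
      (R⁻¹ • ψ ∘ₗ LinearMap.inr ℂ _ _)
  have hΦβ : ∀ j m, component Φ (β j) m = g j m := by
    intro j m
    change (((monoBasis n).tensorProduct β).constr ℂ fun p => g p.2 p.1) (mono m ⊗ₜ[ℂ] β j) +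
      (R⁻¹ • ψ ∘ₗ LinearMap.inr ℂ _ _) 0 = g j m
    rw [map_zero, add_zero, ← monoBasis_apply, ← Module.Basis.tensorProduct_apply,
      Module.Basis.constr_basis]
  have hΦH : ∀ y, Φ (0, y) = R⁻¹ * ψ (0, y) := by
    intro y
    change (((monoBasis n).tensorProduct β).constr ℂ fun p => g p.2 p.1) 0 +
      R⁻¹ * ψ (0, y) = _
    rw [map_zero, zero_add]
  -- After summation over the group only the orbit of an exponent matters: translating k by k₀
  -- absorbs the passage from b(λ) to λ.
  have hsum : ∀ l m, ∑ k : (∀ i, ZMod (r i)), twistScalar ξ k m * ∏ i, (b l i : ℂ) ^ m i =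
      ∑ k : (∀ i, ZMod (r i)), twistScalar ξ k m * ∏ i, (l i : ℂ) ^ m i := by
    intro l m
    obtain ⟨k₀, hk₀⟩ := hbk l
    have hl : ∏ i, (l i : ℂ) ^ m i = twistScalar ξ k₀ m * ∏ i, (b l i : ℂ) ^ m i := by
      rw [← prod_rotate_zpow, ← hk₀]
    rw [hl, ← Equiv.sum_comp (Equiv.addRight k₀)]
    refine Finset.sum_congr rfl fun k _ => ?_
    rw [Equiv.coe_addRight, twistScalar_add_left hξ, mul_assoc]
  refine ⟨Φ, fun h => ?_, dual_ext β (fun j m => ?_) fun y => ?_⟩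
  · induction β.mem_span h using Submodule.span_induction with
    | zero => rw [component_zero]; exact isExpPolyOn_zero B
    | add h h' _ _ hh hh' => rw [component_add]; exact hh.add hh'
    | smul a h _ hh => rw [component_smul]; exact hh.smul a
    | mem h hh =>
      obtain ⟨j, rfl⟩ := hh
      have : component Φ (β j) =
          R⁻¹ • fun m => (c j).sum fun p z => z * expMonomial (p.1, b p.2) m := funext (hΦβ j)
      rw [this]
      refine IsExpPolyOn.smul _ ⟨(c j).mapDomain fun p => (p.1, b p.2), fun p hp => ?_, fun m => ?_⟩
      · obtain ⟨q, _, rfl⟩ := Finset.mem_image.1 (Finsupp.mapDomain_support hp)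
        exact hb q.2
      · rw [Finsupp.sum_mapDomain_index (fun p => by simp) (fun p a b => by ring)]
        refine Finsupp.sum_congr fun p _ => ?_
        rw [expMonomial, mul_assoc]
  · have hc : component (∑ k : (∀ i, ZMod (r i)), twist ξ k Φ) (β j) m =
        ∑ k : (∀ i, ZMod (r i)), component (twist ξ k Φ) (β j) m := LinearMap.sum_apply _ _ _
    have hcm' : component ψ (β j) m = (c j).sum fun p z => z * expMonomial p m := by
      rw [hcm]
      refine Finsupp.sum_congr fun p _ => ?_
      rw [expMonomial, mul_assoc]
    have h1 : ∑ k : (∀ i, ZMod (r i)), twistScalar ξ k m * component ψ (β j) m =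
        R * component ψ (β j) m := by
      rw [Finset.sum_congr rfl fun k _ => twistScalar_mul_component hξ hA k (β j) m,
        Finset.sum_const, nsmul_eq_mul]; rfl
    have h2 : ∑ k : (∀ i, ZMod (r i)), component (twist ξ k Φ) (β j) m =
        R⁻¹ * ∑ k : (∀ i, ZMod (r i)), twistScalar ξ k m * component ψ (β j) m := by
      simp only [component_twist, hΦβ, g, hcm', Finsupp.sum, Finset.mul_sum]
      rw [Finset.sum_comm, Finset.sum_comm (s := Finset.univ)]
      refine Finset.sum_congr rfl fun p _ => ?_
      have := congrArg (fun z => R⁻¹ * (c j p * ((∏ i, (m i : ℂ) ^ p.1 i) * z))) (hsum p.2 m)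
      simp only [Finset.mul_sum] at this
      refine Eq.trans (Finset.sum_congr rfl fun k _ => ?_)
        (this.trans (Finset.sum_congr rfl fun k _ => ?_))
      · rw [expMonomial]; ring
      · rw [expMonomial]; ring
    rw [hc, h2, h1, inv_mul_cancel_left₀ hR]
  · rw [LinearMap.sum_apply, Finset.sum_congr rfl fun k _ => (twist_inr k Φ y).trans (hΦH y),
      Finset.sum_const, nsmul_eq_mul]
    exact (mul_inv_cancel_left₀ hR _).symm

end Functionals

end LoopKM
end

/-! ### The tensor product theorem. -/

theorem corollary3p9 {ι : Type*} [Fintype ι] {C : Matrix ι ι ℤ} (hC : LoopKM.IsGCM C)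
    {H : Type*} [AddCommGroup H] [Module ℂ H] (Z : LoopKM.Realization C H)
    (H2 : Submodule ℂ (LoopKM.KM Z)) (hH2 : LoopKM.IsCartanCompl Z H2)
    (n : ℕ) (r : Fin n → ℕ) [∀ i, NeZero (r i)]
    (ξ : Fin n → ℂˣ) (hξ : ∀ i, IsPrimitiveRoot (ξ i) (r i))
    (B : Set (Fin n → ℂˣ)) (hB : LoopKM.IsTransversal r ξ B)
    (ψ : Module.Dual ℂ (LoopKM.LoopCartan Z n H2)) (hψ : LoopKM.ExpPoly ψ)
    (hA : LoopKM.imageAlgebra ψ = LoopKM.powerSubalgebra r) :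
    (∃ Φ, LoopKM.IsDecomposition r ξ B ψ Φ) ∧
    ∀ Φ, LoopKM.IsDecomposition r ξ B ψ Φ →
      (∀ k : (∀ i, ZMod (r i)),
        LieModule.IsIrreducible ℂ (LoopKM.loopKM Z n H2) (LoopKM.V (LoopKM.twist ξ k Φ))) ∧
      Nonempty (LoopKM.V ψ ≃ₗ⁅ℂ, LoopKM.loopKM Z n H2⁆
        ⨂[ℂ] k : (∀ i, ZMod (r i)), LoopKM.V (LoopKM.twist ξ k Φ)) := by
  refine ⟨LoopKM.exists_isDecomposition hξ hB hψ hA.le, fun Φ hΦ =>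
    ⟨fun k => LoopKM.isIrreducible_V hH2 _, ?_⟩⟩
  obtain ⟨hΦB, rfl⟩ := hΦ
  refine LoopKM.nonempty_equiv_tensor hH2 fun k k' hk => ?_
  refine LoopKM.isCoprime_weightIdeal (LoopKM.expPolyOn_twist hΦB k)
    (LoopKM.expPolyOn_twist hΦB k') ?_
  -- A common exponent of two twists would be a point of both k·B and k'·B.
  rw [Set.disjoint_left]
  rintro _ ⟨b, hb, rfl⟩ ⟨b', hb', h⟩
  exact hk (LoopKM.rotate_injOn hξ hB hb hb' h.symm)
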